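/- Let $\{P_\theta\}_{\theta\in\Theta}$ be probability measures on a measurable space $\mathcal X$ with densities $p_\theta$ with respect to a common measure. Let $\widetilde P$ be a probability measure and $T_\theta$ measurable maps such that $T_\theta(\widetilde X)\sim P_\theta$ if $\widetilde X\sim\widetilde P$. Let $X_1,X_2,\dots$ be i.i.d. from $P_{\theta_0}$, $\widetilde X_1,\widetilde X_2,\dots$ i.i.d. from $\widetilde P$, fix $\theta\in\Theta$ and put $X_i^\theta=T_\theta(\widetilde X_i)$. For a measure $Q$ write $Qf=\int f\,dQ$; let $\mathbb P_nf=\frac1n\sum_{i\le n}f(X_i)$, $\mathbb P_m^\theta f=\frac1m\sum_{i\le m}f(X_i^\theta)$, $\mathbb M_{n,m}^\theta(D)=\mathbb P_n\log D+\mathbb P_m^\theta\log(1-D)$, $D_\theta=p_{\theta_0}/(p_{\theta_0}+p_\theta)$, $$h_\theta(f,g)^2=(P_{\theta_0}+P_\theta)(\sqrt f-\sqrt g)^2,\qquad d_\theta(D_1,D_2)^2=h_\theta(D_1,D_2)^2+h_\theta(1-D_1,1-D_2)^2 .$$ $O_P$ is understood in outer probability. Let $\mathcal D_n$ be sets of measurable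 functions $\mathcal X\to(0,1)$, let $\mathcal D^\theta_{n,\delta}=\{D\in\mathcal D_n: d_\theta(D,D_\theta)\le\delta\}$, let $m=m_n\geq 1$ be integers, $(\delta_n)$ a bounded sequence of positive numbers, and $\hat D_{n,m}^\theta\in\mathcal D_n$ a random element (a classifier). Let $\mathcal B$ be a collection of brackets, that is, of pairs of measurable functions $0\le\ell\le u\le1$. Let $N_{[]}(\varepsilon,\mathcal F,d_\theta)$ be the least number of brackets $(\ell,u)\in\mathcal B$ with $d_\theta(\ell,u)<\varepsilon$ such that every $f\in\mathcal F$ satisfies $\ell\le f\le u$ for one of them, and $J_{[]}(\delta,\mathcal F,d_\theta)=\int_0^\delta\sqrt{1+\log N_{[]}(\varepsilon,\mathcal F,d_\theta)}\,d\varepsilon$. Assumption 1. (a) $n/m$ converges to a finite limit; (b) $\mathbb M_{n,m}^\theta(\hat D_{n,m}^\theta)\ge\mathbb M_{n,m}^\theta(D_\theta)-O_P(\delta_n^2)$; (c) there are $\alpha<2$, $C<\infty$ and functions $\varphi_n$ such that, for all large $n$, $J_{[]}(\delta,\mathcal D^\theta_{n,\delta},d_\theta)\le\varphi_n(\delta)$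 for all $\delta>0$, $\delta\mapsto\varphi_n(\delta)/\delta^\alpha$ is non-increasing on $(0,\infty)$, and $\varphi_n(\delta_n)\le C\delta_n^2\sqrt n$. Assumption 2. (a) $P_{\theta_0}(p_{\theta_0}/p_\theta)$ and $P_{\theta_0}(p_{\theta_0}/p_\theta)^2$ are finite; (b) for every $K>0$ there is $M_K<\infty$ such that, for all large $n$, $$\sup_{D\in\mathcal D^\theta_{n,K\delta_n}}P_{\theta_0}\Bigl(\tfrac{D_\theta}{D}\Bigm|\tfrac{D_\theta}{D}\ge\tfrac{25}{16}\Bigr)\le M_K,\qquad \sup_{D\in\mathcal D^\theta_{n,K\delta_n}}P_{\theta_0}\Bigl(\tfrac{1-D_\theta}{1-D}\Bigm|\tfrac{1-D_\theta}{1-D}\ge\tfrac{25}{16}\Bigr)\le M_K,$$ where a conditional expectation given a null event is $0$; (c) over $(\ell,u)\in\mathcal B$, one has $\ell>0$ and $u<1$ $P_{\theta_0}$-a.s., $P_{\theta_0}(\sqrt{u/\ell}-1)^2=O(d_\theta(u,\ell)^2)$, and $P_{\theta_0}(\sqrt{(1-\ell)/(1-u)}-1)^2=o(d_\theta(u,\ell))$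 as $d_\theta(u,\ell)\to0$, uniformly over $\mathcal B$. Theorem. Under Assumptions 1 and 2, the log-posterior residual $u_\theta=\sum_{i=1}^n\bigl(\log\frac{1-\hat D_{n,m}^\theta(X_i)}{1-D_\theta(X_i)}-\log\frac{\hat D_{n,m}^\theta(X_i)}{D_\theta(X_i)}\bigr)$ satisfies $$\frac{u_\theta}{n}=\mathbb P_n\Bigl(\log\frac{1-\hat D_{n,m}^\theta}{1-D_\theta}-\log\frac{\hat D_{n,m}^\theta}{D_\theta}\Bigr)=O_P(\delta_n).$$ -/

import Mathlib

open MeasureTheory ProbabilityTheory Filter Set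
open scoped ENNReal NNReal Topology

noncomputable section

namespace MHC

/-- A dominated statistical model `(P_θ)` on `𝒳` together with a generator: the maps `T θ` push
the latent law forward to `P_θ`, the law with density `density θ` with respect to `μ`. -/
structure GenerativeModel (Θ 𝒳 𝒵 : Type*) [MeasurableSpace 𝒳] [MeasurableSpace 𝒵] where
  μ : Measure 𝒳
  density : Θ → 𝒳 → ℝ≥0
  measurable_density : ∀ θ, Measurable (density θ)
  lintegral_density : ∀ θ, ∫⁻ x, (density θ x : ℝ≥0∞) ∂μ = 1
  latent : Measure 𝒵
  latent_prob : IsProbabilityMeasure latent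
  T : Θ → 𝒵 → 𝒳
  measurable_T : ∀ θ, Measurable (T θ)
  map_T : ∀ θ, latent.map (T θ) = μ.withDensity (fun x => (density θ x : ℝ≥0∞))

/-- `Z_n = O_P(r_n)`. The measure of a set that need not be measurable is its outer measure. -/
def IsBigOP {Ω : Type*} [MeasurableSpace Ω] (Pr : Measure Ω)
    (Z : ℕ → Ω → ℝ) (r : ℕ → ℝ) : Prop :=
  ∀ ε : ℝ, 0 < ε → ∃ K : ℝ, ∀ᶠ n in atTop, Pr {ω | K * r n < |Z n ω|} ≤ ENNReal.ofReal ε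

/-- The mean `N⁻¹ ∑ f (Y_i)` over the first `N` observations. -/
def empMean {𝒳 : Type*} (N : ℕ) (Y : ℕ → 𝒳) (f : 𝒳 → ℝ) : ℝ :=
  (∑ i ∈ Finset.range N, f (Y i)) / (N : ℝ)

/-- A bracket: measurable functions `ℓ ≤ u` (first and second component) with values in `[0,1]`. -/
def IsBracket {𝒳 : Type*} [MeasurableSpace 𝒳] (b : (𝒳 → ℝ) × (𝒳 → ℝ)) : Prop :=
  Measurable b.1 ∧ Measurable b.2 ∧ ∀ x, 0 ≤ b.1 x ∧ b.1 x ≤ b.2 x ∧ b.2 x ≤ 1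

/-- The minimal number of brackets from the collection `𝓑`, of `d`-size less than `ε`, that are
needed to cover `F` (`⊤` if no finite number suffices). -/
def bracketingNumber {𝒳 : Type*} (𝓑 : Set ((𝒳 → ℝ) × (𝒳 → ℝ)))
    (ε : ℝ) (F : Set (𝒳 → ℝ)) (d : (𝒳 → ℝ) → (𝒳 → ℝ) → ℝ) : ℕ∞ :=
  ⨅ (S : Finset ((𝒳 → ℝ) × (𝒳 → ℝ)))
    (_ : (∀ b ∈ S, b ∈ 𝓑 ∧ d b.1 b.2 < ε) ∧
      ∀ f ∈ F, ∃ b ∈ S, ∀ x, b.1 x ≤ f x ∧ f x ≤ b.2 x), (S.card : ℕ∞)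

/-- `√(1 + log N)`, infinite if `N` is infinite. -/
def sqrtEntropy (N : ℕ∞) : ℝ≥0∞ :=
  if N = ⊤ then ⊤ else ENNReal.ofReal (Real.sqrt (1 + Real.log (N.toNat : ℝ)))

/-- The bracketing entropy integral `∫₀^δ √(1 + log N_[](ε, F, d)) dε`, with brackets from `𝓑`. -/
def bracketingIntegral {𝒳 : Type*} (𝓑 : Set ((𝒳 → ℝ) × (𝒳 → ℝ)))
    (δ : ℝ) (F : Set (𝒳 → ℝ)) (d : (𝒳 → ℝ) → (𝒳 → ℝ) → ℝ) : ℝ≥0∞ :=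
  ∫⁻ ε in Ioc 0 δ, sqrtEntropy (bracketingNumber 𝓑 ε F d)

namespace GenerativeModel

variable {Θ 𝒳 𝒵 : Type*} [MeasurableSpace 𝒳] [MeasurableSpace 𝒵]

/-- The law `P_θ`. -/
def law (G : GenerativeModel Θ 𝒳 𝒵) (θ : Θ) : Measure 𝒳 :=
  G.μ.withDensity (fun x => (G.density θ x : ℝ≥0∞))

/-- The oracle classifier `D_θ = p_{θ₀} / (p_{θ₀} + p_θ)`. -/
def oracle (G : GenerativeModel Θ 𝒳 𝒵) (θ₀ θ : Θ) (x : 𝒳) : ℝ :=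
  (G.density θ₀ x : ℝ) / ((G.density θ₀ x : ℝ) + (G.density θ x : ℝ))

/-- `h_θ(f, g) = √((P_{θ₀} + P_θ)(√f - √g)²)`. -/
def hell (G : GenerativeModel Θ 𝒳 𝒵) (θ₀ θ : Θ) (f g : 𝒳 → ℝ) : ℝ :=
  Real.sqrt (∫ x, (Real.sqrt (f x) - Real.sqrt (g x)) ^ 2 ∂(G.law θ₀ + G.law θ))

/-- `d_θ(D₁, D₂) = √(h_θ(D₁, D₂)² + h_θ(1 - D₁, 1 - D₂)²)`. -/
def dist (G : GenerativeModel Θ 𝒳 𝒵) (θ₀ θ : Θ) (D₁ D₂ : 𝒳 → ℝ) : ℝ :=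
  Real.sqrt (G.hell θ₀ θ D₁ D₂ ^ 2 +
    G.hell θ₀ θ (fun x => 1 - D₁ x) (fun x => 1 - D₂ x) ^ 2)

/-- The classifiers of the sieve at distance at most `δ` from the oracle. -/
def sieveBall (G : GenerativeModel Θ 𝒳 𝒵) (θ₀ θ : Θ) (𝒟 : Set (𝒳 → ℝ)) (δ : ℝ) :
    Set (𝒳 → ℝ) :=
  {D ∈ 𝒟 | G.dist θ₀ θ D (G.oracle θ₀ θ) ≤ δ}

/-- The empirical cross-entropy `M(D) = P_n log D + P_m^θ log (1 - D)` of the real data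
`Y_0, …, Y_{n-1}` and of the fake data `T_θ Z_0, …, T_θ Z_{m-1}`. -/
def crossEntropy (G : GenerativeModel Θ 𝒳 𝒵) (θ : Θ) (n m : ℕ) (Y : ℕ → 𝒳) (Z : ℕ → 𝒵)
    (D : 𝒳 → ℝ) : ℝ :=
  empMean n Y (fun x => Real.log (D x)) +
    empMean m (fun i => G.T θ (Z i)) (fun x => Real.log (1 - D x))

/-- The summand of the log-posterior residual of a classifier `D`:
`log ((1 - D) / (1 - D_θ)) - log (D / D_θ)`. -/
def residualTerm (G : GenerativeModel Θ 𝒳 𝒵) (θ₀ θ : Θ) (D : 𝒳 → ℝ) (x : 𝒳) : ℝ :=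
  Real.log ((1 - D x) / (1 - G.oracle θ₀ θ x)) - Real.log (D x / G.oracle θ₀ θ x)

/-- The log-posterior residual `u_θ` of a classifier `D` for the data `Y_0, …, Y_{n-1}`. -/
def residual (G : GenerativeModel Θ 𝒳 𝒵) (θ₀ θ : Θ) (n : ℕ) (Y : ℕ → 𝒳) (D : 𝒳 → ℝ) : ℝ :=
  ∑ i ∈ Finset.range n, G.residualTerm θ₀ θ D (Y i)

/-- The observations `X_i` are i.i.d. from `P_{θ₀}`, the latent variables `Z_i` are i.i.d. from
the latent law. -/
structure IsSampling {Ω : Type*} [MeasurableSpace Ω] (G : GenerativeModel Θ 𝒳 𝒵) (θ₀ : Θ)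
    (Pr : Measure Ω) (X : ℕ → Ω → 𝒳) (Z : ℕ → Ω → 𝒵) : Prop where
  measurable_X : ∀ i, Measurable (X i)
  measurable_Z : ∀ i, Measurable (Z i)
  indep_X : iIndepFun X Pr
  indep_Z : iIndepFun Z Pr
  law_X : ∀ i, Pr.map (X i) = G.law θ₀
  law_Z : ∀ i, Pr.map (Z i) = G.latent

/-- The sieve, the approximate maximizer of the cross-entropy and the entropy bound; the entropy
is computed with brackets from the collection `𝓑`. -/
structure SieveAssumption {Ω : Type*} [MeasurableSpace Ω] (G : GenerativeModel Θ 𝒳 𝒵)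
    (θ₀ θ : Θ) (Pr : Measure Ω) (X : ℕ → Ω → 𝒳) (Z : ℕ → Ω → 𝒵) (m : ℕ → ℕ)
    (𝒟 : ℕ → Set (𝒳 → ℝ)) (Dhat : ℕ → Ω → 𝒳 → ℝ) (δ : ℕ → ℝ)
    (𝓑 : Set ((𝒳 → ℝ) × (𝒳 → ℝ))) : Prop where
  /-- `δ` is a positive bounded sequence (a rate). -/
  rate_pos : ∀ n, 0 < δ n
  rate_bdd : ∃ B : ℝ, ∀ n, δ n ≤ B
  /-- `n / m` converges. -/
  m_pos : ∀ n, 0 < m n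
  ratio : ∃ c : ℝ, Tendsto (fun n : ℕ => (n : ℝ) / (m n : ℝ)) atTop (𝓝 c)
  /-- The sieve consists of measurable functions with values in `(0,1)`. -/
  sieve : ∀ n, ∀ D ∈ 𝒟 n, Measurable D ∧ ∀ x, 0 < D x ∧ D x < 1
  Dhat_mem : ∀ n ω, Dhat n ω ∈ 𝒟 n
  /-- `M(D̂) ≥ M(D_θ) - O_P(δ_n²)`. -/
  approx_max : ∃ R : ℕ → Ω → ℝ, IsBigOP Pr R (fun n => δ n ^ 2) ∧ ∀ n ω,
    G.crossEntropy θ n (m n) (fun i => X i ω) (fun i => Z i ω) (G.oracle θ₀ θ) - R n ω ≤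
      G.crossEntropy θ n (m n) (fun i => X i ω) (fun i => Z i ω) (Dhat n ω)
  isBracket : ∀ b ∈ 𝓑, IsBracket b
  /-- The entropy integral of the sieve balls has a majorant `φ` with `φ(r) / r ^ α` decreasing
  in the radius `r`, for some `α < 2`, and with `φ(δ_n) ≲ δ_n² √n`. -/
  entropy : ∃ α : ℝ, α < 2 ∧ ∃ C : ℝ, ∃ φ : ℕ → ℝ → ℝ, ∀ᶠ n in atTop,
    (∀ r : ℝ, 0 < r →
      bracketingIntegral 𝓑 r (G.sieveBall θ₀ θ (𝒟 n) r) (G.dist θ₀ θ) ≤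
        ENNReal.ofReal (φ n r)) ∧
    AntitoneOn (fun r : ℝ => φ n r / r ^ α) (Ioi 0) ∧
    φ n (δ n) ≤ C * (δ n ^ 2 * Real.sqrt n)

/-- Tail and support compatibility. Conditioning on a null set gives the value `0`. -/
structure TailAssumption (G : GenerativeModel Θ 𝒳 𝒵) (θ₀ θ : Θ)
    (𝒟 : ℕ → Set (𝒳 → ℝ)) (δ : ℕ → ℝ) (𝓑 : Set ((𝒳 → ℝ) × (𝒳 → ℝ))) : Prop where
  /-- `P_{θ₀}(p_{θ₀} / p_θ) < ∞` and `P_{θ₀}(p_{θ₀} / p_θ)² < ∞`, where `a / 0 = ∞` for `a > 0`. -/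
  ratio_bound : ∃ M : ℝ,
    ∫⁻ x, (G.density θ₀ x : ℝ≥0∞) / (G.density θ x : ℝ≥0∞) ∂(G.law θ₀) ≤ ENNReal.ofReal M ∧
    ∫⁻ x, ((G.density θ₀ x : ℝ≥0∞) / (G.density θ x : ℝ≥0∞)) ^ 2 ∂(G.law θ₀) ≤ ENNReal.ofReal M
  /-- For every `K` the conditional tail expectations are bounded over the balls of radius
  `K δ_n`. -/
  tail_bound : ∀ K : ℝ, 0 < K → ∃ M : ℝ, ∀ᶠ n in atTop,
    ∀ D ∈ G.sieveBall θ₀ θ (𝒟 n) (K * δ n),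
      ∫⁻ x, ENNReal.ofReal (G.oracle θ₀ θ x / D x)
        ∂(G.law θ₀)[|{x | 25 / 16 ≤ G.oracle θ₀ θ x / D x}] ≤ ENNReal.ofReal M ∧
      ∫⁻ x, ENNReal.ofReal ((1 - G.oracle θ₀ θ x) / (1 - D x))
        ∂(G.law θ₀)[|{x | 25 / 16 ≤ (1 - G.oracle θ₀ θ x) / (1 - D x)}] ≤ ENNReal.ofReal M
  /-- The quotients `u / ℓ` and `(1 - ℓ) / (1 - u)` are defined almost surely. -/
  bracket_pos : ∀ b ∈ 𝓑, ∀ᵐ x ∂(G.law θ₀), 0 < b.1 x ∧ b.2 x < 1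
  /-- `P_{θ₀}(√(u / ℓ) - 1)² = O(d_θ(u, ℓ)²)` over the brackets of `𝓑`. -/
  bracket_bigO : ∃ C : ℝ, ∀ b ∈ 𝓑,
    ∫⁻ x, ENNReal.ofReal ((Real.sqrt (b.2 x / b.1 x) - 1) ^ 2) ∂(G.law θ₀) ≤
      ENNReal.ofReal (C * G.dist θ₀ θ b.2 b.1 ^ 2)
  /-- `P_{θ₀}(√((1 - ℓ) / (1 - u)) - 1)² = o(d_θ(u, ℓ))` over the brackets of `𝓑`. -/
  bracket_littleO : ∀ η : ℝ, 0 < η → ∃ r : ℝ, 0 < r ∧ ∀ b ∈ 𝓑, G.dist θ₀ θ b.2 b.1 ≤ r →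
    ∫⁻ x, ENNReal.ofReal ((Real.sqrt ((1 - b.1 x) / (1 - b.2 x)) - 1) ^ 2) ∂(G.law θ₀) ≤
      ENNReal.ofReal (η * G.dist θ₀ θ b.2 b.1)

end GenerativeModel

end MHC

end

noncomputable section

namespace MHC

/-! ### Exponential moments and maximal inequalities for finite families. -/

section FiniteMaximal

variable {Ω 𝒳 ι : Type*} [MeasurableSpace Ω] [MeasurableSpace 𝒳]

/-! ### Elementary inequalities for the exponential function -/

/-! Write `e` for the oracle `D_θ`. The proof first localizes the classifier in a ball of radius of
order `δ_n` around `e`, then bounds the residual uniformly over that ball. Both stages rest on one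
maximal inequality.

Maximal inequality. Logarithms of classifiers are unbounded, so size is measured by `bernMoment`,
the moment `P (g² exp (|g| / 2))`. For log-ratios it is comparable to Hellinger-type integrals such
as `P (√(a / b) - 1)²`. A finite family obeys a Bernstein bound (`supMeanLE_finite`). A bracketed
class is handled by chaining in which a point leaves the chain once its bracket width exceeds a
threshold (`supMeanLE_chain`). In `supMeanLE_bracketing` the bracket sizes decay like `ρ ^ q` along
the dyadic radii, and the chain has finite length `Q`.

Rate of the classifier. By concavity, `(log D - log e) / 2` is at most `midLog e D = log ((D + e) /
(2e))`, whose argument is at least `1/2` wherever `e > 0`. Thus `midLog` has Bernstein moment of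
order `d_θ(D, e)²` with no tail condition, while its expected cross-entropy is at most `-d_θ(D, e)²
/ 16`. A near-maximizer outside radius `2 ^ j δ_n` therefore forces a centered sum of relative size
`4 ^ j δ_n²`. The entropy bound makes this improbable, with probability of order `(2 ^ α / 4) ^ j`;
since `α < 2`, summing over dyadic shells gives `dist_Dhat_le`.

Residual. On the ball the residual is a difference of empirical means of `log ((1 - D) / (1 - e))`
and `log (D / e)`. Here the midpoint is not available, and the tail assumptions yield first moments
and Bernstein moments of order `δ_n` only (`logRatio_moments`). The squared logarithmic sizes of the
brackets are likewise only linear in `d_θ`, so `ρ = √(1/2)` and the full chaining series need not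
converge. Stopping at bracket radius of order `δ_n²` gives a remainder `n √(δ_n²) = n δ_n`, and the
links before it cost `√n · δ_n⁻¹ · δ_n² √n = n δ_n`, up to constants (`supMeanLE_bracketing_rate`).
Hence means and fluctuations are both `O(δ_n)`. -/

lemma exp_le_one_add_add_sq_mul_exp_abs (z : ℝ) :
    Real.exp z ≤ 1 + z + z ^ 2 * Real.exp |z| := by
  have h1 : Real.exp z - 1 ≤ z * Real.exp z := by
    have h := Real.add_one_le_exp (-z)
    have h2 : Real.exp (-z) * Real.exp z = 1 := by rw [← Real.exp_add]; simp
    nlinarith [Real.exp_pos z]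
  have h0 := Real.add_one_le_exp z
  have h3 : 1 ≤ Real.exp |z| := Real.one_le_exp (abs_nonneg z)
  rcases le_total 0 z with hz | hz
  · rw [abs_of_nonneg hz]
    nlinarith
  · nlinarith [sq_nonneg z]

/-- This is `x / 4 ≤ sinh (x / 4)`, rearranged and squared. With `x = 2 log y` the right side is `4
(y - 1)²`; this match is the reason for the exponent `1 / 2` in the Bernstein moment. -/
lemma sq_mul_exp_half_le {x : ℝ} (hx : 0 ≤ x) :
    x ^ 2 * Real.exp (x / 2) ≤ 4 * (Real.exp (x / 2) - 1) ^ 2 := by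
  have h := Real.self_le_sinh_iff.2 (by positivity : 0 ≤ x / 4)
  rw [Real.sinh_eq] at h
  have h2 : Real.exp (-(x / 4)) * Real.exp (x / 4) = 1 := by rw [← Real.exp_add]; simp
  have h3 : Real.exp (x / 2) = Real.exp (x / 4) * Real.exp (x / 4) := by
    rw [← Real.exp_add]; ring_nf
  have hp := Real.exp_pos (x / 4)
  have h4 : x * Real.exp (x / 4) ≤ 2 * (Real.exp (x / 2) - 1) := by
    rw [h3]; nlinarith
  calc x ^ 2 * Real.exp (x / 2) = (x * Real.exp (x / 4)) ^ 2 := by rw [h3]; ring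
    _ ≤ (2 * (Real.exp (x / 2) - 1)) ^ 2 := by gcongr
    _ = _ := by ring

lemma sq_le_sq_mul_exp {x c : ℝ} (hc : 0 ≤ c) : x ^ 2 ≤ x ^ 2 * Real.exp (c * |x|) :=
  le_mul_of_one_le_right (sq_nonneg x) (Real.one_le_exp (by positivity))

/-! ### Moments -/

lemma integrable_of_lintegral_ofReal_le {P : Measure 𝒳} {g : 𝒳 → ℝ} (hg : Measurable g)
    (h0 : ∀ x, 0 ≤ g x) {v : ℝ} (hv : ∫⁻ x, ENNReal.ofReal (g x) ∂P ≤ ENNReal.ofReal v) :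
    Integrable g P := by
  refine ⟨hg.aestronglyMeasurable, ?_⟩
  rw [hasFiniteIntegral_iff_ofReal (Eventually.of_forall h0)]
  exact hv.trans_lt ENNReal.ofReal_lt_top

lemma integral_le_of_lintegral_ofReal_le {P : Measure 𝒳} {g : 𝒳 → ℝ} (hg : Measurable g)
    (h0 : ∀ x, 0 ≤ g x) {v : ℝ} (hv0 : 0 ≤ v)
    (hv : ∫⁻ x, ENNReal.ofReal (g x) ∂P ≤ ENNReal.ofReal v) : ∫ x, g x ∂P ≤ v := by
  rw [integral_eq_lintegral_of_nonneg_ae (Eventually.of_forall h0) hg.aestronglyMeasurable]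
  exact ENNReal.toReal_le_of_le_ofReal hv0 hv

lemma integrable_of_sq {P : Measure 𝒳} [IsFiniteMeasure P] {g : 𝒳 → ℝ} (hg : Measurable g)
    {v : ℝ} (hv : ∫⁻ x, ENNReal.ofReal (g x ^ 2) ∂P ≤ ENNReal.ofReal v) : Integrable g P := by
  refine ((integrable_of_lintegral_ofReal_le (hg.pow_const 2) (fun x => sq_nonneg _) hv).add
    (integrable_const (1 : ℝ))).mono' hg.aestronglyMeasurable (Eventually.of_forall fun x => ?_)
  rw [Real.norm_eq_abs, Pi.add_apply, ← sq_abs (g x)]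
  nlinarith [sq_nonneg (|g x| - 1), abs_nonneg (g x)]

lemma sq_moment_le {P : Measure 𝒳} {g : 𝒳 → ℝ} {c v : ℝ} (hc : 0 ≤ c)
    (hv : ∫⁻ x, ENNReal.ofReal (g x ^ 2 * Real.exp (c * |g x|)) ∂P ≤ ENNReal.ofReal v) :
    ∫⁻ x, ENNReal.ofReal (g x ^ 2) ∂P ≤ ENNReal.ofReal v :=
  (lintegral_mono fun _ => ENNReal.ofReal_le_ofReal (sq_le_sq_mul_exp hc)).trans hv

/-- A function with a weighted exponential moment has an exponential moment. -/
lemma integral_exp_le {P : Measure 𝒳} [IsProbabilityMeasure P] {g : 𝒳 → ℝ} (hg : Measurable g)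
    {c v : ℝ} (hv0 : 0 ≤ v)
    (hv : ∫⁻ x, ENNReal.ofReal (g x ^ 2 * Real.exp (|c| * |g x|)) ∂P ≤ ENNReal.ofReal v) :
    Integrable (fun x => Real.exp (c * g x)) P ∧
      ∫ x, Real.exp (c * g x) ∂P ≤ 1 + c * ∫ x, g x ∂P + c ^ 2 * v := by
  have hm : Measurable fun x => g x ^ 2 * Real.exp (|c| * |g x|) := by fun_prop
  have h0 : ∀ x, 0 ≤ g x ^ 2 * Real.exp (|c| * |g x|) := fun x => by positivity
  have hi := integrable_of_lintegral_ofReal_le hm h0 hv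
  have hgi := integrable_of_sq hg (sq_moment_le (abs_nonneg c) hv)
  have hb : Integrable (fun x => 1 + c * g x +
      c ^ 2 * (g x ^ 2 * Real.exp (|c| * |g x|))) P :=
    ((integrable_const _).add (hgi.const_mul c)).add (hi.const_mul _)
  have hle : ∀ x, Real.exp (c * g x) ≤ 1 + c * g x +
      c ^ 2 * (g x ^ 2 * Real.exp (|c| * |g x|)) := fun x => by
    have h := exp_le_one_add_add_sq_mul_exp_abs (c * g x)
    rw [abs_mul] at h
    linarith
  have hie : Integrable (fun x => Real.exp (c * g x)) P := by
    refine hb.mono' (by fun_prop) (Eventually.of_forall fun x => ?_)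
    rw [Real.norm_of_nonneg (Real.exp_pos _).le]
    exact hle x
  refine ⟨hie, (integral_mono hie hb hle).trans ?_⟩
  have h1 : Integrable (fun x => 1 + c * g x) P := (integrable_const _).add (hgi.const_mul c)
  rw [integral_add h1 (hi.const_mul _),
    integral_add (integrable_const _) (hgi.const_mul c), integral_const_mul, integral_const_mul]
  have := integral_le_of_lintegral_ofReal_le hm h0 hv0 hv
  simp only [integral_const, probReal_univ, smul_eq_mul, mul_one]
  gcongr

/-! ### Centered sums of an i.i.d. sample -/

/-- `X` is an i.i.d. sample from `P`. -/
structure IsIIDSample (Pr : Measure Ω) (P : Measure 𝒳) (X : ℕ → Ω → 𝒳) : Prop where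
  meas : ∀ i, Measurable (X i)
  indep : iIndepFun X Pr
  law : ∀ i, Pr.map (X i) = P

/-- The centered sum `∑_{i < n} (g (Y i) - P g)`. -/
def centeredSum (P : Measure 𝒳) (n : ℕ) (Y : ℕ → 𝒳) (g : 𝒳 → ℝ) : ℝ :=
  ∑ i ∈ Finset.range n, (g (Y i) - ∫ x, g x ∂P)

lemma centeredSum_eq (P : Measure 𝒳) (n : ℕ) (Y : ℕ → 𝒳) (g : 𝒳 → ℝ) :
    centeredSum P n Y g = (∑ i ∈ Finset.range n, g (Y i)) - n * ∫ x, g x ∂P := by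
  simp [centeredSum, Finset.sum_sub_distrib]

lemma centeredSum_add (P : Measure 𝒳) (n : ℕ) (Y : ℕ → 𝒳) {f g : 𝒳 → ℝ}
    (hf : Integrable f P) (hg : Integrable g P) :
    centeredSum P n Y (fun x => f x + g x) = centeredSum P n Y f + centeredSum P n Y g := by
  rw [centeredSum_eq, centeredSum_eq, centeredSum_eq, integral_add hf hg, Finset.sum_add_distrib]
  ring

/-- Independence factorizes the moment generating function, and each centered factor is at most `exp
(-c a) (1 + c a + c² v) ≤ exp (c² v)`. The weighted moment takes the place of a sup-norm bound on
`g`. -/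
lemma IsIIDSample.integral_exp_centeredSum_le {Pr : Measure Ω} [IsProbabilityMeasure Pr]
    {P : Measure 𝒳} [IsProbabilityMeasure P] {X : ℕ → Ω → 𝒳} (hX : IsIIDSample Pr P X) (n : ℕ)
    {g : 𝒳 → ℝ} (hg : Measurable g) {c v : ℝ} (hv0 : 0 ≤ v)
    (hv : ∫⁻ x, ENNReal.ofReal (g x ^ 2 * Real.exp (|c| * |g x|)) ∂P ≤ ENNReal.ofReal v) :
    Integrable (fun ω => Real.exp (c * centeredSum P n (fun i => X i ω) g)) Pr ∧
      ∫ ω, Real.exp (c * centeredSum P n (fun i => X i ω) g) ∂Pr ≤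
        Real.exp (n * (c ^ 2 * v)) := by
  obtain ⟨hie, hle⟩ := integral_exp_le hg hv0 hv
  set a := ∫ x, g x ∂P
  have hgm : Measurable fun x => g x - a := by fun_prop
  have hind : iIndepFun (fun i ω => g (X i ω) - a) Pr :=
    hX.indep.comp (fun _ x => g x - a) (fun _ => hgm)
  have hmeas : ∀ i, Measurable fun ω => g (X i ω) - a := fun i => hgm.comp (hX.meas i)
  have hfac : ∀ y : ℝ, Real.exp (c * (y - a)) = Real.exp (-(c * a)) * Real.exp (c * y) := fun y => by
    rw [← Real.exp_add]; ring_nf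
  have hie' : Integrable (fun x => Real.exp (c * (g x - a))) P := by
    simp only [hfac]; exact hie.const_mul _
  have hi : ∀ i, Integrable (fun ω => Real.exp (c * (g (X i ω) - a))) Pr := fun i => by
    have h := hie'
    rw [← hX.law i] at h
    exact h.comp_measurable (hX.meas i)
  have hsum : ∀ ω, centeredSum P n (fun i => X i ω) g =
      (∑ i ∈ Finset.range n, fun ω => g (X i ω) - a) ω := fun ω => by
    simp [centeredSum, a]
  have hmgf : ∀ i, mgf (fun ω => g (X i ω) - a) Pr c ≤ Real.exp (c ^ 2 * v) := fun i => by
    have h1 : mgf (fun ω => g (X i ω) - a) Pr c = ∫ x, Real.exp (c * (g x - a)) ∂P := by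
      rw [← hX.law i, integral_map (hX.meas i).aemeasurable (by fun_prop)]; rfl
    rw [h1]
    simp only [hfac]
    rw [integral_const_mul]
    have h2 := Real.add_one_le_exp (c * a + c ^ 2 * v)
    calc Real.exp (-(c * a)) * ∫ x, Real.exp (c * g x) ∂P
        ≤ Real.exp (-(c * a)) * Real.exp (c * a + c ^ 2 * v) := by
          gcongr; linarith
      _ = _ := by rw [← Real.exp_add]; ring_nf
  simp only [hsum]
  refine ⟨hind.integrable_exp_mul_sum hmeas (fun i _ => hi i), ?_⟩
  have h := hind.mgf_sum hmeas (Finset.range n) (t := c)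
  change mgf _ Pr c ≤ _
  rw [h]
  calc ∏ i ∈ Finset.range n, mgf (fun ω => g (X i ω) - a) Pr c
      ≤ ∏ i ∈ Finset.range n, Real.exp (c ^ 2 * v) :=
        Finset.prod_le_prod (fun i _ => mgf_nonneg) (fun i _ => hmgf i)
    _ = _ := by rw [Finset.prod_const, Finset.card_range, ← Real.exp_nat_mul]

/-! ### Bounds for the outer mean of a supremum -/

/-- The family `V` has a measurable envelope with mean at most `B`. -/
def SupMeanLE (Pr : Measure Ω) (V : ι → Ω → ℝ) (B : ℝ) : Prop :=
  ∃ Y : Ω → ℝ≥0∞, Measurable Y ∧ (∀ᵐ ω ∂Pr, ∀ i, ENNReal.ofReal |V i ω| ≤ Y ω) ∧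
    ∫⁻ ω, Y ω ∂Pr ≤ ENNReal.ofReal B

lemma SupMeanLE.mono {Pr : Measure Ω} {V : ι → Ω → ℝ} {B B' : ℝ} (h : SupMeanLE Pr V B)
    (hB : B ≤ B') : SupMeanLE Pr V B' := by
  obtain ⟨Y, h1, h2, h3⟩ := h
  exact ⟨Y, h1, h2, h3.trans (ENNReal.ofReal_le_ofReal hB)⟩

lemma SupMeanLE.of_abs_le {Pr : Measure Ω} {V W : ι → Ω → ℝ} {B : ℝ} (h : SupMeanLE Pr V B)
    (hW : ∀ᵐ ω ∂Pr, ∀ i, |W i ω| ≤ |V i ω|) : SupMeanLE Pr W B := by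
  obtain ⟨Y, h1, h2, h3⟩ := h
  refine ⟨Y, h1, ?_, h3⟩
  filter_upwards [h2, hW] with ω h4 h5 i
  exact (ENNReal.ofReal_le_ofReal (h5 i)).trans (h4 i)

lemma SupMeanLE.of_le_add {Pr : Measure Ω} {V V' W : ι → Ω → ℝ} {B B' : ℝ} (hB : 0 ≤ B)
    (hB' : 0 ≤ B') (h : SupMeanLE Pr V B) (h' : SupMeanLE Pr V' B')
    (hW : ∀ ω i, |W i ω| ≤ |V i ω| + |V' i ω|) : SupMeanLE Pr W (B + B') := by
  obtain ⟨Y, h1, h2, h3⟩ := h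
  obtain ⟨Y', h1', h2', h3'⟩ := h'
  refine ⟨fun ω => Y ω + Y' ω, h1.add h1', ?_, ?_⟩
  · filter_upwards [h2, h2'] with ω h4 h5 i
    refine (ENNReal.ofReal_le_ofReal (hW ω i)).trans ?_
    rw [ENNReal.ofReal_add (abs_nonneg _) (abs_nonneg _)]
    exact add_le_add (h4 i) (h5 i)
  · rw [lintegral_add_left h1, ENNReal.ofReal_add hB hB']
    exact add_le_add h3 h3'

lemma SupMeanLE.const {Pr : Measure Ω} [IsProbabilityMeasure Pr] {B : ℝ} :
    SupMeanLE Pr (fun (_ : ι) (_ : Ω) => B) |B| :=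
  ⟨fun _ => ENNReal.ofReal |B|, measurable_const, Eventually.of_forall fun _ _ => le_rfl, by simp⟩

/-- Markov's inequality for a supremum. -/
lemma SupMeanLE.measure_le {Pr : Measure Ω} {V : ι → Ω → ℝ} {B : ℝ} (h : SupMeanLE Pr V B)
    {t : ℝ} (ht : 0 < t) : Pr {ω | ∃ i, t ≤ |V i ω|} ≤ ENNReal.ofReal (B / t) := by
  obtain ⟨Y, h1, h2, h3⟩ := h
  have h4 : Pr {ω | ∃ i, t ≤ |V i ω|} ≤ Pr {ω | ENNReal.ofReal t ≤ Y ω} := by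
    apply measure_mono_ae
    filter_upwards [h2] with ω hω
    rintro ⟨i, hi⟩
    exact (ENNReal.ofReal_le_ofReal hi).trans (hω i)
  refine h4.trans ((meas_ge_le_lintegral_div h1.aemeasurable (by simpa using ht)
    ENNReal.ofReal_ne_top).trans ?_)
  rw [ENNReal.ofReal_div_of_pos ht]
  gcongr

/-- The maximal inequality for a finite family of centered sums. -/
theorem IsIIDSample.supMeanLE_finite {Pr : Measure Ω} [IsProbabilityMeasure Pr]
    {P : Measure 𝒳} [IsProbabilityMeasure P] {X : ℕ → Ω → 𝒳} (hX : IsIIDSample Pr P X) (n : ℕ)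
    {g : ι → 𝒳 → ℝ} (hg : ∀ i, Measurable (g i)) (T : Finset (𝒳 → ℝ)) (hT : ∀ i, g i ∈ T)
    {N : ℝ} (hN1 : 1 ≤ N) (hN : (T.card : ℝ) ≤ N) {c v : ℝ} (hc : 0 < c) (hv0 : 0 ≤ v)
    (hv : ∀ i, ∫⁻ x, ENNReal.ofReal (g i x ^ 2 * Real.exp (c * |g i x|)) ∂P ≤
      ENNReal.ofReal v) :
    SupMeanLE Pr (fun i ω => centeredSum P n (fun k => X k ω) (g i))
      (c⁻¹ * (1 + Real.log (2 * N) + n * (c ^ 2 * v))) := by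
  classical
  -- Only members of `T` that are attained by the family are known to be measurable and to satisfy
  -- the moment bound.
  set T' := T.filter (fun f => f ∈ range g) with hT'
  have hmem : ∀ i, g i ∈ T' := fun i => by simp [hT', hT i]
  set s : (𝒳 → ℝ) → Ω → ℝ := fun f ω => centeredSum P n (fun k => X k ω) f
  set L : ℝ := Real.log (2 * N) + n * (c ^ 2 * v) with hL
  have hL0 : 0 ≤ L := by
    have : 0 ≤ Real.log (2 * N) := Real.log_nonneg (by linarith)
    positivity
  -- The envelope comes from `x ≤ L + exp (x - L)` at `x = c |s f|`, with the largest exponential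
  -- replaced by the sum over the finite set `T'`. It is measurable whatever the index type, and `L`
  -- is chosen so that the sum has mean at most 1.
  set F : Ω → ℝ := fun ω => c⁻¹ * (L + ∑ f ∈ T', Real.exp (-L) *
    (Real.exp (c * s f ω) + Real.exp (-c * s f ω))) with hF
  have hF0 : ∀ ω, 0 ≤ F ω := fun ω => by
    have : 0 ≤ ∑ f ∈ T', Real.exp (-L) * (Real.exp (c * s f ω) + Real.exp (-c * s f ω)) :=
      Finset.sum_nonneg fun f _ => by positivity
    positivity
  have hT'm : ∀ f ∈ T', Measurable f := fun f hf => by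
    obtain ⟨i, rfl⟩ := (Finset.mem_filter.1 hf).2
    exact hg i
  have hsm : ∀ f ∈ T', Measurable (s f) := fun f hf =>
    Finset.measurable_sum _ fun i _ => ((hT'm f hf).comp (hX.meas i)).sub_const _
  have hFm : Measurable F := by
    refine (measurable_const.add (Finset.measurable_sum _ fun f hf => ?_)).const_mul _
    have := hsm f hf
    fun_prop
  have hbd : ∀ f ∈ T', ∀ a : ℝ, |a| = c → Integrable (fun ω => Real.exp (a * s f ω)) Pr ∧
      ∫ ω, Real.exp (a * s f ω) ∂Pr ≤ Real.exp (n * (c ^ 2 * v)) := by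
    intro f hf a ha
    obtain ⟨i, rfl⟩ := (Finset.mem_filter.1 hf).2
    have h := hX.integral_exp_centeredSum_le n (hg i) (c := a) hv0 (by rw [ha]; exact hv i)
    rwa [← sq_abs a, ha] at h
  have hpos : ∀ f ∈ T', _ := fun f hf => hbd f hf c (abs_of_pos hc)
  have hneg : ∀ f ∈ T', _ := fun f hf => hbd f hf (-c) (by rw [abs_neg, abs_of_pos hc])
  have hterm : ∀ f ∈ T', Integrable (fun ω => Real.exp (-L) *
      (Real.exp (c * s f ω) + Real.exp (-c * s f ω))) Pr := fun f hf =>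
    ((hpos f hf).1.add (hneg f hf).1).const_mul _
  have hFi : Integrable F Pr :=
    ((integrable_const L).add (integrable_finsetSum _ hterm)).const_mul _
  refine ⟨fun ω => ENNReal.ofReal (F ω), hFm.ennreal_ofReal,
    Eventually.of_forall fun ω i => ENNReal.ofReal_le_ofReal ?_, ?_⟩
  · have h1 : c * |s (g i) ω| ≤ L + Real.exp (-L) *
        (Real.exp (c * s (g i) ω) + Real.exp (-c * s (g i) ω)) := by
      have h2 := Real.add_one_le_exp (c * |s (g i) ω| - L)
      have h3 : Real.exp (c * |s (g i) ω|) ≤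
          Real.exp (c * s (g i) ω) + Real.exp (-c * s (g i) ω) := by
        rcases abs_cases (s (g i) ω) with ⟨h, _⟩ | ⟨h, _⟩
        · rw [h]; linarith [Real.exp_pos (-c * s (g i) ω)]
        · rw [h, mul_neg, ← neg_mul]; linarith [Real.exp_pos (c * s (g i) ω)]
      have h4 : Real.exp (c * |s (g i) ω| - L) = Real.exp (-L) * Real.exp (c * |s (g i) ω|) := by
        rw [← Real.exp_add]; ring_nf
      have h5 := mul_le_mul_of_nonneg_left h3 (Real.exp_pos (-L)).le
      linarith
    have h6 := Finset.single_le_sum (f := fun f => Real.exp (-L) *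
      (Real.exp (c * s f ω) + Real.exp (-c * s f ω))) (fun f _ => by positivity) (hmem i)
    calc |s (g i) ω| = c⁻¹ * (c * |s (g i) ω|) := by field_simp
      _ ≤ F ω := by
        exact mul_le_mul_of_nonneg_left (by linarith) (by positivity)
  · rw [← ofReal_integral_eq_lintegral_ofReal hFi (Eventually.of_forall hF0)]
    apply ENNReal.ofReal_le_ofReal
    rw [hF, integral_const_mul, integral_add (integrable_const L) (integrable_finsetSum _ hterm),
      integral_finsetSum _ hterm]
    have h1 : ∑ f ∈ T', ∫ ω, Real.exp (-L) *
        (Real.exp (c * s f ω) + Real.exp (-c * s f ω)) ∂Pr ≤ 1 := by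
      calc _ ≤ ∑ f ∈ T', Real.exp (-L) * (2 * Real.exp (n * (c ^ 2 * v))) := by
            refine Finset.sum_le_sum fun f hf => ?_
            rw [integral_const_mul, integral_add (hpos f hf).1 (hneg f hf).1]
            gcongr
            linarith [(hpos f hf).2, (hneg f hf).2]
        _ = T'.card * (Real.exp (-L) * (2 * Real.exp (n * (c ^ 2 * v)))) := by
            rw [Finset.sum_const, nsmul_eq_mul]
        _ ≤ N * (Real.exp (-L) * (2 * Real.exp (n * (c ^ 2 * v)))) := by
            gcongr
            refine le_trans ?_ hN
            exact_mod_cast Finset.card_filter_le _ _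
        _ = 1 := by
            rw [hL, neg_add, Real.exp_add, Real.exp_neg, Real.exp_neg,
              Real.exp_log (by linarith)]
            field_simp
    simp only [integral_const, probReal_univ, smul_eq_mul, one_mul]
    exact mul_le_mul_of_nonneg_left (by linarith) (by positivity)

/-- A nonnegative family is controlled by a dominating family with small mean. -/
lemma SupMeanLE.centeredSum_of_le {Pr : Measure Ω} [IsProbabilityMeasure Pr] {P : Measure 𝒳}
    {X : ℕ → Ω → 𝒳} {n : ℕ} {t h : ι → 𝒳 → ℝ} {B a : ℝ} (hB : 0 ≤ B) (ha : 0 ≤ a)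
    (hh : SupMeanLE Pr (fun i ω => centeredSum P n (fun k => X k ω) (h i)) B)
    (ht0 : ∀ i x, 0 ≤ t i x) (hth : ∀ i x, t i x ≤ h i x) (hhi : ∀ i, Integrable (h i) P)
    (hht : ∀ i, Measurable (t i)) (hha : ∀ i, ∫ x, h i x ∂P ≤ a) :
    SupMeanLE Pr (fun i ω => centeredSum P n (fun k => X k ω) (t i)) (B + 2 * n * a) := by
  have h2 : SupMeanLE Pr (fun (_ : ι) (_ : Ω) => 2 * n * a) (2 * n * a) :=
    SupMeanLE.const.mono (abs_of_nonneg (by positivity)).le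
  refine hh.of_le_add hB (by positivity) h2 fun ω i => ?_
  simp only [centeredSum_eq]
  rw [abs_of_nonneg (by positivity : 0 ≤ 2 * (n : ℝ) * a)]
  -- Since `0 ≤ t ≤ h`, the upper deviation is at most `∑ h`, that is, the deviation of `h` plus `n
  -- P h`; the lower deviation is at least `-n P t ≥ -n a`.
  have h3 : ∑ k ∈ Finset.range n, t i (X k ω) ≤ ∑ k ∈ Finset.range n, h i (X k ω) :=
    Finset.sum_le_sum fun k _ => hth i _
  have h4 : 0 ≤ ∑ k ∈ Finset.range n, t i (X k ω) := Finset.sum_nonneg fun k _ => ht0 i _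
  have hti : Integrable (t i) P := (hhi i).mono' (hht i).aestronglyMeasurable
    (Eventually.of_forall fun x => by rw [Real.norm_of_nonneg (ht0 i x)]; exact hth i x)
  have h5 : ∫ x, t i x ∂P ≤ ∫ x, h i x ∂P := integral_mono hti (hhi i) (hth i)
  have h6 : 0 ≤ ∫ x, t i x ∂P := integral_nonneg (ht0 i)
  have h7 : (n : ℝ) * ∫ x, t i x ∂P ≤ n * ∫ x, h i x ∂P := by gcongr
  have h8 : (n : ℝ) * ∫ x, h i x ∂P ≤ n * a := by gcongr; exact hha i
  have h9 : 0 ≤ (n : ℝ) * ∫ x, t i x ∂P := by positivity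
  have h10 := le_abs_self (∑ k ∈ Finset.range n, h i (X k ω) - n * ∫ x, h i x ∂P)
  have h11 := abs_nonneg (∑ k ∈ Finset.range n, h i (X k ω) - n * ∫ x, h i x ∂P)
  rw [abs_le]
  constructor <;> linarith

end FiniteMaximal

/-! ### Chaining with brackets -/

section Combinatorics

variable {𝒳 ι : Type*}

/-- The largest lower bracket function among the first levels. -/
def chainLo (br : ℕ → ι → (𝒳 → ℝ) × (𝒳 → ℝ)) : ℕ → ι → 𝒳 → ℝ
  | 0 => fun i => (br 0 i).1
  | q + 1 => fun i x => max (chainLo br q i x) ((br (q + 1) i).1 x)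

/-- The smallest upper bracket function among the first levels. -/
def chainUp (br : ℕ → ι → (𝒳 → ℝ) × (𝒳 → ℝ)) : ℕ → ι → 𝒳 → ℝ
  | 0 => fun i => (br 0 i).2
  | q + 1 => fun i x => min (chainUp br q i x) ((br (q + 1) i).2 x)

/-- The width of the intersection of the first brackets. -/
def chainWidth (br : ℕ → ι → (𝒳 → ℝ) × (𝒳 → ℝ)) (q : ℕ) (i : ι) (x : 𝒳) : ℝ :=
  chainUp br q i x - chainLo br q i x

/-- The indicator that the widths of the levels below `q` do not exceed the thresholds `a`. -/
def chainAlive (br : ℕ → ι → (𝒳 → ℝ) × (𝒳 → ℝ)) (a : ℕ → ℝ) : ℕ → ι → 𝒳 → ℝ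
  | 0 => fun _ _ => 1
  | q + 1 => fun i x => if chainWidth br q i x ≤ a q then chainAlive br a q i x else 0

variable {br : ℕ → ι → (𝒳 → ℝ) × (𝒳 → ℝ)} {a : ℕ → ℝ}

/-- This and the next three lemmas say that the level-`q` objects are functions of the brackets of
levels at most `q`. By `exists_finset_of_factors` they then take finitely many values, even over an
uncountable class. -/
lemma chainLo_congr {q : ℕ} {i i' : ι} (h : ∀ j ≤ q, br j i = br j i') :
    chainLo br q i = chainLo br q i' := by
  induction q with
  | zero => simp [chainLo, h 0 le_rfl]
  | succ q ih => simp [chainLo, h (q + 1) le_rfl, ih fun j hj => h j (by omega)]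

lemma chainUp_congr {q : ℕ} {i i' : ι} (h : ∀ j ≤ q, br j i = br j i') :
    chainUp br q i = chainUp br q i' := by
  induction q with
  | zero => simp [chainUp, h 0 le_rfl]
  | succ q ih => simp [chainUp, h (q + 1) le_rfl, ih fun j hj => h j (by omega)]

lemma chainWidth_congr {q : ℕ} {i i' : ι} (h : ∀ j ≤ q, br j i = br j i') :
    chainWidth br q i = chainWidth br q i' := by
  funext x
  simp [chainWidth, chainLo_congr h, chainUp_congr h]

lemma chainAlive_congr {q : ℕ} {i i' : ι} (h : ∀ j ≤ q, br j i = br j i') :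
    chainAlive br a q i = chainAlive br a q i' := by
  induction q with
  | zero => rfl
  | succ q ih =>
    have h' : ∀ j ≤ q, br j i = br j i' := fun j hj => h j (by omega)
    simp [chainAlive, ih h', chainWidth_congr h']

lemma chainAlive_mem (q : ℕ) (i : ι) (x : 𝒳) :
    chainAlive br a q i x = 0 ∨ chainAlive br a q i x = 1 := by
  induction q with
  | zero => exact Or.inr rfl
  | succ q ih =>
    simp only [chainAlive]
    split_ifs
    · exact ih
    · exact Or.inl rfl

lemma chainAlive_nonneg (q : ℕ) (i : ι) (x : 𝒳) : 0 ≤ chainAlive br a q i x := by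
  rcases chainAlive_mem (br := br) (a := a) q i x with h | h <;> rw [h]; norm_num

lemma chainAlive_le_one (q : ℕ) (i : ι) (x : 𝒳) : chainAlive br a q i x ≤ 1 := by
  rcases chainAlive_mem (br := br) (a := a) q i x with h | h <;> rw [h]; norm_num

lemma chainLo_le_succ (q : ℕ) (i : ι) (x : 𝒳) : chainLo br q i x ≤ chainLo br (q + 1) i x :=
  le_max_left _ _

lemma chainLo_le {f : ι → 𝒳 → ℝ} (hf : ∀ q i x, (br q i).1 x ≤ f i x) (q : ℕ) (i : ι) (x : 𝒳) :
    chainLo br q i x ≤ f i x := by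
  induction q with
  | zero => exact hf 0 i x
  | succ q ih => exact max_le ih (hf _ i x)

lemma le_chainUp {f : ι → 𝒳 → ℝ} (hf : ∀ q i x, f i x ≤ (br q i).2 x) (q : ℕ) (i : ι) (x : 𝒳) :
    f i x ≤ chainUp br q i x := by
  induction q with
  | zero => exact hf 0 i x
  | succ q ih => exact le_min ih (hf _ i x)

lemma chainWidth_succ_le (q : ℕ) (i : ι) (x : 𝒳) :
    chainWidth br (q + 1) i x ≤ chainWidth br q i x :=
  sub_le_sub (min_le_left _ _) (le_max_left _ _)

lemma chainWidth_le (q : ℕ) (i : ι) (x : 𝒳) :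
    chainWidth br q i x ≤ (br q i).2 x - (br q i).1 x := by
  cases q with
  | zero => exact le_rfl
  | succ q => exact sub_le_sub (min_le_right _ _) (le_max_right _ _)

/-- A family that depends only on the brackets of the levels up to `q` has finite range. -/
lemma exists_finset_of_factors {S : ℕ → Finset ((𝒳 → ℝ) × (𝒳 → ℝ))}
    (hS : ∀ q i, br q i ∈ S q) (q : ℕ) {g : ι → 𝒳 → ℝ}
    (hg : ∀ i i', (∀ j ≤ q, br j i = br j i') → g i = g i') :
    ∃ T : Finset (𝒳 → ℝ), (∀ i, g i ∈ T) ∧ T.card ≤ ∏ j ∈ Finset.range (q + 1), (S j).card := by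
  classical
  -- Each attainable selection of brackets is represented by one chosen index; the others are sent
  -- to a dummy value.
  refine ⟨(Fintype.piFinset fun j : Fin (q + 1) => S j).image fun c =>
    if h : ∃ i, ∀ j : Fin (q + 1), br j i = c j then g h.choose else 0, fun i => ?_, ?_⟩
  · refine Finset.mem_image.2 ⟨fun j => br j i, Fintype.mem_piFinset.2 fun j => hS j i, ?_⟩
    have h : ∃ i', ∀ j : Fin (q + 1), br j i' = br j i := ⟨i, fun _ => rfl⟩
    rw [dif_pos h]
    exact hg _ _ fun j hj => h.choose_spec ⟨j, by omega⟩
  · refine Finset.card_image_le.trans (le_of_eq ?_)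
    rw [Fintype.card_piFinset, Fin.prod_univ_eq_prod_range (fun j => (S j).card)]

/-- The logarithm of the number of chains up to level `q`, up to constants. -/
def chainEntropy (S : ℕ → Finset ((𝒳 → ℝ) × (𝒳 → ℝ))) (q : ℕ) : ℝ :=
  1 + Real.log (2 * ∏ j ∈ Finset.range (q + 1), ((S j).card : ℝ))

lemma one_le_prod_card {S : ℕ → Finset ((𝒳 → ℝ) × (𝒳 → ℝ))} (hS : ∀ q, (S q).Nonempty) (q : ℕ) :
    (1 : ℝ) ≤ ∏ j ∈ Finset.range q, ((S j).card : ℝ) := by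
  have h : 1 ≤ ∏ j ∈ Finset.range q, (S j).card :=
    Finset.one_le_prod' fun j _ => Finset.card_pos.2 (hS j)
  exact_mod_cast h

lemma one_le_chainEntropy {S : ℕ → Finset ((𝒳 → ℝ) × (𝒳 → ℝ))} (hS : ∀ q, (S q).Nonempty)
    (q : ℕ) : 1 ≤ chainEntropy S q := by
  have := one_le_prod_card hS (q + 1)
  have h2 : 0 ≤ Real.log (2 * ∏ j ∈ Finset.range (q + 1), ((S j).card : ℝ)) :=
    Real.log_nonneg (by linarith)
  rw [chainEntropy]
  linarith

end Combinatorics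

/-! ### The truncated bracketing chain. -/

section Chain

variable {Ω 𝒳 ι : Type*} [MeasurableSpace Ω] [MeasurableSpace 𝒳]

/-- The moment `P (g² exp (|g| / 2))`. -/
def bernMoment (P : Measure 𝒳) (g : 𝒳 → ℝ) : ℝ≥0∞ :=
  ∫⁻ x, ENNReal.ofReal (g x ^ 2 * Real.exp (1 / 2 * |g x|)) ∂P

lemma bernMoment_mono {P : Measure 𝒳} {f g : 𝒳 → ℝ} (h : ∀ᵐ x ∂P, |f x| ≤ |g x|) :
    bernMoment P f ≤ bernMoment P g := by
  refine lintegral_mono_ae ?_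
  filter_upwards [h] with x hx
  apply ENNReal.ofReal_le_ofReal
  have := sq_le_sq.2 hx
  gcongr

variable {br : ℕ → ι → (𝒳 → ℝ) × (𝒳 → ℝ)} {a : ℕ → ℝ}

lemma measurable_chainLo (hm : ∀ q i, Measurable (br q i).1) (q : ℕ) (i : ι) :
    Measurable (chainLo br q i) := by
  induction q with
  | zero => exact hm 0 i
  | succ q ih => exact ih.max (hm _ i)

lemma measurable_chainUp (hm : ∀ q i, Measurable (br q i).2) (q : ℕ) (i : ι) :
    Measurable (chainUp br q i) := by
  induction q with
  | zero => exact hm 0 i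
  | succ q ih => exact ih.min (hm _ i)

lemma measurable_chainWidth (hm : ∀ q i, Measurable (br q i).1 ∧ Measurable (br q i).2) (q : ℕ)
    (i : ι) : Measurable (chainWidth br q i) :=
  (measurable_chainUp (fun q i => (hm q i).2) q i).sub
    (measurable_chainLo (fun q i => (hm q i).1) q i)

lemma measurable_chainAlive (hm : ∀ q i, Measurable (br q i).1 ∧ Measurable (br q i).2) (q : ℕ)
    (i : ι) : Measurable (chainAlive br a q i) := by
  induction q with
  | zero => exact measurable_const
  | succ q ih =>
    exact Measurable.ite (measurableSet_le (measurable_chainWidth hm q i) measurable_const) ih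
      measurable_const

lemma IsIIDSample.supMeanLE_factors {Pr : Measure Ω} [IsProbabilityMeasure Pr]
    {P : Measure 𝒳} [IsProbabilityMeasure P] {X : ℕ → Ω → 𝒳} (hX : IsIIDSample Pr P X) (n : ℕ)
    {S : ℕ → Finset ((𝒳 → ℝ) × (𝒳 → ℝ))} (hS : ∀ q i, br q i ∈ S q)
    (hSn : ∀ q, (S q).Nonempty) (q : ℕ) {g : ι → 𝒳 → ℝ} (hgm : ∀ i, Measurable (g i))
    (hg : ∀ i i', (∀ j ≤ q, br j i = br j i') → g i = g i') {c v : ℝ} (hc : 0 < c) (hv0 : 0 ≤ v)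
    (hv : ∀ i, ∫⁻ x, ENNReal.ofReal (g i x ^ 2 * Real.exp (c * |g i x|)) ∂P ≤
      ENNReal.ofReal v) :
    SupMeanLE Pr (fun i ω => centeredSum P n (fun k => X k ω) (g i))
      (c⁻¹ * (chainEntropy S q + n * (c ^ 2 * v))) := by
  obtain ⟨T, hT, hcard⟩ := exists_finset_of_factors hS q hg
  refine hX.supMeanLE_finite n hgm T hT (one_le_prod_card hSn (q + 1)) ?_ hc hv0 hv
  exact_mod_cast hcard

variable {S : ℕ → Finset ((𝒳 → ℝ) × (𝒳 → ℝ))} {σ : ℕ → ℝ} {n : ℕ} {f : ι → 𝒳 → ℝ}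

/-- The truncation level of the chaining argument. -/
def chainThreshold (S : ℕ → Finset ((𝒳 → ℝ) × (𝒳 → ℝ))) (σ : ℕ → ℝ) (n q : ℕ) : ℝ :=
  σ q * Real.sqrt n / Real.sqrt (chainEntropy S (q + 1))

/-- The contribution of one level to the chaining bound. -/
def chainTerm (S : ℕ → Finset ((𝒳 → ℝ) × (𝒳 → ℝ))) (σ : ℕ → ℝ) (n q : ℕ) : ℝ :=
  Real.sqrt n * σ q * Real.sqrt (chainEntropy S (q + 1))

/-- Families that are dominated by the truncated width of the previous level. -/
lemma IsIIDSample.supMeanLE_truncated {Pr : Measure Ω} [IsProbabilityMeasure Pr]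
    {P : Measure 𝒳} [IsProbabilityMeasure P] {X : ℕ → Ω → 𝒳} (hX : IsIIDSample Pr P X)
    (hn : 0 < n) (hS : ∀ q i, br q i ∈ S q) (hSn : ∀ q, (S q).Nonempty) (hσ : ∀ q, 0 < σ q)
    (hbr0 : ∀ q i x, (br q i).1 x ≤ (br q i).2 x)
    (hbr : ∀ q i, bernMoment P (fun x => (br q i).2 x - (br q i).1 x) ≤ ENNReal.ofReal (σ q ^ 2))
    (q : ℕ) {g : ι → 𝒳 → ℝ} (hgm : ∀ i, Measurable (g i))
    (hg : ∀ i i', (∀ j ≤ q + 1, br j i = br j i') → g i = g i') (hg0 : ∀ i x, 0 ≤ g i x)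
    (hgw : ∀ i x, g i x ≤ chainWidth br q i x * chainAlive br (chainThreshold S σ n) (q + 1) i x) :
    SupMeanLE Pr (fun i ω => centeredSum P n (fun k => X k ω) (g i)) (4 * chainTerm S σ n q) := by
  set H := chainEntropy S (q + 1) with hH
  have hH1 : 1 ≤ H := one_le_chainEntropy hSn _
  have hsn : 0 < Real.sqrt n := Real.sqrt_pos.2 (by exact_mod_cast hn)
  have hsH : 0 < Real.sqrt H := Real.sqrt_pos.2 (by linarith)
  have hsn2 : Real.sqrt n ^ 2 = n := Real.sq_sqrt (by positivity)
  have hsH2 : Real.sqrt H ^ 2 = H := Real.sq_sqrt (by linarith)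
  have hσq := hσ q
  -- With `c` the inverse of the threshold, `c |g| ≤ 1`, so the exponential weight is below `e < 3`.
  -- The threshold balances `c⁻¹ H` against `3 n c σ²`: they equal one and three times `√n σ √H`,
  -- whence the factor 4.
  set c : ℝ := (chainThreshold S σ n q)⁻¹ with hc
  have ht : 0 < chainThreshold S σ n q := by rw [chainThreshold]; positivity
  have hgt : ∀ i x, g i x ≤ chainThreshold S σ n q ∧ g i x ≤ (br q i).2 x - (br q i).1 x := by
    intro i x
    have h := hgw i x
    have hz : g i x ≤ 0 → g i x ≤ chainThreshold S σ n q ∧ g i x ≤ (br q i).2 x - (br q i).1 x :=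
      fun hz => ⟨hz.trans ht.le, hz.trans (sub_nonneg.2 (hbr0 q i x))⟩
    simp only [chainAlive] at h
    split_ifs at h with h1
    · rcases chainAlive_mem (br := br) (a := chainThreshold S σ n) q i x with h2 | h2
      · exact hz (by simpa [h2] using h)
      · rw [h2, mul_one] at h
        exact ⟨h.trans h1, h.trans (chainWidth_le q i x)⟩
    · exact hz (by simpa using h)
  refine (hX.supMeanLE_factors n hS hSn (q + 1) hgm hg (c := c) (v := 3 * σ q ^ 2)
    (inv_pos.2 ht) (by positivity) fun i => ?_).mono (le_of_eq ?_)
  · have h3 : ∫⁻ x, ENNReal.ofReal (g i x ^ 2 * Real.exp (c * |g i x|)) ∂P ≤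
        ∫⁻ x, ENNReal.ofReal 3 * ENNReal.ofReal (((br q i).2 x - (br q i).1 x) ^ 2 *
          Real.exp (1 / 2 * |(br q i).2 x - (br q i).1 x|)) ∂P := by
      refine lintegral_mono fun x => ?_
      rw [← ENNReal.ofReal_mul (by norm_num)]
      apply ENNReal.ofReal_le_ofReal
      have h4 : Real.exp (c * |g i x|) ≤ 3 := by
        refine (Real.exp_le_exp.2 ?_).trans Real.exp_one_lt_three.le
        rw [abs_of_nonneg (hg0 i x), hc, inv_mul_le_iff₀ ht, mul_one]
        exact (hgt i x).1
      have h5 : g i x ^ 2 ≤ ((br q i).2 x - (br q i).1 x) ^ 2 :=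
        pow_le_pow_left₀ (hg0 i x) (hgt i x).2 2
      calc g i x ^ 2 * Real.exp (c * |g i x|) ≤ ((br q i).2 x - (br q i).1 x) ^ 2 * 3 := by gcongr
        _ ≤ _ := by
          have := sq_le_sq_mul_exp (x := (br q i).2 x - (br q i).1 x) (c := 1 / 2) (by norm_num)
          linarith
    refine h3.trans ?_
    rw [lintegral_const_mul' _ _ ENNReal.ofReal_ne_top, ENNReal.ofReal_mul (by norm_num)]
    gcongr
    exact hbr q i
  · rw [hc, inv_inv, chainThreshold, chainTerm, ← hH]
    generalize Real.sqrt (n : ℝ) = r at hsn hsn2 ⊢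
    generalize Real.sqrt H = y at hsH hsH2 ⊢
    rw [← hsn2, ← hsH2]
    field_simp
    ring

/-- The first absolute moment of a function from its second moment. -/
lemma integral_le_of_sq {P : Measure 𝒳} [IsProbabilityMeasure P] {g : 𝒳 → ℝ} (hg : Measurable g)
    {s : ℝ} (hs : 0 < s)
    (hv : ∫⁻ x, ENNReal.ofReal (g x ^ 2) ∂P ≤ ENNReal.ofReal (s ^ 2)) : ∫ x, g x ∂P ≤ s := by
  have h0 : ∀ x, 0 ≤ g x ^ 2 := fun x => sq_nonneg _
  have hi := integrable_of_lintegral_ofReal_le (hg.pow_const 2) h0 hv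
  have h2 := integral_le_of_lintegral_ofReal_le (hg.pow_const 2) h0 (sq_nonneg s) hv
  have h1 : ∫ x, g x ∂P ≤ ∫ x, (s / 2 + (2 * s)⁻¹ * g x ^ 2) ∂P := by
    refine integral_mono (integrable_of_sq hg hv) ((integrable_const _).add (hi.const_mul _))
      fun x => ?_
    have : 0 ≤ (2 * s)⁻¹ * (g x - s) ^ 2 := by positivity
    have h3 : (2 * s)⁻¹ * (g x - s) ^ 2 = s / 2 + (2 * s)⁻¹ * g x ^ 2 - g x := by
      field_simp; ring
    simp only
    linarith
  rw [integral_add (integrable_const _) (hi.const_mul _), integral_const_mul] at h1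
  simp only [integral_const, probReal_univ, smul_eq_mul, one_mul] at h1
  have h4 : (2 * s)⁻¹ * ∫ x, g x ^ 2 ∂P ≤ (2 * s)⁻¹ * s ^ 2 := by gcongr
  have h5 : (2 * s)⁻¹ * s ^ 2 = s / 2 := by field_simp
  linarith

/-- The maximal inequality for a class of functions covered by brackets, with a finite chain of
length `Q`. -/
theorem IsIIDSample.supMeanLE_chain [Nonempty ι] {Pr : Measure Ω} [IsProbabilityMeasure Pr]
    {P : Measure 𝒳} [IsProbabilityMeasure P] {X : ℕ → Ω → 𝒳} (hX : IsIIDSample Pr P X)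
    (hn : 0 < n) (hS : ∀ q i, br q i ∈ S q) (hσ : ∀ q, 0 < σ q)
    (hbm : ∀ q i, Measurable (br q i).1 ∧ Measurable (br q i).2) (hfm : ∀ i, Measurable (f i))
    (hf : ∀ q i x, (br q i).1 x ≤ f i x ∧ f i x ≤ (br q i).2 x)
    (hbr : ∀ q i, bernMoment P (fun x => (br q i).2 x - (br q i).1 x) ≤ ENNReal.ofReal (σ q ^ 2))
    {s : ℝ} (hs : ∀ i, bernMoment P (f i) ≤ ENNReal.ofReal (s ^ 2))
    {c : ℝ} (hc : 0 < c) (hc4 : c ≤ 1 / 4) (Q : ℕ) :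
    SupMeanLE Pr (fun i ω => centeredSum P n (fun k => X k ω) (f i))
      (2 * c⁻¹ * (chainEntropy S 0 + n * (c ^ 2 * (4 * (s ^ 2 + σ 0 ^ 2)))) +
        10 * ∑ q ∈ Finset.range Q, chainTerm S σ n q + 2 * n * σ Q) := by
  have hSn : ∀ q, (S q).Nonempty := fun q => ⟨_, hS q (Classical.arbitrary ι)⟩
  have hbr0 : ∀ q i x, (br q i).1 x ≤ (br q i).2 x := fun q i x => (hf q i x).1.trans (hf q i x).2
  set a := chainThreshold S σ n with ha
  have hH1 : ∀ q, 1 ≤ chainEntropy S q := one_le_chainEntropy hSn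
  have hsn : 0 < Real.sqrt n := Real.sqrt_pos.2 (by exact_mod_cast hn)
  have hsn2 : Real.sqrt n ^ 2 = n := Real.sq_sqrt (by positivity)
  have hsH : ∀ q, 0 < Real.sqrt (chainEntropy S q) := fun q =>
    Real.sqrt_pos.2 (by linarith [hH1 q])
  have hapos : ∀ q, 0 < a q := fun q => by
    have := hσ q; have := hsH (q + 1)
    rw [ha, chainThreshold]; positivity
  have hG0 : ∀ q, 0 ≤ chainTerm S σ n q := fun q => by
    have := hσ q
    rw [chainTerm]; positivity
  have hLm := measurable_chainLo (fun q i => (hbm q i).1)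
  have hWm := measurable_chainWidth hbm
  have hAm := measurable_chainAlive (a := a) hbm
  have hLf : ∀ q i x, chainLo br q i x ≤ f i x := chainLo_le fun q i x => (hf q i x).1
  have hfU : ∀ q i x, f i x ≤ chainUp br q i x := le_chainUp fun q i x => (hf q i x).2
  have hW0 : ∀ q i x, 0 ≤ chainWidth br q i x := fun q i x =>
    sub_nonneg.2 ((hLf q i x).trans (hfU q i x))
  have hA0 : ∀ q i x, 0 ≤ chainAlive br a q i x := chainAlive_nonneg
  have hA1 : ∀ q i x, chainAlive br a q i x ≤ 1 := chainAlive_le_one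
  have hWsq : ∀ q i, ∫⁻ x, ENNReal.ofReal (chainWidth br q i x ^ 2) ∂P ≤
      ENNReal.ofReal (σ q ^ 2) := fun q i =>
    (lintegral_mono fun x => ENNReal.ofReal_le_ofReal
      (pow_le_pow_left₀ (hW0 q i x) (chainWidth_le q i x) 2)).trans
      (sq_moment_le (by norm_num) (hbr q i))
  have hWi : ∀ q i, Integrable (chainWidth br q i) P := fun q i =>
    integrable_of_sq (hWm q i) (hWsq q i)
  have hle : ∀ {g : 𝒳 → ℝ} {q : ℕ} {i : ι}, Measurable g → (∀ x, |g x| ≤ chainWidth br q i x) →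
      Integrable g P := fun hg hgw =>
    (hWi _ _).mono' hg.aestronglyMeasurable (Eventually.of_forall hgw)
  have hAle : ∀ {y w z : ℝ}, 0 ≤ y → y ≤ w → 0 ≤ z → z ≤ 1 → |y * z| ≤ w := by
    intro y w z h1 h2 h3 h4
    rw [abs_of_nonneg (mul_nonneg h1 h3)]
    nlinarith
  -- the bounds for the levels
  set E : ℕ → ℝ := fun q => match q with
    | 0 => c⁻¹ * (chainEntropy S 0 + n * (c ^ 2 * σ 0 ^ 2))
    | q + 1 => 4 * chainTerm S σ n q with hE
  have hE0 : ∀ q, 0 ≤ E q := by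
    intro q
    cases q with
    | zero =>
      have := hH1 0
      simp only [hE]; positivity
    | succ q => exact mul_nonneg (by norm_num) (hG0 q)
  have hlevel : ∀ q (g : ι → 𝒳 → ℝ), (∀ i, Measurable (g i)) →
      (∀ i i', (∀ j ≤ q, br j i = br j i') → g i = g i') → (∀ i x, 0 ≤ g i x) →
      (∀ i x, g i x ≤ chainWidth br q i x * chainAlive br a q i x) →
      SupMeanLE Pr (fun i ω => centeredSum P n (fun k => X k ω) (g i)) (E q) := by
    intro q g hgm hg hg0 hgw
    cases q with
    | zero =>
      refine hX.supMeanLE_factors n hS hSn 0 hgm hg hc (by positivity) fun i => ?_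
      refine le_trans (lintegral_mono fun x => ENNReal.ofReal_le_ofReal ?_) (hbr 0 i)
      have h1 : g i x ≤ (br 0 i).2 x - (br 0 i).1 x := by
        simpa [chainAlive, chainWidth, chainUp, chainLo] using hgw i x
      have h2 : |g i x| ≤ |(br 0 i).2 x - (br 0 i).1 x| := by
        rw [abs_of_nonneg (hg0 i x)]; exact h1.trans (le_abs_self _)
      have h3 := sq_le_sq.2 h2
      have h4 : c ≤ 1 / 2 := by linarith
      gcongr
    | succ q =>
      refine hX.supMeanLE_truncated hn hS hSn hσ hbr0 hbr q hgm hg hg0 fun i x => ?_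
      refine (hgw i x).trans (mul_le_mul_of_nonneg_right (chainWidth_succ_le q i x) (hA0 _ i x))
  -- the remainders
  set R : ℕ → ι → 𝒳 → ℝ := fun q i x => (f i x - chainLo br q i x) * chainAlive br a q i x with hR
  have hRm : ∀ q i, Measurable (R q i) := fun q i => ((hfm i).sub (hLm q i)).mul (hAm q i)
  have hfL : ∀ q i x, f i x - chainLo br q i x ≤ chainWidth br q i x := fun q i x =>
    sub_le_sub_right (hfU q i x) _
  have hRi : ∀ q i, Integrable (R q i) P := fun q i => hle (hRm q i) fun x =>
    hAle (sub_nonneg.2 (hLf q i x)) (hfL q i x) (hA0 q i x) (hA1 q i x)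
  have hstep : ∀ q B, 0 ≤ B →
      SupMeanLE Pr (fun i ω => centeredSum P n (fun k => X k ω) (R (q + 1) i)) B →
      SupMeanLE Pr (fun i ω => centeredSum P n (fun k => X k ω) (R q i))
        (B + (E q + 2 * chainTerm S σ n q + E (q + 1))) := by
    intro q B hB hRB
    set I : ι → 𝒳 → ℝ := fun i x => if chainWidth br q i x ≤ a q then 0 else 1 with hI
    have hIm : ∀ i, Measurable (I i) := fun i =>
      Measurable.ite (measurableSet_le (hWm q i) measurable_const) measurable_const
        measurable_const
    have hI0 : ∀ i x, 0 ≤ I i x := fun i x => by simp only [hI]; split_ifs <;> norm_num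
    have hI1 : ∀ i x, I i x ≤ 1 := fun i x => by simp only [hI]; split_ifs <;> norm_num
    have hIc : ∀ i i', (∀ j ≤ q, br j i = br j i') → I i = I i' := fun i i' h => by
      simp only [hI, chainWidth_congr h]
    set t : ι → 𝒳 → ℝ := fun i x => R q i x * I i x with ht
    set h : ι → 𝒳 → ℝ := fun i x => chainWidth br q i x * chainAlive br a q i x * I i x with hh
    set k : ι → 𝒳 → ℝ := fun i x =>
      (chainLo br (q + 1) i x - chainLo br q i x) * chainAlive br a (q + 1) i x with hk
    have htm : ∀ i, Measurable (t i) := fun i => (hRm q i).mul (hIm i)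
    have hhm : ∀ i, Measurable (h i) := fun i => ((hWm q i).mul (hAm q i)).mul (hIm i)
    have hkm : ∀ i, Measurable (k i) := fun i =>
      ((hLm (q + 1) i).sub (hLm q i)).mul (hAm (q + 1) i)
    have hR0 : ∀ i x, 0 ≤ R q i x := fun i x => mul_nonneg (sub_nonneg.2 (hLf q i x)) (hA0 q i x)
    have hRw : ∀ i x, R q i x ≤ chainWidth br q i x := fun i x =>
      (le_abs_self _).trans (hAle (sub_nonneg.2 (hLf q i x)) (hfL q i x) (hA0 q i x) (hA1 q i x))
    have hWA0 : ∀ i x, 0 ≤ chainWidth br q i x * chainAlive br a q i x := fun i x =>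
      mul_nonneg (hW0 q i x) (hA0 q i x)
    have hWAw : ∀ i x, chainWidth br q i x * chainAlive br a q i x ≤ chainWidth br q i x :=
      fun i x => mul_le_of_le_one_right (hW0 q i x) (hA1 q i x)
    have hti : ∀ i, Integrable (t i) P := fun i => hle (htm i) fun x =>
      hAle (hR0 i x) (hRw i x) (hI0 i x) (hI1 i x)
    have hhi : ∀ i, Integrable (h i) P := fun i => hle (hhm i) fun x =>
      hAle (hWA0 i x) (hWAw i x) (hI0 i x) (hI1 i x)
    have hkw : ∀ i x, chainLo br (q + 1) i x - chainLo br q i x ≤ chainWidth br q i x :=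
      fun i x => sub_le_sub_right ((hLf (q + 1) i x).trans (hfU q i x)) _
    have hk0 : ∀ i x, 0 ≤ chainLo br (q + 1) i x - chainLo br q i x := fun i x =>
      sub_nonneg.2 (chainLo_le_succ q i x)
    have hki : ∀ i, Integrable (k i) P := fun i => hle (hkm i) fun x =>
      hAle (hk0 i x) (hkw i x) (hA0 _ i x) (hA1 _ i x)
    -- Where the width exceeds `a q` the chain stops and leaves `t`. Elsewhere the point stays
    -- alive, and the remainder splits into the next remainder plus the link `k` between consecutive
    -- lower functions.
    have hdec : ∀ i, R q i = fun x => (t i x + R (q + 1) i x) + k i x := by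
      intro i
      funext x
      simp only [ht, hk, hR, hI, chainAlive]
      split_ifs <;> ring
    have hhS : SupMeanLE Pr (fun i ω => centeredSum P n (fun k => X k ω) (h i)) (E q) := by
      refine hlevel q h hhm (fun i i' hi => ?_) (fun i x => mul_nonneg (hWA0 i x) (hI0 i x))
        (fun i x => mul_le_of_le_one_right (hWA0 i x) (hI1 i x))
      simp only [hh, chainWidth_congr hi, chainAlive_congr hi, hIc i i' hi]
    -- Wherever `h` is nonzero the width `W` exceeds `a q`, so `W ≤ W² / a q`. This makes the mean
    -- small enough to dominate the stopped part `t` by `h` at the price of one `chainTerm`.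
    have hhint : ∀ i, ∫ x, h i x ∂P ≤ σ q ^ 2 / a q := by
      intro i
      have h1 : ∀ x, h i x ≤ (a q)⁻¹ * chainWidth br q i x ^ 2 := by
        intro x
        by_cases hx : chainWidth br q i x ≤ a q
        · simp only [hh, hI, if_pos hx, mul_zero]
          have := hapos q
          positivity
        · refine le_trans ((le_abs_self _).trans (hAle (hWA0 i x) (hWAw i x) (hI0 i x) (hI1 i x)))
            ?_
          rw [← div_eq_inv_mul, le_div_iff₀ (hapos q), sq]
          exact mul_le_mul_of_nonneg_left (not_le.1 hx).le (hW0 q i x)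
      have h2 := integrable_of_lintegral_ofReal_le ((hWm q i).pow_const 2)
        (fun x => sq_nonneg _) (hWsq q i)
      refine (integral_mono (hhi i) (h2.const_mul _) h1).trans ?_
      rw [integral_const_mul, div_eq_inv_mul]
      have := hapos q
      gcongr
      exact integral_le_of_lintegral_ofReal_le ((hWm q i).pow_const 2) (fun x => sq_nonneg _)
        (sq_nonneg _) (hWsq q i)
    have hval : 2 * n * (σ q ^ 2 / a q) = 2 * chainTerm S σ n q := by
      have := hσ q; have := hsH (q + 1)
      rw [ha, chainThreshold, chainTerm]
      generalize Real.sqrt (n : ℝ) = r at hsn hsn2 ⊢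
      rw [← hsn2]
      field_simp
    have htS : SupMeanLE Pr (fun i ω => centeredSum P n (fun k => X k ω) (t i))
        (E q + 2 * chainTerm S σ n q) := by
      rw [← hval]
      have := hapos q
      exact SupMeanLE.centeredSum_of_le (hE0 q) (by positivity) hhS
        (fun i x => mul_nonneg (hR0 i x) (hI0 i x))
        (fun i x => mul_le_mul_of_nonneg_right
          (mul_le_mul_of_nonneg_right (hfL q i x) (hA0 q i x)) (hI0 i x)) hhi htm hhint
    have hkS : SupMeanLE Pr (fun i ω => centeredSum P n (fun k => X k ω) (k i)) (E (q + 1)) := by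
      refine hX.supMeanLE_truncated hn hS hSn hσ hbr0 hbr q hkm (fun i i' hi => ?_)
        (fun i x => mul_nonneg (hk0 i x) (hA0 _ i x))
        (fun i x => mul_le_mul_of_nonneg_right (hkw i x) (hA0 _ i x))
      have hi' : ∀ j ≤ q, br j i = br j i' := fun j hj => hi j (by omega)
      simp only [hk, chainLo_congr hi, chainLo_congr hi', chainAlive_congr hi]
    have hG := hG0 q
    have h1 := (htS.of_le_add (add_nonneg (hE0 q) (by positivity)) hB hRB
      (W := fun i ω => centeredSum P n (fun k => X k ω) (t i) +
        centeredSum P n (fun k => X k ω) (R (q + 1) i)) fun ω i => abs_add_le _ _)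
    refine (h1.of_le_add (add_nonneg (add_nonneg (hE0 q) (by positivity)) hB) (hE0 (q + 1)) hkS
      (W := fun i ω => centeredSum P n (fun k => X k ω) (R q i)) fun ω i => ?_).mono
      (le_of_eq (by ring))
    have htR : Integrable (fun x => t i x + R (q + 1) i x) P := (hti i).add (hRi (q + 1) i)
    rw [hdec i, centeredSum_add _ _ _ htR (hki i),
      centeredSum_add _ _ _ (hti i) (hRi (q + 1) i)]
    exact abs_add_le _ _
  have hiter : ∀ k B, 0 ≤ B →
      SupMeanLE Pr (fun i ω => centeredSum P n (fun k => X k ω) (R k i)) B →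
      SupMeanLE Pr (fun i ω => centeredSum P n (fun k => X k ω) (R 0 i))
        (B + ∑ q ∈ Finset.range k, (E q + 2 * chainTerm S σ n q + E (q + 1))) := by
    intro k
    induction k with
    | zero => intro B _ h; simpa using h
    | succ k ih =>
      intro B hB h
      have h1 := hE0 k
      have h2 := hE0 (k + 1)
      have h3 := hG0 k
      refine (ih _ (by positivity) (hstep k B hB h)).mono (le_of_eq ?_)
      rw [Finset.sum_range_succ]
      ring
  -- At the end of the chain the remainder is dominated by the width itself, whose mean is at most
  -- `σ Q`; this is the source of the term `2 n σ_Q`.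
  have hlast : SupMeanLE Pr (fun i ω => centeredSum P n (fun k => X k ω) (R Q i))
      (E Q + 2 * n * σ Q) := by
    have h1 := hlevel Q (fun i x => chainWidth br Q i x * chainAlive br a Q i x)
      (fun i => (hWm Q i).mul (hAm Q i))
      (fun i i' hi => by simp only [chainWidth_congr hi, chainAlive_congr hi])
      (fun i x => mul_nonneg (hW0 Q i x) (hA0 Q i x)) (fun i x => le_rfl)
    have hi : ∀ i, Integrable (fun x => chainWidth br Q i x * chainAlive br a Q i x) P :=
      fun i => hle ((hWm Q i).mul (hAm Q i)) fun x =>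
        hAle (hW0 Q i x) le_rfl (hA0 Q i x) (hA1 Q i x)
    refine SupMeanLE.centeredSum_of_le (hE0 Q) (hσ Q).le h1
      (fun i x => mul_nonneg (sub_nonneg.2 (hLf Q i x)) (hA0 Q i x))
      (fun i x => mul_le_mul_of_nonneg_right (hfL Q i x) (hA0 Q i x)) hi (hRm Q) fun i => ?_
    refine (integral_mono (hi i) (hWi Q i) fun x =>
      mul_le_of_le_one_right (hW0 Q i x) (hA1 Q i x)).trans ?_
    exact integral_le_of_sq (hWm Q i) (hσ Q) (hWsq Q i)
  have hσQ := hσ Q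
  have hrem := hiter Q _ (add_nonneg (hE0 Q) (by positivity)) hlast
  -- the first level
  have hbase_mom : ∀ i, ∫⁻ x, ENNReal.ofReal (chainLo br 0 i x ^ 2 *
      Real.exp (c * |chainLo br 0 i x|)) ∂P ≤ ENNReal.ofReal (4 * (s ^ 2 + σ 0 ^ 2)) := by
    intro i
    have hpt : ∀ x, ENNReal.ofReal (chainLo br 0 i x ^ 2 * Real.exp (c * |chainLo br 0 i x|)) ≤
        ENNReal.ofReal 4 * (ENNReal.ofReal (f i x ^ 2 * Real.exp (1 / 2 * |f i x|)) +
          ENNReal.ofReal (((br 0 i).2 x - (br 0 i).1 x) ^ 2 *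
            Real.exp (1 / 2 * |(br 0 i).2 x - (br 0 i).1 x|))) := by
      intro x
      rw [← ENNReal.ofReal_add (by positivity) (by positivity),
        ← ENNReal.ofReal_mul (by norm_num)]
      apply ENNReal.ofReal_le_ofReal
      -- The lower function is bounded by twice the larger of `|f|` and the bracket width. The
      -- doubling costs a factor 4 in the square and is absorbed in the exponent because `c ≤ 1 /
      -- 4`.
      have key : ∀ y z : ℝ, |y| ≤ 2 * |z| → y ^ 2 * Real.exp (c * |y|) ≤
          4 * (z ^ 2 * Real.exp (1 / 2 * |z|)) := by
        intro y z hyz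
        have h1 : y ^ 2 ≤ 4 * z ^ 2 := by
          have := sq_le_sq.2 (show |y| ≤ |2 * z| by rwa [abs_mul, abs_two])
          linarith [mul_pow 2 z 2]
        have h2 : c * |y| ≤ 1 / 2 * |z| := by
          calc c * |y| ≤ 1 / 4 * (2 * |z|) := by gcongr
            _ = _ := by ring
        calc y ^ 2 * Real.exp (c * |y|) ≤ (4 * z ^ 2) * Real.exp (1 / 2 * |z|) := by gcongr
          _ = _ := by ring
      have hp1 : 0 ≤ f i x ^ 2 * Real.exp (1 / 2 * |f i x|) := by positivity
      have hp2 : 0 ≤ ((br 0 i).2 x - (br 0 i).1 x) ^ 2 *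
            Real.exp (1 / 2 * |(br 0 i).2 x - (br 0 i).1 x|) := by positivity
      have h3 : |chainLo br 0 i x| ≤ |f i x| + |(br 0 i).2 x - (br 0 i).1 x| := by
        have h4 := hLf 0 i x
        have h5 := (hf 0 i x).2
        rw [abs_of_nonneg (sub_nonneg.2 (hbr0 0 i x))]
        simp only [chainLo] at h4 ⊢
        rw [abs_le]
        constructor <;> linarith [neg_abs_le (f i x), le_abs_self (f i x), hbr0 0 i x]
      rcases le_total |f i x| |(br 0 i).2 x - (br 0 i).1 x| with h | h
      · have := key _ ((br 0 i).2 x - (br 0 i).1 x) (h3.trans (by linarith))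
        linarith
      · have := key _ (f i x) (h3.trans (by linarith))
        linarith
    refine (lintegral_mono hpt).trans ?_
    have hm1 : Measurable fun x => ENNReal.ofReal (f i x ^ 2 * Real.exp (1 / 2 * |f i x|)) := by
      have := hfm i
      fun_prop
    rw [lintegral_const_mul' _ _ ENNReal.ofReal_ne_top, lintegral_add_left hm1,
      ENNReal.ofReal_mul (by norm_num), ENNReal.ofReal_add (sq_nonneg _) (sq_nonneg _)]
    gcongr
    · exact hs i
    · exact hbr 0 i
  have hbase := hX.supMeanLE_factors n hS hSn 0 (hLm 0) (fun i i' hi => chainLo_congr hi) hc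
    (by positivity) hbase_mom
  have hLi : ∀ i, Integrable (chainLo br 0 i) P := fun i =>
    integrable_of_sq (hLm 0 i) (sq_moment_le hc.le (hbase_mom i))
  have hH0 := hH1 0
  -- Each `chainTerm` occurs with weight 4 as the error of the level it leads to, 4 as the link to
  -- that level, and 2 from the stopped mean: 10 in all.
  have htot : E Q + 2 * n * σ Q +
      ∑ q ∈ Finset.range Q, (E q + 2 * chainTerm S σ n q + E (q + 1)) =
      E 0 + 10 * ∑ q ∈ Finset.range Q, chainTerm S σ n q + 2 * n * σ Q := by
    have h1 : ∀ k, E k + ∑ q ∈ Finset.range k, (E q + 2 * chainTerm S σ n q + E (q + 1)) =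
        E 0 + 10 * ∑ q ∈ Finset.range k, chainTerm S σ n q := by
      intro k
      induction k with
      | zero => simp
      | succ k ih =>
        rw [Finset.sum_range_succ, Finset.sum_range_succ]
        have h2 : E (k + 1) = 4 * chainTerm S σ n k := rfl
        linarith
    linarith [h1 Q]
  rw [htot] at hrem
  have hsum0 : 0 ≤ ∑ q ∈ Finset.range Q, chainTerm S σ n q := Finset.sum_nonneg fun q _ => hG0 q
  refine (hbase.of_le_add (by positivity)
    (add_nonneg (add_nonneg (hE0 0) (by positivity)) (by positivity)) hrem
    (W := fun i ω => centeredSum P n (fun k => X k ω) (f i)) fun ω i => ?_).mono ?_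
  · have : f i = fun x => chainLo br 0 i x + R 0 i x := by
      funext x
      simp [hR, chainAlive]
    rw [this, centeredSum_add _ _ _ (hLi i) (hRi 0 i)]
    exact abs_add_le _ _
  · have h1 : E 0 ≤ c⁻¹ * (chainEntropy S 0 + n * (c ^ 2 * (4 * (s ^ 2 + σ 0 ^ 2)))) := by
      simp only [hE]
      have : σ 0 ^ 2 ≤ 4 * (s ^ 2 + σ 0 ^ 2) := by nlinarith [sq_nonneg s, sq_nonneg (σ 0)]
      gcongr
    linarith

end Chain

/-! ### The maximal inequality in terms of the entropy integral -/

section Entropy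

variable {𝒳 : Type*} {𝓑 : Set ((𝒳 → ℝ) × (𝒳 → ℝ))} {F : Set (𝒳 → ℝ)}
  {d : (𝒳 → ℝ) → (𝒳 → ℝ) → ℝ}

lemma bracketingNumber_anti {ε ε' : ℝ} (h : ε ≤ ε') :
    bracketingNumber 𝓑 ε' F d ≤ bracketingNumber 𝓑 ε F d :=
  le_iInf₂ fun S hS => iInf₂_le S ⟨fun b hb => ⟨(hS.1 b hb).1, (hS.1 b hb).2.trans_le h⟩, hS.2⟩

lemma exists_cover_of_bracketingNumber_ne_top {ε : ℝ} (h : bracketingNumber 𝓑 ε F d ≠ ⊤) :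
    ∃ S : Finset ((𝒳 → ℝ) × (𝒳 → ℝ)), (∀ b ∈ S, b ∈ 𝓑 ∧ d b.1 b.2 < ε) ∧
      (∀ f ∈ F, ∃ b ∈ S, ∀ x, b.1 x ≤ f x ∧ f x ≤ b.2 x) ∧
      S.card ≤ (bracketingNumber 𝓑 ε F d).toNat := by
  -- A finite infimum in `ℕ∞` lies strictly below its successor, so some admissible cover attains
  -- it.
  have h1 : bracketingNumber 𝓑 ε F d < bracketingNumber 𝓑 ε F d + 1 :=
    (ENat.lt_add_one_iff h).2 le_rfl
  nth_rewrite 1 [bracketingNumber] at h1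
  obtain ⟨S, hS⟩ := iInf_lt_iff.1 h1
  obtain ⟨hS1, hS2⟩ := iInf_lt_iff.1 hS
  refine ⟨S, hS1.1, hS1.2, ?_⟩
  have h3 := (ENat.lt_add_one_iff h).1 hS2
  rw [← ENat.natCast_toNat h] at h3
  exact_mod_cast h3

lemma sqrtEntropy_mono {N N' : ℕ∞} (h : N ≤ N') : sqrtEntropy N ≤ sqrtEntropy N' := by
  unfold sqrtEntropy
  split_ifs with h1 h2 h2
  · exact le_rfl
  · exact absurd (top_le_iff.1 (h1 ▸ h)) h2
  · exact le_top
  · apply ENNReal.ofReal_le_ofReal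
    apply Real.sqrt_le_sqrt
    have h3 : N.toNat ≤ N'.toNat := ENat.toNat_le_toNat h h2
    -- The empty cover is harmless because `log 0 = 0`.
    rcases Nat.eq_zero_or_pos N.toNat with h4 | h4
    · rw [h4]
      simp only [Nat.cast_zero, Real.log_zero]
      linarith [Real.log_natCast_nonneg N'.toNat]
    · gcongr

lemma bracketingIntegral_mono {δ δ' : ℝ} (h : δ ≤ δ') :
    bracketingIntegral 𝓑 δ F d ≤ bracketingIntegral 𝓑 δ' F d :=
  lintegral_mono_set (Ioc_subset_Ioc_right h)

/-- The entropy integral dominates its dyadic Riemann sums. -/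
lemma sum_sqrtEntropy_le_bracketingIntegral {r : ℝ} (hr : 0 < r) (k : ℕ) :
    ∑ j ∈ Finset.range k, ENNReal.ofReal ((1 / 2) ^ (j + 1) * r) *
      sqrtEntropy (bracketingNumber 𝓑 ((1 / 2) ^ j * r) F d) ≤ bracketingIntegral 𝓑 r F d := by
  have hpow : ∀ k : ℕ, (0 : ℝ) < (1 / 2) ^ k * r := fun k => by positivity
  have hstep : ∀ k : ℕ, ((1 : ℝ) / 2) ^ (k + 1) * r ≤ (1 / 2) ^ k * r := fun k => by
    rw [pow_succ]; nlinarith [hpow k]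
  have hle : ∀ k : ℕ, ((1 : ℝ) / 2) ^ k * r ≤ r := fun k =>
    mul_le_of_le_one_left hr.le (pow_le_one₀ (by norm_num) (by norm_num))
  suffices h : ∀ k : ℕ, ∑ j ∈ Finset.range k, ENNReal.ofReal ((1 / 2) ^ (j + 1) * r) *
      sqrtEntropy (bracketingNumber 𝓑 ((1 / 2) ^ j * r) F d) ≤
      ∫⁻ ε in Ioc ((1 / 2) ^ k * r) r, sqrtEntropy (bracketingNumber 𝓑 ε F d) from
    (h k).trans (lintegral_mono_set (Ioc_subset_Ioc_left (hpow k).le))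
  intro k
  induction k with
  | zero => simp
  | succ k ih =>
    -- On each dyadic interval the entropy is at least its value at the right endpoint, and the
    -- interval has length `(1 / 2) ^ (k + 1) * r`.
    rw [Finset.sum_range_succ, ← Ioc_union_Ioc_eq_Ioc (hstep k) (hle k), union_comm,
      lintegral_union measurableSet_Ioc
        (Set.disjoint_left.2 fun x hx hx' => absurd hx.1 (not_lt.2 hx'.2))]
    refine add_le_add ih ?_
    calc ENNReal.ofReal ((1 / 2) ^ (k + 1) * r) *
          sqrtEntropy (bracketingNumber 𝓑 ((1 / 2) ^ k * r) F d)
        = ∫⁻ _ in Ioc ((1 / 2) ^ (k + 1) * r) ((1 / 2) ^ k * r),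
            sqrtEntropy (bracketingNumber 𝓑 ((1 / 2) ^ k * r) F d) := by
          rw [setLIntegral_const, Real.volume_Ioc, mul_comm]
          congr 2
          rw [pow_succ]; ring
      _ ≤ _ := setLIntegral_mono' measurableSet_Ioc fun ε hε =>
          sqrtEntropy_mono (bracketingNumber_anti hε.2)

/-- A finite entropy integral yields finite covers on all dyadic scales. -/
lemma exists_dyadic_covers {r Φ : ℝ} (hr : 0 < r) (hΦ : 0 ≤ Φ)
    (hJ : bracketingIntegral 𝓑 r F d ≤ ENNReal.ofReal Φ) :
    ∃ (S : ℕ → Finset ((𝒳 → ℝ) × (𝒳 → ℝ))) (h : ℕ → ℝ),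
      (∀ q, ∀ b ∈ S q, b ∈ 𝓑 ∧ d b.1 b.2 < (1 / 2) ^ q * r) ∧
      (∀ q, ∀ f ∈ F, ∃ b ∈ S q, ∀ x, b.1 x ≤ f x ∧ f x ≤ b.2 x) ∧
      (∀ q, 0 ≤ h q ∧ 1 + Real.log (S q).card ≤ h q ^ 2) ∧
      ∀ k, ∑ j ∈ Finset.range k, (1 / 2) ^ j * h j ≤ 2 * Φ / r := by
  have hsum := fun k => (sum_sqrtEntropy_le_bracketingIntegral (𝓑 := 𝓑) (F := F) (d := d) hr k).trans hJ
  have hfin : ∀ q, bracketingNumber 𝓑 ((1 / 2) ^ q * r) F d ≠ ⊤ := by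
    intro q hq
    have h1 := (Finset.single_le_sum (f := fun j => ENNReal.ofReal ((1 / 2) ^ (j + 1) * r) *
      sqrtEntropy (bracketingNumber 𝓑 ((1 / 2) ^ j * r) F d)) (fun _ _ => zero_le)
      (Finset.self_mem_range_succ q)).trans (hsum (q + 1))
    simp only [hq, sqrtEntropy, if_true] at h1
    rw [ENNReal.mul_top (by
      rw [Ne, ENNReal.ofReal_eq_zero, not_le]; positivity)] at h1
    exact ENNReal.ofReal_ne_top (top_le_iff.1 h1)
  choose S hS1 hS2 hS3 using fun q => exists_cover_of_bracketingNumber_ne_top (hfin q)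
  set h : ℕ → ℝ := fun q =>
    Real.sqrt (1 + Real.log ((bracketingNumber 𝓑 ((1 / 2) ^ q * r) F d).toNat : ℝ)) with hh
  refine ⟨S, h, hS1, hS2, fun q => ⟨Real.sqrt_nonneg _, ?_⟩, fun k => ?_⟩
  · have hlog := Real.log_natCast_nonneg (bracketingNumber 𝓑 ((1 / 2) ^ q * r) F d).toNat
    simp only [hh]
    rw [Real.sq_sqrt (by linarith)]
    rcases Nat.eq_zero_or_pos (S q).card with h4 | h4
    · rw [h4]; simpa using hlog
    · have := hS3 q
      gcongr
  · have h1 := hsum k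
    have h2 : ∀ j, sqrtEntropy (bracketingNumber 𝓑 ((1 / 2) ^ j * r) F d) =
        ENNReal.ofReal (h j) := fun j => by rw [sqrtEntropy, if_neg (hfin j)]
    have h0 : ∀ j, 0 ≤ h j := fun j => Real.sqrt_nonneg _
    simp only [h2] at h1
    have h3 : ∑ j ∈ Finset.range k, ENNReal.ofReal ((1 / 2) ^ (j + 1) * r) * ENNReal.ofReal (h j) =
        ENNReal.ofReal (∑ j ∈ Finset.range k, (1 / 2) ^ (j + 1) * r * h j) := by
      rw [ENNReal.ofReal_sum_of_nonneg fun j _ => mul_nonneg (by positivity) (h0 j)]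
      exact Finset.sum_congr rfl fun j _ => (ENNReal.ofReal_mul (by positivity)).symm
    rw [h3, ENNReal.ofReal_le_ofReal_iff hΦ] at h1
    rw [le_div_iff₀ hr]
    calc (∑ j ∈ Finset.range k, (1 / 2) ^ j * h j) * r
        = 2 * ∑ j ∈ Finset.range k, (1 / 2) ^ (j + 1) * r * h j := by
          rw [Finset.sum_mul, Finset.mul_sum]
          exact Finset.sum_congr rfl fun j _ => by rw [pow_succ]; ring
      _ ≤ 2 * Φ := by linarith

/-- The logarithm turns the product of cardinalities into a sum. The extra `1 + log 2 ≤ 2` is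
absorbed by doubling `h 0 ^ 2`, which is at least 1. A separate count `N` is allowed because
transformed brackets may coincide. -/
lemma chainEntropy_le {S : ℕ → Finset ((𝒳 → ℝ) × (𝒳 → ℝ))} {N : ℕ → ℕ} {h : ℕ → ℝ}
    (hS : ∀ q, (S q).Nonempty) (hN : ∀ q, (S q).card ≤ N q)
    (hh : ∀ q, 0 ≤ h q ∧ 1 + Real.log (N q) ≤ h q ^ 2) (q : ℕ) :
    chainEntropy S q ≤ 2 * ∑ j ∈ Finset.range (q + 1), h j ^ 2 := by
  have hpos : ∀ j, (0 : ℝ) < (S j).card := fun j => by exact_mod_cast Finset.card_pos.2 (hS j)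
  have h1 : ∀ j, Real.log ((S j).card) ≤ h j ^ 2 - 1 := fun j => by
    have h2 : Real.log ((S j).card) ≤ Real.log (N j) :=
      Real.log_le_log (hpos j) (by exact_mod_cast hN j)
    linarith [(hh j).2]
  have hl0 : ∀ j, 0 ≤ Real.log ((S j).card) := fun j => Real.log_natCast_nonneg _
  rw [chainEntropy, Real.log_mul (by norm_num) (Finset.prod_pos fun j _ => hpos j).ne',
    Real.log_prod fun j _ => (hpos j).ne', Finset.sum_range_succ']
  rw [Finset.sum_range_succ']
  have h3 : ∑ j ∈ Finset.range q, Real.log ((S (j + 1)).card) ≤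
      2 * ∑ j ∈ Finset.range q, h (j + 1) ^ 2 := by
    rw [Finset.mul_sum]
    exact Finset.sum_le_sum fun j _ => by linarith [h1 (j + 1), hl0 (j + 1)]
  have h4 : Real.log 2 ≤ 1 := by linarith [Real.log_two_lt_d9]
  linarith [h1 0, hl0 0]

end Entropy

/-- After exchanging the sums, `h j` has coefficient at most `ρ ^ (j - 1) / (1 - ρ) ≤ 8 ρ ^ j` for
positive `j`. The induction carries `4 ρ ^ Q ∑ h`, a bound for the geometric tail not yet summed, as
`1 / (1 - ρ) ≤ 4`. -/
lemma sum_geometric_mul_partial_sum_le {ρ : ℝ} (h1 : 1 / 2 ≤ ρ) (h2 : ρ ≤ 3 / 4) {h : ℕ → ℝ}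
    (h0 : ∀ q, 0 ≤ h q) (Q : ℕ) :
    ∑ q ∈ Finset.range Q, ρ ^ q * ∑ j ∈ Finset.range (q + 2), h j ≤
      8 * ∑ j ∈ Finset.range (Q + 1), ρ ^ j * h j := by
  suffices H : ∑ q ∈ Finset.range Q, ρ ^ q * ∑ j ∈ Finset.range (q + 2), h j +
      4 * (ρ ^ Q * ∑ j ∈ Finset.range (Q + 1), h j) ≤
      8 * ∑ j ∈ Finset.range (Q + 1), ρ ^ j * h j by
    have : 0 ≤ 4 * (ρ ^ Q * ∑ j ∈ Finset.range (Q + 1), h j) := by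
      have := Finset.sum_nonneg fun j (_ : j ∈ Finset.range (Q + 1)) => h0 j
      positivity
    linarith
  induction Q with
  | zero => simp; linarith [h0 0]
  | succ Q ih =>
    rw [Finset.sum_range_succ (n := Q), Finset.sum_range_succ (n := Q + 1) (f := fun j => ρ ^ j * h j),
      Finset.sum_range_succ (n := Q + 1) (f := h), pow_succ]
    have hT := Finset.sum_nonneg fun j (_ : j ∈ Finset.range (Q + 1)) => h0 j
    set T := ∑ j ∈ Finset.range (Q + 1), h j
    have hp : 0 < ρ ^ Q := by positivity
    have h3 := h0 (Q + 1)
    have h4 : ρ ^ Q * (T + h (Q + 1)) + 4 * (ρ ^ Q * ρ * (T + h (Q + 1))) ≤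
        4 * (ρ ^ Q * T) + 8 * (ρ ^ Q * ρ * h (Q + 1)) := by
      have h5 : 0 ≤ ρ ^ Q * (T * (3 - 4 * ρ) + h (Q + 1) * (4 * ρ - 1)) := by
        have : 0 ≤ 3 - 4 * ρ := by linarith
        have : 0 ≤ 4 * ρ - 1 := by linarith
        positivity
      nlinarith
    linarith

section Main

variable {Ω 𝒳 ι : Type*} [MeasurableSpace Ω] [MeasurableSpace 𝒳]

lemma SupMeanLE.of_isEmpty [IsEmpty ι] {Pr : Measure Ω} (V : ι → Ω → ℝ) (B : ℝ) :
    SupMeanLE Pr V B :=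
  ⟨fun _ => 0, measurable_const, Eventually.of_forall fun _ i => isEmptyElim i, by simp⟩

/-- The maximal inequality for a class covered by brackets, which hold almost surely. -/
theorem IsIIDSample.supMeanLE_chain_ae {β : Type*} {Pr : Measure Ω}
    [IsProbabilityMeasure Pr] {P : Measure 𝒳} [IsProbabilityMeasure P] {X : ℕ → Ω → 𝒳}
    (hX : IsIIDSample Pr P X) {n : ℕ} (hn : 0 < n) {S : ℕ → Finset β} {b : ℕ → ι → β}
    (hS : ∀ q i, b q i ∈ S q) {τ : β → (𝒳 → ℝ) × (𝒳 → ℝ)} {f : ι → 𝒳 → ℝ}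
    (hτm : ∀ q i, Measurable (τ (b q i)).1 ∧ Measurable (τ (b q i)).2)
    (hfm : ∀ i, Measurable (f i))
    (hf : ∀ᵐ x ∂P, ∀ q i, (τ (b q i)).1 x ≤ f i x ∧ f i x ≤ (τ (b q i)).2 x)
    {σ ρ : ℝ} (hσ : 0 < σ) (hρ1 : 1 / 2 ≤ ρ) (hρ2 : ρ ≤ 3 / 4)
    (hbr : ∀ q i, bernMoment P (fun x => (τ (b q i)).2 x - (τ (b q i)).1 x) ≤
      ENNReal.ofReal ((σ * ρ ^ q) ^ 2))
    {s : ℝ} (hs : ∀ i, bernMoment P (f i) ≤ ENNReal.ofReal (s ^ 2))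
    {h : ℕ → ℝ} (hh : ∀ q, 0 ≤ h q ∧ 1 + Real.log (S q).card ≤ h q ^ 2)
    {c : ℝ} (hc : 0 < c) (hc4 : c ≤ 1 / 4) (Q : ℕ) :
    SupMeanLE Pr (fun i ω => centeredSum P n (fun k => X k ω) (f i))
      (2 * c⁻¹ * (2 * h 0 ^ 2 + n * (c ^ 2 * (4 * (s ^ 2 + σ ^ 2)))) +
        160 * (Real.sqrt n * σ * ∑ j ∈ Finset.range (Q + 1), ρ ^ j * h j) +
        2 * n * (σ * ρ ^ Q)) := by
  classical
  rcases isEmpty_or_nonempty ι with hι | hι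
  · exact SupMeanLE.of_isEmpty _ _
  -- The index type may be uncountable, so the good set need not be measurable; a measurable hull of
  -- the bad set is removed instead. Multiplying by the indicator of `A` makes the bracket
  -- inequalities hold everywhere and almost surely leaves the sums unchanged.
  set A : Set 𝒳 := (toMeasurable P
    {x | ¬ ∀ q i, (τ (b q i)).1 x ≤ f i x ∧ f i x ≤ (τ (b q i)).2 x})ᶜ with hA
  have hAm : MeasurableSet A := (measurableSet_toMeasurable _ _).compl
  have hAae : ∀ᵐ x ∂P, x ∈ A := by
    rw [ae_iff]
    simpa [hA, measure_toMeasurable] using ae_iff.1 hf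
  have hAb : ∀ x ∈ A, ∀ q i, (τ (b q i)).1 x ≤ f i x ∧ f i x ≤ (τ (b q i)).2 x := by
    intro x hx
    by_contra hcon
    exact hx (subset_toMeasurable P _ hcon)
  set τ' : β → (𝒳 → ℝ) × (𝒳 → ℝ) := fun y => (A.indicator (τ y).1, A.indicator (τ y).2) with hτ'
  set S' : ℕ → Finset ((𝒳 → ℝ) × (𝒳 → ℝ)) := fun q => (S q).image τ' with hS'
  have hmem : ∀ q i, τ' (b q i) ∈ S' q := fun q i => Finset.mem_image_of_mem _ (hS q i)
  have hSn : ∀ q, (S' q).Nonempty := fun q => ⟨_, hmem q (Classical.arbitrary ι)⟩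
  have hρ0 : 0 < ρ := by linarith
  have hind : ∀ g : 𝒳 → ℝ, ∀ x, |A.indicator g x| ≤ |g x| := fun g x => by
    by_cases hx : x ∈ A <;> simp [hx]
  have hchain := hX.supMeanLE_chain hn (br := fun q i => τ' (b q i)) (S := S')
    (f := fun i => A.indicator (f i)) (σ := fun q => σ * ρ ^ q) hmem (fun q => by positivity)
    (fun q i => ⟨(hτm q i).1.indicator hAm, (hτm q i).2.indicator hAm⟩)
    (fun i => (hfm i).indicator hAm)
    (fun q i x => by
      by_cases hx : x ∈ A
      · simpa [hτ', hx] using hAb x hx q i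
      · simp [hτ', hx])
    (fun q i => by
      refine le_trans (bernMoment_mono (Eventually.of_forall fun x => ?_)) (hbr q i)
      by_cases hx : x ∈ A <;> simp [hτ', hx])
    (s := s) (fun i => (bernMoment_mono (Eventually.of_forall (hind (f i)))).trans (hs i))
    hc hc4 Q
  have hXA : ∀ᵐ ω ∂Pr, ∀ k, X k ω ∈ A := by
    rw [ae_all_iff]
    intro k
    have := hAae
    rw [← hX.law k] at this
    exact ae_of_ae_map (hX.meas k).aemeasurable this
  refine (hchain.of_abs_le (W := fun i ω => centeredSum P n (fun k => X k ω) (f i)) ?_).mono ?_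
  · filter_upwards [hXA] with ω hω i
    apply le_of_eq
    congr 1
    have h1 : ∫ x, f i x ∂P = ∫ x, A.indicator (f i) x ∂P := by
      apply integral_congr_ae
      filter_upwards [hAae] with x hx
      simp [hx]
    simp [centeredSum, hω, h1]
  · have hH := chainEntropy_le hSn (fun q => Finset.card_image_le) hh
    -- Replacing the root of a sum of squares by a sum makes the bound linear in `h`, so that
    -- `sum_geometric_mul_partial_sum_le` applies.
    have hsq : ∀ q, Real.sqrt (chainEntropy S' q) ≤ 2 * ∑ j ∈ Finset.range (q + 1), h j := by
      intro q
      have h0 : 0 ≤ ∑ j ∈ Finset.range (q + 1), h j := Finset.sum_nonneg fun j _ => (hh j).1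
      refine Real.sqrt_le_iff.2 ⟨by positivity, (hH q).trans ?_⟩
      have := Finset.sum_sq_le_sq_sum_of_nonneg (s := Finset.range (q + 1)) (f := h)
        fun j _ => (hh j).1
      nlinarith
    have hterm : ∀ q, chainTerm S' (fun q => σ * ρ ^ q) n q ≤
        2 * (Real.sqrt n * σ) * (ρ ^ q * ∑ j ∈ Finset.range (q + 2), h j) := by
      intro q
      rw [chainTerm]
      calc _ ≤ Real.sqrt n * (σ * ρ ^ q) * (2 * ∑ j ∈ Finset.range (q + 2), h j) := by
            gcongr
            exact hsq (q + 1)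
        _ = _ := by ring
    have hsum : ∑ q ∈ Finset.range Q, chainTerm S' (fun q => σ * ρ ^ q) n q ≤
        16 * (Real.sqrt n * σ * ∑ j ∈ Finset.range (Q + 1), ρ ^ j * h j) := by
      refine (Finset.sum_le_sum fun q _ => hterm q).trans ?_
      rw [← Finset.mul_sum]
      have := sum_geometric_mul_partial_sum_le hρ1 hρ2 (fun q => (hh q).1) Q
      calc _ ≤ 2 * (Real.sqrt n * σ) * (8 * ∑ j ∈ Finset.range (Q + 1), ρ ^ j * h j) := by gcongr
        _ = _ := by ring
    have h0 := hH 0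
    simp only [zero_add, Finset.range_one, Finset.sum_singleton] at h0
    have hfirst : 2 * c⁻¹ * (chainEntropy S' 0 + n * (c ^ 2 * (4 * (s ^ 2 + (σ * ρ ^ 0) ^ 2)))) ≤
        2 * c⁻¹ * (2 * h 0 ^ 2 + n * (c ^ 2 * (4 * (s ^ 2 + σ ^ 2)))) := by
      rw [pow_zero, mul_one]
      gcongr
    linarith

/-- The maximal inequality for a class with finite entropy integral. -/
theorem IsIIDSample.supMeanLE_bracketing {Pr : Measure Ω}
    [IsProbabilityMeasure Pr] {P : Measure 𝒳} [IsProbabilityMeasure P] {X : ℕ → Ω → 𝒳}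
    (hX : IsIIDSample Pr P X) {n : ℕ} (hn : 0 < n) {𝓑 : Set ((𝒳 → ℝ) × (𝒳 → ℝ))}
    {F : Set (𝒳 → ℝ)} {d : (𝒳 → ℝ) → (𝒳 → ℝ) → ℝ} {r Φ : ℝ} (hr : 0 < r) (hΦ : 0 ≤ Φ)
    (hJ : bracketingIntegral 𝓑 r F d ≤ ENNReal.ofReal Φ)
    {τ : (𝒳 → ℝ) × (𝒳 → ℝ) → (𝒳 → ℝ) × (𝒳 → ℝ)} {f : (𝒳 → ℝ) → 𝒳 → ℝ}
    (hτm : ∀ b ∈ 𝓑, Measurable (τ b).1 ∧ Measurable (τ b).2)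
    (hfm : ∀ D ∈ F, Measurable (f D))
    (hf : ∀ b ∈ 𝓑, ∀ᵐ x ∂P, ∀ D ∈ F, b.1 x ≤ D x → D x ≤ b.2 x →
      (τ b).1 x ≤ f D x ∧ f D x ≤ (τ b).2 x)
    {σ ρ : ℝ} (hσ : 0 < σ) (hρ1 : 1 / 2 ≤ ρ) (hρ2 : ρ ≤ 3 / 4)
    (hbr : ∀ q : ℕ, ∀ b ∈ 𝓑, d b.1 b.2 < (1 / 2) ^ q * r →
      bernMoment P (fun x => (τ b).2 x - (τ b).1 x) ≤ ENNReal.ofReal ((σ * ρ ^ q) ^ 2))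
    {s : ℝ} (hs : ∀ D ∈ F, bernMoment P (f D) ≤ ENNReal.ofReal (s ^ 2))
    {c : ℝ} (hc : 0 < c) (hc4 : c ≤ 1 / 4) (Q : ℕ) :
    SupMeanLE Pr (fun (D : F) ω => centeredSum P n (fun k => X k ω) (f D))
      (2 * c⁻¹ * (2 * (2 * Φ / r) ^ 2 + n * (c ^ 2 * (4 * (s ^ 2 + σ ^ 2)))) +
        160 * (Real.sqrt n * σ * ((2 * ρ) ^ Q * (2 * Φ / r))) + 2 * n * (σ * ρ ^ Q)) := by
  obtain ⟨S, h, hS1, hS2, hh, hsum⟩ := exists_dyadic_covers hr hΦ hJ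
  choose b hb hbD using fun (q : ℕ) (D : F) => hS2 q D D.2
  have hmem : ∀ q D, b q D ∈ 𝓑 := fun q D => (hS1 q _ (hb q D)).1
  have hae : ∀ᵐ x ∂P, ∀ q, ∀ y ∈ S q, ∀ D ∈ F, y.1 x ≤ D x → D x ≤ y.2 x →
      (τ y).1 x ≤ f D x ∧ f D x ≤ (τ y).2 x := by
    rw [ae_all_iff]
    intro q
    exact (Finset.eventually_all (S q)).2 fun y hy => hf y (hS1 q y hy).1
  refine (hX.supMeanLE_chain_ae hn hb (τ := τ) (f := fun D : F => f D)
    (fun q D => hτm _ (hmem q D)) (fun D => hfm D D.2) ?_ hσ hρ1 hρ2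
    (fun q D => hbr q _ (hmem q D) (hS1 q _ (hb q D)).2) (fun D => hs D D.2) hh hc hc4 Q).mono ?_
  · filter_upwards [hae] with x hx q D
    exact hx q _ (hb q D) D D.2 (hbD q D x).1 (hbD q D x).2
  · have h0 : h 0 ≤ 2 * Φ / r := by simpa using hsum 1
    -- The entropy integral controls the weights `(1 / 2) ^ j` only. Slower decay of the bracket
    -- sizes costs `(2ρ) ^ Q`, which is 1 for `ρ = 1 / 2` but grows with the chain length for `ρ =
    -- √(1 / 2)`.
    have h1 : ∑ j ∈ Finset.range (Q + 1), ρ ^ j * h j ≤ (2 * ρ) ^ Q * (2 * Φ / r) := by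
      calc _ ≤ ∑ j ∈ Finset.range (Q + 1), (2 * ρ) ^ Q * ((1 / 2) ^ j * h j) := by
            refine Finset.sum_le_sum fun j hj => ?_
            have hjQ : j ≤ Q := by simpa [Nat.lt_succ_iff] using hj
            have h2 : (2 * ρ) ^ j ≤ (2 * ρ) ^ Q := pow_le_pow_right₀ (by linarith) hjQ
            have h3 : ρ ^ j = (2 * ρ) ^ j * (1 / 2) ^ j := by rw [← mul_pow]; ring_nf
            rw [h3, mul_assoc]
            exact mul_le_mul_of_nonneg_right h2 (mul_nonneg (by positivity) (hh j).1)
        _ ≤ _ := by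
            rw [← Finset.mul_sum]
            exact mul_le_mul_of_nonneg_left (hsum _) (by positivity)
    have := (hh 0).1
    gcongr

end Main

/-! ### Pointwise inequalities for logarithms and square roots -/

lemma two_log_sq_mul_exp_le {y : ℝ} (hy : 1 ≤ y) :
    (2 * Real.log y) ^ 2 * Real.exp (1 / 2 * |2 * Real.log y|) ≤ 4 * (y - 1) ^ 2 := by
  have h0 : 0 ≤ 2 * Real.log y := by have := Real.log_nonneg hy; positivity
  have h := sq_mul_exp_half_le h0
  have h1 : Real.exp (2 * Real.log y / 2) = y := by
    rw [mul_div_cancel_left₀ _ (by norm_num : (2 : ℝ) ≠ 0), Real.exp_log (by linarith)]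
  rw [h1] at h
  rwa [abs_of_nonneg h0, show 1 / 2 * (2 * Real.log y) = 2 * Real.log y / 2 by ring, h1]

lemma two_log_sq_mul_exp_le_of_le_one {y : ℝ} (hy0 : 0 < y) (hy : y ≤ 1) :
    (2 * Real.log y) ^ 2 * Real.exp (1 / 2 * |2 * Real.log y|) ≤ 4 * (y⁻¹ - 1) ^ 2 := by
  have h := two_log_sq_mul_exp_le ((one_le_inv₀ hy0).2 hy)
  rw [Real.log_inv, mul_neg, abs_neg, neg_sq] at h
  exact h

lemma log_eq_two_log_sqrt {x : ℝ} (hx : 0 ≤ x) : Real.log x = 2 * Real.log (Real.sqrt x) := by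
  rw [Real.log_sqrt hx]; ring

lemma sq_sqrt_mid_sub_le {a b : ℝ} :
    (Real.sqrt ((a + b) / 2) - Real.sqrt b) ^ 2 ≤ (Real.sqrt a - Real.sqrt b) ^ 2 := by
  apply sq_le_sq.2
  rcases le_total a b with h | h
  · have h1 : Real.sqrt a ≤ Real.sqrt ((a + b) / 2) := Real.sqrt_le_sqrt (by linarith)
    have h2 : Real.sqrt ((a + b) / 2) ≤ Real.sqrt b := Real.sqrt_le_sqrt (by linarith)
    rw [abs_of_nonpos (by linarith), abs_of_nonpos (by linarith)]
    linarith
  · have h1 : Real.sqrt ((a + b) / 2) ≤ Real.sqrt a := Real.sqrt_le_sqrt (by linarith)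
    have h2 : Real.sqrt b ≤ Real.sqrt ((a + b) / 2) := Real.sqrt_le_sqrt (by linarith)
    rw [abs_of_nonneg (by linarith), abs_of_nonneg (by linarith)]
    linarith

/-- With `x`, `y`, `z` the roots of `a`, `b` and the midpoint, `(x - y)(x + y) = 2 (z - y)(z + y)`
and `z + y ≤ 2 (x + y)`, so `|x - y| ≤ 4 |z - y|`. It converts a distance to the midpoint back into
a distance to `D`. -/
lemma sq_sqrt_sub_le_sixteen_mul {a b : ℝ} (ha : 0 ≤ a) (hb : 0 ≤ b) :
    (Real.sqrt a - Real.sqrt b) ^ 2 ≤ 16 * (Real.sqrt ((a + b) / 2) - Real.sqrt b) ^ 2 := by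
  have hc2 := Real.sq_sqrt (by positivity : 0 ≤ (a + b) / 2)
  have ha2 := Real.sq_sqrt ha
  have hb2 := Real.sq_sqrt hb
  have hc0 := Real.sqrt_nonneg ((a + b) / 2)
  have ha0 := Real.sqrt_nonneg a
  have hb0 := Real.sqrt_nonneg b
  set x := Real.sqrt a
  set y := Real.sqrt b
  set z := Real.sqrt ((a + b) / 2)
  have h1 : (x - y) * (x + y) = 2 * ((z - y) * (z + y)) := by nlinarith
  have h2 : z ≤ x + y := abs_le_of_sq_le_sq' (by nlinarith) (by positivity) |>.2
  rcases (add_nonneg ha0 hb0).eq_or_lt with h | h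
  · have hx : x = 0 := by linarith
    have hy : y = 0 := by linarith
    rw [hx, hy]
    nlinarith [sq_nonneg (z - 0)]
  · have h3 : |x - y| ≤ 4 * |z - y| := by
      refine le_of_mul_le_mul_right ?_ h
      calc |x - y| * (x + y) = |(x - y) * (x + y)| := by rw [abs_mul, abs_of_pos h]
        _ = 2 * (|z - y| * (z + y)) := by
          rw [h1, abs_mul, abs_mul, abs_of_nonneg (add_nonneg hc0 hb0), abs_two]
        _ ≤ 2 * (|z - y| * (2 * (x + y))) := by gcongr; linarith
        _ = 4 * |z - y| * (x + y) := by ring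
    have h4 := sq_le_sq.2 (show |x - y| ≤ |4 * (z - y)| by
      rwa [abs_mul, abs_of_pos (by norm_num : (0 : ℝ) < 4)])
    linarith [mul_pow 4 (z - y) 2]

lemma sqrt_add_sub_sqrt_add_le {a b c : ℝ} (hb : 0 ≤ b) (hab : b ≤ a) (hc : 0 ≤ c) :
    Real.sqrt (a + c) - Real.sqrt (b + c) ≤ Real.sqrt a - Real.sqrt b := by
  have h1 : Real.sqrt b ≤ Real.sqrt a := Real.sqrt_le_sqrt hab
  have h2 : Real.sqrt b ≤ Real.sqrt (b + c) := Real.sqrt_le_sqrt (by linarith)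
  have h3 := Real.sq_sqrt hb
  have h4 := Real.sq_sqrt (by linarith : 0 ≤ a)
  have h5 := Real.sq_sqrt (by linarith : 0 ≤ b + c)
  have : Real.sqrt (a + c) ≤ Real.sqrt a - Real.sqrt b + Real.sqrt (b + c) := by
    refine Real.sqrt_le_iff.2 ⟨by linarith [Real.sqrt_nonneg (b + c)], ?_⟩
    nlinarith [mul_nonneg (sub_nonneg.2 h1) (sub_nonneg.2 h2)]
  linarith

/-- The logarithm `log ((D + e) / (2 e))`. -/
def midLog (e D : ℝ) : ℝ := Real.log ((D + e) / (2 * e))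

lemma midLog_mono {e a b : ℝ} (he : 0 ≤ e) (ha : 0 ≤ a) (hab : a ≤ b) :
    midLog e a ≤ midLog e b := by
  rcases he.eq_or_lt with rfl | he
  · simp [midLog]
  · exact Real.log_le_log (by positivity) (by gcongr)

/-- Concavity of the logarithm. It trades the log-ratio, unbounded below, for `midLog`, which is at
least `-log 2`. -/
lemma half_log_sub_le_midLog {e D : ℝ} (he : 0 ≤ e) (hD : 0 < D) (hD1 : D ≤ 1) :
    (Real.log D - Real.log e) / 2 ≤ midLog e D := by
  -- At `e = 0` division by zero and `log 0 = 0` make both `midLog` and `log e` vanish; the claim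
  -- becomes `log D ≤ 0`.
  rcases he.eq_or_lt with rfl | he
  · have := Real.log_nonpos hD.le hD1
    simp [midLog]; linarith
  · have h1 : Real.log (D / e) ≤ 2 * midLog e D := by
      rw [midLog, ← Real.log_rpow (by positivity)]
      apply Real.log_le_log (by positivity)
      rw [Real.rpow_two, div_pow, div_le_div_iff₀ he (by positivity)]
      nlinarith [mul_nonneg he.le (sq_nonneg (D - e))]
    rw [Real.log_div hD.ne' he.ne'] at h1
    linarith

lemma midLog_eq {e D : ℝ} (he : 0 < e) (hD : 0 ≤ D) :
    midLog e D = 2 * Real.log (Real.sqrt ((D + e) / 2) / Real.sqrt e) := by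
  rw [midLog, log_eq_two_log_sqrt (by positivity), ← Real.sqrt_div (by positivity)]
  congr 3
  field_simp

/-- This is `log x ≤ x - 1` on the square-root scale. The bound is a Hellinger affinity, and adding
its counterpart for `1 - e` produces squared Hellinger differences. -/
lemma mul_midLog_le {e D : ℝ} (he : 0 ≤ e) (hD : 0 ≤ D) :
    e * midLog e D ≤ 2 * (Real.sqrt ((D + e) / 2) * Real.sqrt e - e) := by
  rcases he.eq_or_lt with rfl | he
  · simp
  · have hs : 0 < Real.sqrt e := Real.sqrt_pos.2 he
    have hq : 0 < Real.sqrt ((D + e) / 2) := Real.sqrt_pos.2 (by positivity)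
    have h2 := Real.sq_sqrt he.le
    rw [midLog_eq he hD]
    have h := Real.log_le_sub_one_of_pos (div_pos hq hs)
    have h3 : e * (2 * (Real.sqrt ((D + e) / 2) / Real.sqrt e - 1)) =
        2 * (Real.sqrt ((D + e) / 2) * Real.sqrt e - e) := by
      generalize Real.sqrt ((D + e) / 2) = q at *
      generalize Real.sqrt e = s at *
      rw [← h2]; field_simp
    rw [← h3]
    gcongr

/-- If the midpoint is below `e`, inverting the ratio costs the factor `e / ((D + e) / 2) ≤ 2`.
Without the averaging with `e` this factor would be unbounded. -/
lemma mul_midLog_sq_mul_exp_le {e D : ℝ} (he : 0 ≤ e) (hD : 0 ≤ D) :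
    e * (midLog e D ^ 2 * Real.exp (1 / 2 * |midLog e D|)) ≤
      8 * (Real.sqrt D - Real.sqrt e) ^ 2 := by
  refine le_trans ?_ (mul_le_mul_of_nonneg_left sq_sqrt_mid_sub_le (by norm_num))
  rcases he.eq_or_lt with rfl | he
  · rw [zero_mul]; positivity
  have hs : 0 < Real.sqrt e := Real.sqrt_pos.2 he
  have hq : 0 < Real.sqrt ((D + e) / 2) := Real.sqrt_pos.2 (by positivity)
  have hs2 := Real.sq_sqrt he.le
  have hq2 := Real.sq_sqrt (by positivity : 0 ≤ (D + e) / 2)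
  rw [midLog_eq he hD]
  have hge : e ≤ 2 * Real.sqrt ((D + e) / 2) ^ 2 := by rw [hq2]; linarith
  generalize Real.sqrt ((D + e) / 2) = q at *
  generalize Real.sqrt e = s at *
  have hy : 0 < q / s := by positivity
  rcases le_total 1 (q / s) with h | h
  · calc _ ≤ e * (4 * (q / s - 1) ^ 2) :=
          mul_le_mul_of_nonneg_left (two_log_sq_mul_exp_le h) he.le
      _ = 4 * (q - s) ^ 2 := by rw [← hs2]; field_simp
      _ ≤ _ := by nlinarith [sq_nonneg (q - s)]
  · calc _ ≤ e * (4 * ((q / s)⁻¹ - 1) ^ 2) :=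
          mul_le_mul_of_nonneg_left (two_log_sq_mul_exp_le_of_le_one hy h) he.le
      _ = 4 * (e / q ^ 2) * (q - s) ^ 2 := by field_simp; ring
      _ ≤ 4 * 2 * (q - s) ^ 2 := by
          gcongr
          rw [div_le_iff₀ (by positivity)]
          exact hge
      _ = _ := by ring

/-- The weighted moment of `log (a / b)` for `b ≤ a`. -/
lemma log_div_sq_mul_exp_le {a b : ℝ} (hb : 0 < b) (hab : b ≤ a) :
    Real.log (a / b) ^ 2 * Real.exp (1 / 2 * |Real.log (a / b)|) ≤
      4 * (Real.sqrt (a / b) - 1) ^ 2 := by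
  rw [log_eq_two_log_sqrt (div_nonneg (hb.le.trans hab) hb.le)]
  exact two_log_sq_mul_exp_le (Real.one_le_sqrt.2 ((one_le_div hb).2 hab))

/-- The difference is `log ((a + e) / (b + e))`. The weight `e` cancels the denominator, and
increments of the square root shrink under the shift by `e`. -/
lemma mul_midLog_sub_sq_mul_exp_le {e a b : ℝ} (he : 0 ≤ e) (hb : 0 ≤ b) (hab : b ≤ a) :
    e * ((midLog e a - midLog e b) ^ 2 * Real.exp (1 / 2 * |midLog e a - midLog e b|)) ≤
      4 * (Real.sqrt b - Real.sqrt a) ^ 2 := by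
  rcases he.eq_or_lt with rfl | he
  · rw [zero_mul]; positivity
  have ha : 0 ≤ a := hb.trans hab
  have h1 : midLog e a - midLog e b = Real.log ((a + e) / (b + e)) := by
    rw [midLog, midLog, ← Real.log_div (by positivity) (by positivity)]
    congr 1
    field_simp
  have h2 : e * (Real.sqrt ((a + e) / (b + e)) - 1) ^ 2 ≤
      (Real.sqrt (a + e) - Real.sqrt (b + e)) ^ 2 := by
    have hs : 0 < Real.sqrt (b + e) := Real.sqrt_pos.2 (by positivity)
    have hs2 := Real.sq_sqrt (by positivity : 0 ≤ b + e)
    rw [Real.sqrt_div (by linarith)]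
    have h3 : e ≤ Real.sqrt (b + e) ^ 2 := by rw [hs2]; linarith
    calc e * _ ≤ Real.sqrt (b + e) ^ 2 * (Real.sqrt (a + e) / Real.sqrt (b + e) - 1) ^ 2 := by
          gcongr
      _ = _ := by field_simp
  have h4 : (Real.sqrt (a + e) - Real.sqrt (b + e)) ^ 2 ≤ (Real.sqrt a - Real.sqrt b) ^ 2 :=
    pow_le_pow_left₀ (sub_nonneg.2 (Real.sqrt_le_sqrt (by linarith)))
      (sqrt_add_sub_sqrt_add_le hb hab he.le) 2
  rw [h1]
  calc _ ≤ e * (4 * (Real.sqrt ((a + e) / (b + e)) - 1) ^ 2) :=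
        mul_le_mul_of_nonneg_left (log_div_sq_mul_exp_le (by positivity) (by linarith)) he.le
    _ ≤ 4 * (Real.sqrt a - Real.sqrt b) ^ 2 := by linarith
    _ = _ := by ring

/-- The pointwise inequality behind the quadratic decrease of the expected cross-entropy. -/
lemma mul_midLog_add_mul_midLog_le {e D : ℝ} (he : 0 ≤ e) (he1 : e ≤ 1) (hD : 0 ≤ D)
    (hD1 : D ≤ 1) :
    e * midLog e D + (1 - e) * midLog (1 - e) (1 - D) ≤
      -(1 / 16) * ((Real.sqrt D - Real.sqrt e) ^ 2 +
        (Real.sqrt (1 - D) - Real.sqrt (1 - e)) ^ 2) := by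
  -- Because `e + (1 - e) = 1`, and likewise for the midpoint, the two affinity bounds add up to
  -- minus the squared Hellinger differences between midpoint and `e`. Passing from the midpoint to
  -- `D` gives the constant `1 / 16`.
  have h1 := mul_midLog_le he hD
  have h2 := mul_midLog_le (sub_nonneg.2 he1) (sub_nonneg.2 hD1)
  have h3 := sq_sqrt_sub_le_sixteen_mul hD he
  have h4 := sq_sqrt_sub_le_sixteen_mul (sub_nonneg.2 hD1) (sub_nonneg.2 he1)
  have h5 := Real.sq_sqrt he
  have h6 := Real.sq_sqrt (sub_nonneg.2 he1)
  have h7 := Real.sq_sqrt (by positivity : 0 ≤ (D + e) / 2)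
  have h8 := Real.sq_sqrt (by linarith : 0 ≤ (1 - D + (1 - e)) / 2)
  nlinarith

/-! ### The laws as densities with respect to their sum -/

namespace GenerativeModel

variable {Θ 𝒳 𝒵 : Type*} [MeasurableSpace 𝒳] [MeasurableSpace 𝒵] (G : GenerativeModel Θ 𝒳 𝒵)
  (θ₀ θ : Θ)

instance isProbabilityMeasure_law : IsProbabilityMeasure (G.law θ) :=
  ⟨by rw [law, withDensity_apply _ MeasurableSet.univ, Measure.restrict_univ,
    G.lintegral_density]⟩

lemma measurable_oracle : Measurable (G.oracle θ₀ θ) := by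
  have h1 := G.measurable_density θ₀
  have h2 := G.measurable_density θ
  unfold oracle
  fun_prop

lemma oracle_nonneg (x : 𝒳) : 0 ≤ G.oracle θ₀ θ x := by unfold oracle; positivity

lemma oracle_le_one (x : 𝒳) : G.oracle θ₀ θ x ≤ 1 :=
  div_le_one_of_le₀ (le_add_of_nonneg_right (by positivity)) (by positivity)

lemma law_add_law : G.law θ₀ + G.law θ =
    G.μ.withDensity (fun x => (G.density θ₀ x : ℝ≥0∞) + (G.density θ x : ℝ≥0∞)) :=
  (withDensity_add_left (by have := G.measurable_density θ₀; fun_prop) _).symm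

/-- The oracle is the density of `P_{θ₀}` with respect to `P_{θ₀} + P_θ`, the measure that defines
`d_θ`; pointwise inequalities weighted by `e` thus become moment bounds under `P_{θ₀}`. -/
lemma law_eq_withDensity : G.law θ₀ =
    (G.law θ₀ + G.law θ).withDensity (fun x => ENNReal.ofReal (G.oracle θ₀ θ x)) := by
  have h1 := G.measurable_density θ₀
  have h2 := G.measurable_density θ
  rw [law_add_law, ← withDensity_mul _ (by fun_prop)
    (G.measurable_oracle θ₀ θ).ennreal_ofReal, law]
  congr 1
  funext x
  have h3 : (G.density θ₀ x : ℝ≥0∞) + G.density θ x =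
      ENNReal.ofReal ((G.density θ₀ x : ℝ) + G.density θ x) := by
    rw [ENNReal.ofReal_add (by positivity) (by positivity)]; simp
  rw [Pi.mul_apply, h3, ← ENNReal.ofReal_mul (by positivity), oracle]
  rcases (by positivity : (0 : ℝ) ≤ (G.density θ₀ x : ℝ) + G.density θ x).eq_or_lt with h | h
  -- Both densities vanish here, so the value `0 / 0 = 0` of the oracle carries no mass.
  · have h4 : (G.density θ₀ x : ℝ) = 0 := by
      linarith [(G.density θ₀ x).coe_nonneg, (G.density θ x).coe_nonneg]
    rw [← h, zero_mul, ENNReal.ofReal_zero]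
    exact_mod_cast h4
  · rw [mul_div_cancel₀ _ h.ne']; simp

lemma law_eq_withDensity_one_sub : G.law θ =
    (G.law θ₀ + G.law θ).withDensity (fun x => ENNReal.ofReal (1 - G.oracle θ₀ θ x)) := by
  have h1 := G.measurable_density θ₀
  have h2 := G.measurable_density θ
  have h0 := G.measurable_oracle θ₀ θ
  rw [law_add_law, ← withDensity_mul _ (by fun_prop)
    (h0.const_sub 1).ennreal_ofReal, law]
  congr 1
  funext x
  have h3 : (G.density θ₀ x : ℝ≥0∞) + G.density θ x =
      ENNReal.ofReal ((G.density θ₀ x : ℝ) + G.density θ x) := by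
    rw [ENNReal.ofReal_add (by positivity) (by positivity)]; simp
  rw [Pi.mul_apply, h3, ← ENNReal.ofReal_mul (by positivity), oracle]
  rcases (by positivity : (0 : ℝ) ≤ (G.density θ₀ x : ℝ) + G.density θ x).eq_or_lt with h | h
  · have h4 : (G.density θ x : ℝ) = 0 := by
      linarith [(G.density θ₀ x).coe_nonneg, (G.density θ x).coe_nonneg]
    rw [← h, zero_mul, ENNReal.ofReal_zero]
    exact_mod_cast h4
  · rw [mul_sub, mul_div_cancel₀ _ h.ne']; simp

/-! ### The distance -/

variable {G θ₀ θ}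

lemma integrable_sq_sqrt_sub {f g : 𝒳 → ℝ} (hf : Measurable f) (hg : Measurable g)
    (hf1 : ∀ x, f x ≤ 1) (hg1 : ∀ x, g x ≤ 1) :
    Integrable (fun x => (Real.sqrt (f x) - Real.sqrt (g x)) ^ 2) (G.law θ₀ + G.law θ) := by
  refine (integrable_const (1 : ℝ)).mono' (by fun_prop) (Eventually.of_forall fun x => ?_)
  rw [Real.norm_of_nonneg (sq_nonneg _)]
  have h1 : Real.sqrt (f x) ≤ 1 := Real.sqrt_le_one.2 (hf1 x)
  have h2 : Real.sqrt (g x) ≤ 1 := Real.sqrt_le_one.2 (hg1 x)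
  have h3 := Real.sqrt_nonneg (f x)
  have h4 := Real.sqrt_nonneg (g x)
  nlinarith

lemma dist_sq (f g : 𝒳 → ℝ) : G.dist θ₀ θ f g ^ 2 =
    ∫ x, (Real.sqrt (f x) - Real.sqrt (g x)) ^ 2 ∂(G.law θ₀ + G.law θ) +
    ∫ x, (Real.sqrt (1 - f x) - Real.sqrt (1 - g x)) ^ 2 ∂(G.law θ₀ + G.law θ) := by
  rw [dist, Real.sq_sqrt (by positivity), hell, hell, Real.sq_sqrt, Real.sq_sqrt]
  · exact integral_nonneg fun x => sq_nonneg _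
  · exact integral_nonneg fun x => sq_nonneg _

lemma dist_nonneg (f g : 𝒳 → ℝ) : 0 ≤ G.dist θ₀ θ f g := Real.sqrt_nonneg _

lemma dist_comm (f g : 𝒳 → ℝ) : G.dist θ₀ θ f g = G.dist θ₀ θ g f := by
  have h : ∀ a b : ℝ, (a - b) ^ 2 = (b - a) ^ 2 := fun a b => by ring
  unfold dist hell
  simp only [fun x => h (Real.sqrt (f x)) (Real.sqrt (g x)),
    fun x => h (Real.sqrt (1 - f x)) (Real.sqrt (1 - g x))]

lemma lintegral_le_dist_sq {f g : 𝒳 → ℝ} (hf : Measurable f) (hg : Measurable g)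
    (hf1 : ∀ x, f x ≤ 1) (hg1 : ∀ x, g x ≤ 1) :
    ∫⁻ x, ENNReal.ofReal ((Real.sqrt (f x) - Real.sqrt (g x)) ^ 2) ∂(G.law θ₀ + G.law θ) ≤
      ENNReal.ofReal (G.dist θ₀ θ f g ^ 2) := by
  rw [← ofReal_integral_eq_lintegral_ofReal (integrable_sq_sqrt_sub hf hg hf1 hg1)
    (Eventually.of_forall fun x => sq_nonneg _), dist_sq]
  exact ENNReal.ofReal_le_ofReal (le_add_of_nonneg_right (integral_nonneg fun x => sq_nonneg _))

lemma lintegral_one_sub_le_dist_sq {f g : 𝒳 → ℝ} (hf : Measurable f) (hg : Measurable g)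
    (hf0 : ∀ x, 0 ≤ f x) (hg0 : ∀ x, 0 ≤ g x) :
    ∫⁻ x, ENNReal.ofReal ((Real.sqrt (1 - f x) - Real.sqrt (1 - g x)) ^ 2)
      ∂(G.law θ₀ + G.law θ) ≤ ENNReal.ofReal (G.dist θ₀ θ f g ^ 2) := by
  rw [← ofReal_integral_eq_lintegral_ofReal (integrable_sq_sqrt_sub (hf.const_sub 1)
    (hg.const_sub 1) (fun x => by linarith [hf0 x]) (fun x => by linarith [hg0 x]))
    (Eventually.of_forall fun x => sq_nonneg _), dist_sq]
  exact ENNReal.ofReal_le_ofReal (le_add_of_nonneg_left (integral_nonneg fun x => sq_nonneg _))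

/-- The measure has mass 2 and each squared difference is at most 1, so `d² ≤ 4`. Hence a quadratic
bound in `d` can be weakened to a linear one. -/
lemma dist_le_two {f g : 𝒳 → ℝ} (hf : Measurable f) (hg : Measurable g)
    (hf1 : ∀ x, 0 ≤ f x ∧ f x ≤ 1) (hg1 : ∀ x, 0 ≤ g x ∧ g x ≤ 1) : G.dist θ₀ θ f g ≤ 2 := by
  have key : ∀ a b : ℝ, a ≤ 1 → b ≤ 1 → (Real.sqrt a - Real.sqrt b) ^ 2 ≤ 1 := by
    intro a b ha hb
    have h1 : Real.sqrt a ≤ 1 := Real.sqrt_le_one.2 ha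
    have h2 : Real.sqrt b ≤ 1 := Real.sqrt_le_one.2 hb
    nlinarith [Real.sqrt_nonneg a, Real.sqrt_nonneg b]
  have hone : ∫ _, (1 : ℝ) ∂(G.law θ₀ + G.law θ) = 2 := by
    rw [integral_const, measureReal_add_apply]
    norm_num
  have h1 := integral_mono (μ := G.law θ₀ + G.law θ)
    (integrable_sq_sqrt_sub hf hg (fun x => (hf1 x).2) fun x => (hg1 x).2)
    (integrable_const (1 : ℝ)) fun x => key _ _ (hf1 x).2 (hg1 x).2
  have h2 := integral_mono (μ := G.law θ₀ + G.law θ)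
    (integrable_sq_sqrt_sub (hf.const_sub 1) (hg.const_sub 1) (fun x => by linarith [(hf1 x).1])
      fun x => by linarith [(hg1 x).1])
    (integrable_const (1 : ℝ)) fun x => key _ _ (by linarith [(hf1 x).1]) (by linarith [(hg1 x).1])
  rw [hone] at h1 h2
  have h3 := dist_sq (G := G) (θ₀ := θ₀) (θ := θ) f g
  nlinarith [dist_nonneg (G := G) (θ₀ := θ₀) (θ := θ) f g]

end GenerativeModel

/-- A pointwise bound turns into a bound of moments under a change of measure. -/
lemma lintegral_withDensity_le {𝒳 : Type*} [MeasurableSpace 𝒳] {ν P : Measure 𝒳} {e : 𝒳 → ℝ}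
    (he : Measurable e) (he0 : ∀ x, 0 ≤ e x)
    (hP : P = ν.withDensity fun x => ENNReal.ofReal (e x)) {g k : 𝒳 → ℝ} (hg : Measurable g)
    {C : ℝ} (hC : 0 ≤ C) (h : ∀ x, e x * g x ≤ C * k x) :
    ∫⁻ x, ENNReal.ofReal (g x) ∂P ≤ ENNReal.ofReal C * ∫⁻ x, ENNReal.ofReal (k x) ∂ν := by
  rw [hP, lintegral_withDensity_eq_lintegral_mul _ he.ennreal_ofReal hg.ennreal_ofReal,
    ← lintegral_const_mul' _ _ ENNReal.ofReal_ne_top]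
  refine lintegral_mono fun x => ?_
  rw [Pi.mul_apply, ← ENNReal.ofReal_mul (he0 x), ← ENNReal.ofReal_mul hC]
  exact ENNReal.ofReal_le_ofReal (h x)

section RateOfConvergence

variable {Ω 𝒳 : Type*} [MeasurableSpace Ω] [MeasurableSpace 𝒳]

/-! ### The rate of convergence of the classifier -/

/-- The maximal inequality for brackets of size proportional to the distance. -/
theorem IsIIDSample.supMeanLE_bracketing_linear {Pr : Measure Ω}
    [IsProbabilityMeasure Pr] {P : Measure 𝒳} [IsProbabilityMeasure P] {X : ℕ → Ω → 𝒳}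
    (hX : IsIIDSample Pr P X) {n : ℕ} (hn : 0 < n) {𝓑 : Set ((𝒳 → ℝ) × (𝒳 → ℝ))}
    {F : Set (𝒳 → ℝ)} {d : (𝒳 → ℝ) → (𝒳 → ℝ) → ℝ} (hd : ∀ f g, 0 ≤ d f g) {r Φ : ℝ}
    (hr : 0 < r) (hΦ : 0 < Φ) (hJ : bracketingIntegral 𝓑 r F d ≤ ENNReal.ofReal Φ)
    {τ : (𝒳 → ℝ) × (𝒳 → ℝ) → (𝒳 → ℝ) × (𝒳 → ℝ)} {f : (𝒳 → ℝ) → 𝒳 → ℝ}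
    (hτm : ∀ b ∈ 𝓑, Measurable (τ b).1 ∧ Measurable (τ b).2)
    (hfm : ∀ D ∈ F, Measurable (f D))
    (hf : ∀ b ∈ 𝓑, ∀ᵐ x ∂P, ∀ D ∈ F, b.1 x ≤ D x → D x ≤ b.2 x →
      (τ b).1 x ≤ f D x ∧ f D x ≤ (τ b).2 x)
    (hbr : ∀ b ∈ 𝓑, bernMoment P (fun x => (τ b).2 x - (τ b).1 x) ≤
      ENNReal.ofReal (4 * d b.1 b.2 ^ 2))
    (hs : ∀ D ∈ F, bernMoment P (f D) ≤ ENNReal.ofReal (8 * r ^ 2))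
    {A : ℝ} (hA : 1 ≤ A) (hΦA : Φ ≤ A * (r ^ 2 * Real.sqrt n)) :
    SupMeanLE Pr (fun (D : F) ω => centeredSum P n (fun k => X k ω) (f D))
      (729 * A * (Real.sqrt n * Φ)) := by
  have hsn : 0 < Real.sqrt n := Real.sqrt_pos.2 (by exact_mod_cast hn)
  have hsn2 : Real.sqrt n ^ 2 = n := Real.sq_sqrt (by positivity)
  have hA0 : 0 < A := by linarith
  -- This order of `c` puts the entropy term and the variance term of the first level both at `√n
  -- Φ`; `hΦA` ensures `c ≤ 1 / 4`.
  set c : ℝ := Φ / (4 * A * (r ^ 2 * Real.sqrt n)) with hc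
  have hc0 : 0 < c := by positivity
  have hc4 : c ≤ 1 / 4 := by
    rw [hc, div_le_iff₀ (by positivity)]
    linarith
  -- For `ρ = 1 / 2` a longer chain costs nothing, so `Q` is taken large enough to bring the
  -- remainder below `√n Φ`. The constant is `64 + 24 + 640 + 1 = 729`.
  obtain ⟨Q, hQ⟩ := exists_pow_lt_of_lt_one
    (show 0 < Real.sqrt n * Φ / (2 * n * (2 * r)) by positivity) (by norm_num : (1 / 2 : ℝ) < 1)
  have hQ' : 2 * n * (2 * r * (1 / 2) ^ Q) ≤ Real.sqrt n * Φ := by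
    rw [lt_div_iff₀ (by positivity)] at hQ
    linarith
  have hs8 : (Real.sqrt 8 * r) ^ 2 = 8 * r ^ 2 := by
    rw [mul_pow, Real.sq_sqrt (by norm_num)]
  refine (hX.supMeanLE_bracketing hn hr hΦ.le hJ hτm hfm hf (σ := 2 * r) (ρ := 1 / 2)
    (by positivity) le_rfl (by norm_num) (fun q b hb hq => (hbr b hb).trans ?_)
    (s := Real.sqrt 8 * r) (fun D hD => by rw [hs8]; exact hs D hD) hc0 hc4 Q).mono ?_
  · apply ENNReal.ofReal_le_ofReal
    have h1 := pow_le_pow_left₀ (hd b.1 b.2) hq.le 2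
    calc 4 * d b.1 b.2 ^ 2 ≤ 4 * ((1 / 2) ^ q * r) ^ 2 := by linarith
      _ = _ := by ring
  · rw [hs8]
    have h1 : 2 * c⁻¹ * (2 * (2 * Φ / r) ^ 2 + n * (c ^ 2 * (4 * (8 * r ^ 2 + (2 * r) ^ 2)))) =
        64 * A * (Real.sqrt n * Φ) + 24 * (Real.sqrt n * Φ) / A := by
      rw [hc]
      generalize Real.sqrt (n : ℝ) = y at *
      rw [← hsn2]
      field_simp
      ring
    have h2 : 160 * (Real.sqrt n * (2 * r) * ((2 * (1 / 2)) ^ Q * (2 * Φ / r))) =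
        640 * (Real.sqrt n * Φ) := by
      rw [show (2 * (1 / 2) : ℝ) = 1 by norm_num, one_pow]
      field_simp
      ring
    have h3 : 24 * (Real.sqrt n * Φ) / A ≤ 24 * (Real.sqrt n * Φ) :=
      div_le_self (by positivity) hA
    have h4 : Real.sqrt n * Φ ≤ A * (Real.sqrt n * Φ) :=
      le_mul_of_one_le_left (by positivity) hA
    linarith

namespace GenerativeModel

variable {Θ 𝒵 : Type*} [MeasurableSpace 𝒵] {G : GenerativeModel Θ 𝒳 𝒵} {θ₀ θ : Θ}

lemma measurable_midLog {e D : 𝒳 → ℝ} (he : Measurable e) (hD : Measurable D) :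
    Measurable fun x => midLog (e x) (D x) := by
  unfold midLog; fun_prop

lemma bernMoment_midLog_le {D : 𝒳 → ℝ} (hD : Measurable D) (hD1 : ∀ x, 0 ≤ D x ∧ D x ≤ 1) :
    bernMoment (G.law θ₀) (fun x => midLog (G.oracle θ₀ θ x) (D x)) ≤
      ENNReal.ofReal (8 * G.dist θ₀ θ D (G.oracle θ₀ θ) ^ 2) := by
  have hm := measurable_midLog (G.measurable_oracle θ₀ θ) hD
  rw [ENNReal.ofReal_mul (by norm_num)]
  refine (lintegral_withDensity_le (G.measurable_oracle θ₀ θ) (G.oracle_nonneg θ₀ θ)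
    (G.law_eq_withDensity θ₀ θ) (by fun_prop) (by norm_num) fun x =>
      mul_midLog_sq_mul_exp_le (G.oracle_nonneg θ₀ θ x) (hD1 x).1).trans ?_
  gcongr
  exact lintegral_le_dist_sq hD (G.measurable_oracle θ₀ θ) (fun x => (hD1 x).2)
    (G.oracle_le_one θ₀ θ)

lemma bernMoment_midLog_one_sub_le {D : 𝒳 → ℝ} (hD : Measurable D)
    (hD1 : ∀ x, 0 ≤ D x ∧ D x ≤ 1) :
    bernMoment (G.law θ) (fun x => midLog (1 - G.oracle θ₀ θ x) (1 - D x)) ≤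
      ENNReal.ofReal (8 * G.dist θ₀ θ D (G.oracle θ₀ θ) ^ 2) := by
  have he := (G.measurable_oracle θ₀ θ).const_sub 1
  have hm := measurable_midLog he (hD.const_sub 1)
  rw [ENNReal.ofReal_mul (by norm_num)]
  refine (lintegral_withDensity_le he (fun x => sub_nonneg.2 (G.oracle_le_one θ₀ θ x))
    (G.law_eq_withDensity_one_sub θ₀ θ) (by fun_prop) (by norm_num) fun x =>
      mul_midLog_sq_mul_exp_le (sub_nonneg.2 (G.oracle_le_one θ₀ θ x))
        (sub_nonneg.2 (hD1 x).2)).trans ?_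
  gcongr
  exact lintegral_one_sub_le_dist_sq hD (G.measurable_oracle θ₀ θ) (fun x => (hD1 x).1)
    (G.oracle_nonneg θ₀ θ)

lemma bernMoment_midLog_bracket_le {b : (𝒳 → ℝ) × (𝒳 → ℝ)} (hb : IsBracket b) :
    bernMoment (G.law θ₀) (fun x => midLog (G.oracle θ₀ θ x) (b.2 x) -
      midLog (G.oracle θ₀ θ x) (b.1 x)) ≤ ENNReal.ofReal (4 * G.dist θ₀ θ b.1 b.2 ^ 2) := by
  obtain ⟨h1, h2, h3⟩ := hb
  have he := G.measurable_oracle θ₀ θ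
  have hm1 := measurable_midLog he h1
  have hm2 := measurable_midLog he h2
  rw [ENNReal.ofReal_mul (by norm_num)]
  refine (lintegral_withDensity_le he (G.oracle_nonneg θ₀ θ)
    (G.law_eq_withDensity θ₀ θ) (by fun_prop) (by norm_num) fun x =>
      mul_midLog_sub_sq_mul_exp_le (G.oracle_nonneg θ₀ θ x) (h3 x).1 (h3 x).2.1).trans ?_
  gcongr
  exact lintegral_le_dist_sq h1 h2 (fun x => (h3 x).2.1.trans (h3 x).2.2) (fun x => (h3 x).2.2)

lemma bernMoment_midLog_bracket_one_sub_le {b : (𝒳 → ℝ) × (𝒳 → ℝ)} (hb : IsBracket b) :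
    bernMoment (G.law θ) (fun x => midLog (1 - G.oracle θ₀ θ x) (1 - b.1 x) -
      midLog (1 - G.oracle θ₀ θ x) (1 - b.2 x)) ≤
        ENNReal.ofReal (4 * G.dist θ₀ θ b.1 b.2 ^ 2) := by
  obtain ⟨h1, h2, h3⟩ := hb
  have he := (G.measurable_oracle θ₀ θ).const_sub 1
  have hm1 := measurable_midLog he (h1.const_sub 1)
  have hm2 := measurable_midLog he (h2.const_sub 1)
  rw [ENNReal.ofReal_mul (by norm_num), dist_comm]
  refine (lintegral_withDensity_le he (fun x => sub_nonneg.2 (G.oracle_le_one θ₀ θ x))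
    (G.law_eq_withDensity_one_sub θ₀ θ) (by fun_prop) (by norm_num) fun x =>
      mul_midLog_sub_sq_mul_exp_le (sub_nonneg.2 (G.oracle_le_one θ₀ θ x))
        (sub_nonneg.2 (h3 x).2.2) (by linarith [(h3 x).2.1])).trans ?_
  gcongr
  exact lintegral_one_sub_le_dist_sq h2 h1 (fun x => (h3 x).1.trans (h3 x).2.1)
    (fun x => (h3 x).1)

section Maximal

variable {Pr : Measure Ω} [IsProbabilityMeasure Pr] {n : ℕ} {𝓑 : Set ((𝒳 → ℝ) × (𝒳 → ℝ))}
  {F : Set (𝒳 → ℝ)} {r Φ A : ℝ}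

lemma supMeanLE_midLog {X : ℕ → Ω → 𝒳} (hX : IsIIDSample Pr (G.law θ₀) X) (hn : 0 < n)
    (h𝓑 : ∀ b ∈ 𝓑, IsBracket b)
    (hF : ∀ D ∈ F, Measurable D ∧ (∀ x, 0 < D x ∧ D x < 1) ∧
      G.dist θ₀ θ D (G.oracle θ₀ θ) ≤ r)
    (hr : 0 < r) (hΦ : 0 < Φ)
    (hJ : bracketingIntegral 𝓑 r F (G.dist θ₀ θ) ≤ ENNReal.ofReal Φ)
    (hA : 1 ≤ A) (hΦA : Φ ≤ A * (r ^ 2 * Real.sqrt n)) :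
    SupMeanLE Pr (fun (D : F) ω => centeredSum (G.law θ₀) n (fun k => X k ω)
      fun x => midLog (G.oracle θ₀ θ x) (D.1 x)) (729 * A * (Real.sqrt n * Φ)) := by
  have he := G.measurable_oracle θ₀ θ
  refine hX.supMeanLE_bracketing_linear (f := fun D x => midLog (G.oracle θ₀ θ x) (D x))
    (τ := fun b => (fun x => midLog (G.oracle θ₀ θ x) (b.1 x),
      fun x => midLog (G.oracle θ₀ θ x) (b.2 x))) hn dist_nonneg hr hΦ hJ
    (fun b hb => ⟨measurable_midLog he (h𝓑 b hb).1, measurable_midLog he (h𝓑 b hb).2.1⟩)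
    (fun D hD => measurable_midLog he (hF D hD).1)
    (fun b hb => Eventually.of_forall fun x D hD h1 h2 => ?_)
    (fun b hb => bernMoment_midLog_bracket_le (h𝓑 b hb)) (fun D hD => ?_) hA hΦA
  · have h0 := ((h𝓑 b hb).2.2 x).1
    exact ⟨midLog_mono (G.oracle_nonneg θ₀ θ x) h0 h1,
      midLog_mono (G.oracle_nonneg θ₀ θ x) (h0.trans h1) h2⟩
  · obtain ⟨h1, h2, h3⟩ := hF D hD
    refine (bernMoment_midLog_le h1 fun x => ⟨(h2 x).1.le, (h2 x).2.le⟩).trans ?_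
    apply ENNReal.ofReal_le_ofReal
    have := pow_le_pow_left₀ (dist_nonneg (G := G) (θ₀ := θ₀) (θ := θ) D (G.oracle θ₀ θ)) h3 2
    linarith

/-- The map `D ↦ 1 - D` reverses order, so the transformed bracket has its ends exchanged. It is
applied to the fake sample, with its own sample size. -/
lemma supMeanLE_midLog_one_sub {X : ℕ → Ω → 𝒳} (hX : IsIIDSample Pr (G.law θ) X) (hn : 0 < n)
    (h𝓑 : ∀ b ∈ 𝓑, IsBracket b)
    (hF : ∀ D ∈ F, Measurable D ∧ (∀ x, 0 < D x ∧ D x < 1) ∧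
      G.dist θ₀ θ D (G.oracle θ₀ θ) ≤ r)
    (hr : 0 < r) (hΦ : 0 < Φ)
    (hJ : bracketingIntegral 𝓑 r F (G.dist θ₀ θ) ≤ ENNReal.ofReal Φ)
    (hA : 1 ≤ A) (hΦA : Φ ≤ A * (r ^ 2 * Real.sqrt n)) :
    SupMeanLE Pr (fun (D : F) ω => centeredSum (G.law θ) n (fun k => X k ω)
      fun x => midLog (1 - G.oracle θ₀ θ x) (1 - D.1 x)) (729 * A * (Real.sqrt n * Φ)) := by
  have he := (G.measurable_oracle θ₀ θ).const_sub 1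
  refine hX.supMeanLE_bracketing_linear
    (f := fun D x => midLog (1 - G.oracle θ₀ θ x) (1 - D x))
    (τ := fun b => (fun x => midLog (1 - G.oracle θ₀ θ x) (1 - b.2 x),
      fun x => midLog (1 - G.oracle θ₀ θ x) (1 - b.1 x))) hn dist_nonneg hr hΦ hJ
    (fun b hb => ⟨measurable_midLog he ((h𝓑 b hb).2.1.const_sub 1),
      measurable_midLog he ((h𝓑 b hb).1.const_sub 1)⟩)
    (fun D hD => measurable_midLog he ((hF D hD).1.const_sub 1))
    (fun b hb => Eventually.of_forall fun x D hD h1 h2 => ?_)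
    (fun b hb => bernMoment_midLog_bracket_one_sub_le (h𝓑 b hb)) (fun D hD => ?_) hA hΦA
  · have h0 := ((h𝓑 b hb).2.2 x).2.2
    have h3 := sub_nonneg.2 (G.oracle_le_one θ₀ θ x)
    exact ⟨midLog_mono h3 (by linarith) (by linarith), midLog_mono h3 (by linarith) (by linarith)⟩
  · obtain ⟨h1, h2, h3⟩ := hF D hD
    refine (bernMoment_midLog_one_sub_le h1 fun x => ⟨(h2 x).1.le, (h2 x).2.le⟩).trans ?_
    apply ENNReal.ofReal_le_ofReal
    have := pow_le_pow_left₀ (dist_nonneg (G := G) (θ₀ := θ₀) (θ := θ) D (G.oracle θ₀ θ)) h3 2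
    linarith

end Maximal

/-- The expected cross-entropy decreases quadratically away from the oracle. -/
lemma integral_midLog_add_le {D : 𝒳 → ℝ} (hD : Measurable D) (hD1 : ∀ x, 0 ≤ D x ∧ D x ≤ 1) :
    ∫ x, midLog (G.oracle θ₀ θ x) (D x) ∂(G.law θ₀) +
      ∫ x, midLog (1 - G.oracle θ₀ θ x) (1 - D x) ∂(G.law θ) ≤
      -(1 / 16) * G.dist θ₀ θ D (G.oracle θ₀ θ) ^ 2 := by
  set e := G.oracle θ₀ θ with hedef
  have he : Measurable e := G.measurable_oracle θ₀ θ
  have he0 : ∀ x, 0 ≤ e x := G.oracle_nonneg θ₀ θ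
  have he1 : ∀ x, e x ≤ 1 := G.oracle_le_one θ₀ θ
  have key : ∀ (P : Measure 𝒳) (k : 𝒳 → ℝ), Measurable k → (∀ x, 0 ≤ k x) →
      P = (G.law θ₀ + G.law θ).withDensity (fun x => ENNReal.ofReal (k x)) →
      ∀ g : 𝒳 → ℝ, Integrable g P →
      Integrable (fun x => k x * g x) (G.law θ₀ + G.law θ) ∧
        ∫ x, g x ∂P = ∫ x, k x * g x ∂(G.law θ₀ + G.law θ) := by
    intro P k hk hk0 hP g hg
    have hlt : ∀ᵐ x ∂(G.law θ₀ + G.law θ), ENNReal.ofReal (k x) < ⊤ :=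
      Eventually.of_forall fun x => ENNReal.ofReal_lt_top
    constructor
    · rw [hP, integrable_withDensity_iff_integrable_smul' hk.ennreal_ofReal hlt] at hg
      simpa [ENNReal.toReal_ofReal (hk0 _)] using hg
    · rw [hP, integral_withDensity_eq_integral_toReal_smul hk.ennreal_ofReal hlt]
      simp [ENNReal.toReal_ofReal (hk0 _)]
  have hf : Integrable (fun x => midLog (e x) (D x)) (G.law θ₀) :=
    integrable_of_sq (measurable_midLog he hD)
      (sq_moment_le (by norm_num) (bernMoment_midLog_le hD hD1))
  have hg : Integrable (fun x => midLog (1 - e x) (1 - D x)) (G.law θ) :=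
    integrable_of_sq (measurable_midLog (he.const_sub 1) (hD.const_sub 1))
      (sq_moment_le (by norm_num) (bernMoment_midLog_one_sub_le hD hD1))
  obtain ⟨hf1, hf2⟩ := key _ e he he0 (G.law_eq_withDensity θ₀ θ) _ hf
  obtain ⟨hg1, hg2⟩ := key _ (fun x => 1 - e x) (he.const_sub 1) (fun x => sub_nonneg.2 (he1 x))
    (G.law_eq_withDensity_one_sub θ₀ θ) _ hg
  have hi1 := integrable_sq_sqrt_sub (G := G) (θ₀ := θ₀) (θ := θ) hD he (fun x => (hD1 x).2) he1
  have hi2 := integrable_sq_sqrt_sub (G := G) (θ₀ := θ₀) (θ := θ) (hD.const_sub 1)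
    (he.const_sub 1) (fun x => by linarith [(hD1 x).1]) (fun x => by linarith [he0 x])
  rw [hf2, hg2, ← integral_add hf1 hg1, dist_sq, ← integral_add hi1 hi2, ← integral_const_mul]
  exact integral_mono (hf1.add hg1) ((hi1.add hi2).const_mul _) fun x =>
    mul_midLog_add_mul_midLog_le (he0 x) (he1 x) (hD1 x).1 (hD1 x).2

lemma empMean_eq_centeredSum {n : ℕ} (hn : 0 < n) (P : Measure 𝒳) (Y : ℕ → 𝒳) (g : 𝒳 → ℝ) :
    empMean n Y g = centeredSum P n Y g / n + ∫ x, g x ∂P := by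
  have : (n : ℝ) ≠ 0 := by positivity
  rw [empMean, centeredSum_eq]
  field_simp
  ring

/-- The distance of a near-maximizer of the cross-entropy to the oracle is controlled by centered
sums. -/
lemma dist_sq_le_of_crossEntropy {n m : ℕ} (hn : 0 < n) (hm : 0 < m) {Y : ℕ → 𝒳} {Z : ℕ → 𝒵}
    {D : 𝒳 → ℝ} (hD : Measurable D) (hD1 : ∀ x, 0 < D x ∧ D x < 1) {R : ℝ}
    (h : G.crossEntropy θ n m Y Z (G.oracle θ₀ θ) - R ≤ G.crossEntropy θ n m Y Z D) :
    G.dist θ₀ θ D (G.oracle θ₀ θ) ^ 2 / 16 ≤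
      |centeredSum (G.law θ₀) n Y fun x => midLog (G.oracle θ₀ θ x) (D x)| / n +
      |centeredSum (G.law θ) m (fun i => G.T θ (Z i))
        fun x => midLog (1 - G.oracle θ₀ θ x) (1 - D x)| / m + |R| / 2 := by
  set e := G.oracle θ₀ θ with hedef
  have he0 : ∀ x, 0 ≤ e x := G.oracle_nonneg θ₀ θ
  have he1 : ∀ x, e x ≤ 1 := G.oracle_le_one θ₀ θ
  have hn' : (0 : ℝ) < n := by exact_mod_cast hn
  have hm' : (0 : ℝ) < m := by exact_mod_cast hm
  have h1 : (empMean n Y (fun x => Real.log (D x)) - empMean n Y (fun x => Real.log (e x))) / 2 ≤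
      empMean n Y fun x => midLog (e x) (D x) := by
    unfold empMean
    rw [← sub_div, ← Finset.sum_sub_distrib, div_div, mul_comm, ← div_div, Finset.sum_div]
    gcongr with i
    exact half_log_sub_le_midLog (he0 _) (hD1 _).1 (hD1 _).2.le
  have h2 : (empMean m (fun i => G.T θ (Z i)) (fun x => Real.log (1 - D x)) -
      empMean m (fun i => G.T θ (Z i)) (fun x => Real.log (1 - e x))) / 2 ≤
      empMean m (fun i => G.T θ (Z i)) fun x => midLog (1 - e x) (1 - D x) := by
    unfold empMean
    rw [← sub_div, ← Finset.sum_sub_distrib, div_div, mul_comm, ← div_div, Finset.sum_div]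
    gcongr with i
    exact half_log_sub_le_midLog (sub_nonneg.2 (he1 _)) (by linarith [(hD1 (G.T θ (Z i))).2])
      (by linarith [(hD1 (G.T θ (Z i))).1])
  have h3 := integral_midLog_add_le (G := G) (θ₀ := θ₀) (θ := θ) hD
    fun x => ⟨(hD1 x).1.le, (hD1 x).2.le⟩
  rw [empMean_eq_centeredSum hn (G.law θ₀) _ fun x => midLog (e x) (D x)] at h1
  rw [empMean_eq_centeredSum hm (G.law θ) _ fun x => midLog (1 - e x) (1 - D x)] at h2
  rw [← hedef] at h3
  unfold crossEntropy at h
  have h4 : centeredSum (G.law θ₀) n Y (fun x => midLog (e x) (D x)) / n ≤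
      |centeredSum (G.law θ₀) n Y fun x => midLog (e x) (D x)| / n := by
    gcongr; exact le_abs_self _
  have h5 : centeredSum (G.law θ) m (fun i => G.T θ (Z i))
        (fun x => midLog (1 - e x) (1 - D x)) / m ≤
      |centeredSum (G.law θ) m (fun i => G.T θ (Z i))
        fun x => midLog (1 - e x) (1 - D x)| / m := by
    gcongr; exact le_abs_self _
  have h6 := le_abs_self R
  linarith

/-! ### Sampling and entropy -/

lemma IsSampling.iid_X {Pr : Measure Ω} {X : ℕ → Ω → 𝒳} {Z : ℕ → Ω → 𝒵}
    (h : G.IsSampling θ₀ Pr X Z) : IsIIDSample Pr (G.law θ₀) X :=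
  ⟨h.measurable_X, h.indep_X, h.law_X⟩

lemma IsSampling.iid_fake {Pr : Measure Ω} {X : ℕ → Ω → 𝒳} {Z : ℕ → Ω → 𝒵}
    (h : G.IsSampling θ₀ Pr X Z) (θ : Θ) :
    IsIIDSample Pr (G.law θ) (fun i ω => G.T θ (Z i ω)) where
  meas i := (G.measurable_T θ).comp (h.measurable_Z i)
  indep := h.indep_Z.comp (fun _ => G.T θ) fun _ => G.measurable_T θ
  law i := by
    rw [law, ← G.map_T θ, ← h.law_Z i, Measure.map_map (G.measurable_T θ) (h.measurable_Z i)]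
    rfl

section Rate

variable {Pr : Measure Ω} {X : ℕ → Ω → 𝒳} {Z : ℕ → Ω → 𝒵} {m : ℕ → ℕ} {𝒟 : ℕ → Set (𝒳 → ℝ)}
  {Dhat : ℕ → Ω → 𝒳 → ℝ} {δ : ℕ → ℝ} {𝓑 : Set ((𝒳 → ℝ) × (𝒳 → ℝ))}

/-- The growth of the entropy integral over dyadic multiples of the rate. -/
lemma SieveAssumption.entropy_dyadic (h : G.SieveAssumption θ₀ θ Pr X Z m 𝒟 Dhat δ 𝓑) :
    ∃ w C : ℝ, 0 < w ∧ w < 4 ∧ 1 ≤ C ∧ ∀ᶠ n : ℕ in atTop, ∀ j : ℕ,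
      bracketingIntegral 𝓑 (2 ^ j * δ n) (G.sieveBall θ₀ θ (𝒟 n) (2 ^ j * δ n)) (G.dist θ₀ θ) ≤
        ENNReal.ofReal (C * w ^ j * (δ n ^ 2 * Real.sqrt n)) := by
  obtain ⟨α, hα, C, φ, hφ⟩ := h.entropy
  -- Monotonicity of `φ(r) / r ^ α` gives `φ(2 ^ j δ) ≤ (2 ^ α) ^ j φ(δ)`; `α < 2` puts the growth
  -- factor below 4.
  refine ⟨2 ^ α, max C 1, by positivity, ?_, le_max_right _ _, ?_⟩
  · calc (2 : ℝ) ^ α < 2 ^ (2 : ℝ) := Real.rpow_lt_rpow_of_exponent_lt (by norm_num) hα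
      _ = 4 := by norm_num
  · filter_upwards [hφ] with n ⟨h1, h2, h3⟩ j
    have hδ := h.rate_pos n
    refine (h1 _ (by positivity)).trans (ENNReal.ofReal_le_ofReal ?_)
    have hle : δ n ≤ 2 ^ j * δ n := le_mul_of_one_le_left hδ.le (one_le_pow₀ (by norm_num))
    have h4 := h2 (mem_Ioi.2 hδ) (mem_Ioi.2 (hδ.trans_le hle)) hle
    simp only at h4
    rw [Real.mul_rpow (by positivity) hδ.le, div_le_div_iff₀ (by positivity) (by positivity)] at h4
    have h5 : ((2 : ℝ) ^ j) ^ α = (2 ^ α) ^ j := by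
      rw [← Real.rpow_natCast, ← Real.rpow_natCast, ← Real.rpow_mul (by norm_num),
        ← Real.rpow_mul (by norm_num), mul_comm]
    rw [h5] at h4
    have h6 : φ n (2 ^ j * δ n) ≤ φ n (δ n) * (2 ^ α) ^ j := by
      have : 0 < δ n ^ α := by positivity
      refine le_of_mul_le_mul_right ?_ this
      linarith
    calc φ n (2 ^ j * δ n) ≤ φ n (δ n) * (2 ^ α) ^ j := h6
      _ ≤ (max C 1 * (δ n ^ 2 * Real.sqrt n)) * (2 ^ α) ^ j := by
          gcongr
          exact h3.trans (by gcongr; exact le_max_left _ _)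
      _ = _ := by ring

lemma SieveAssumption.mem_sieveBall (h : G.SieveAssumption θ₀ θ Pr X Z m 𝒟 Dhat δ 𝓑) {n : ℕ}
    {r : ℝ} {D : 𝒳 → ℝ} (hD : D ∈ G.sieveBall θ₀ θ (𝒟 n) r) :
    Measurable D ∧ (∀ x, 0 < D x ∧ D x < 1) ∧ G.dist θ₀ θ D (G.oracle θ₀ θ) ≤ r :=
  ⟨(h.sieve n D hD.1).1, (h.sieve n D hD.1).2, hD.2⟩

end Rate

end GenerativeModel

end RateOfConvergence

/-! ### Peeling over dyadic shells. -/

namespace GenerativeModel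

variable {Ω 𝒳 𝒵 Θ : Type*} [MeasurableSpace Ω] [MeasurableSpace 𝒳] [MeasurableSpace 𝒵]
  {G : GenerativeModel Θ 𝒳 𝒵} {θ₀ θ : Θ}
  {Pr : Measure Ω} {X : ℕ → Ω → 𝒳} {Z : ℕ → Ω → 𝒵} {m : ℕ → ℕ} {𝒟 : ℕ → Set (𝒳 → ℝ)}
  {Dhat : ℕ → Ω → 𝒳 → ℝ} {δ : ℕ → ℝ} {𝓑 : Set ((𝒳 → ℝ) × (𝒳 → ℝ))}

/-- The entropy bound is stated on the scale `√n`; this transfers it to the fake sample of size `m`.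
-/
lemma SieveAssumption.ratio_bounded (h : G.SieveAssumption θ₀ θ Pr X Z m 𝒟 Dhat δ 𝓑) :
    ∃ κ : ℝ, 1 ≤ κ ∧ ∀ᶠ n : ℕ in atTop, Real.sqrt n ≤ κ * Real.sqrt (m n) := by
  obtain ⟨c, hc⟩ := h.ratio
  refine ⟨Real.sqrt (max (c + 1) 1), Real.one_le_sqrt.2 (le_max_right _ _), ?_⟩
  filter_upwards [hc.eventually (gt_mem_nhds (lt_add_one c))] with n hn
  have hm : (0 : ℝ) < m n := by exact_mod_cast h.m_pos n
  rw [← Real.sqrt_mul (by positivity)]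
  apply Real.sqrt_le_sqrt
  rw [div_lt_iff₀ hm] at hn
  exact hn.le.trans (by gcongr; exact le_max_left _ _)

/-- The probability that the centered sums are large over a ball of the sieve. -/
lemma SieveAssumption.shell_bound [IsProbabilityMeasure Pr] (hXZ : G.IsSampling θ₀ Pr X Z)
    (h : G.SieveAssumption θ₀ θ Pr X Z m 𝒟 Dhat δ 𝓑) :
    ∃ w K : ℝ, 0 < w ∧ w < 4 ∧ 0 < K ∧ ∀ᶠ n : ℕ in atTop, ∀ j : ℕ,
      Pr {ω | ∃ D ∈ G.sieveBall θ₀ θ (𝒟 n) (2 ^ (j + 1) * δ n),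
        4 ^ j * δ n ^ 2 / 64 ≤ |centeredSum (G.law θ₀) n (fun k => X k ω)
          fun x => midLog (G.oracle θ₀ θ x) (D x)| / n ∨
        4 ^ j * δ n ^ 2 / 64 ≤ |centeredSum (G.law θ) (m n) (fun k => G.T θ (Z k ω))
          fun x => midLog (1 - G.oracle θ₀ θ x) (1 - D x)| / m n} ≤
        ENNReal.ofReal (K * (w / 4) ^ j) := by
  obtain ⟨w, C, hw0, hw4, hC, hent⟩ := h.entropy_dyadic
  obtain ⟨κ, hκ, hratio⟩ := h.ratio_bounded
  set A := C * κ with hA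
  have hA1 : 1 ≤ A := one_le_mul_of_one_le_of_one_le hC hκ
  have hC0 : 0 < C := by linarith
  have hκ0 : 0 < κ := by linarith
  refine ⟨w, 2 * (729 * A * C * κ * 64 * w), hw0, hw4, by positivity, ?_⟩
  filter_upwards [hent, hratio, eventually_gt_atTop 0] with n hJ hκn hn j
  have hδ := h.rate_pos n
  have hm := h.m_pos n
  set r : ℝ := 2 ^ (j + 1) * δ n with hr
  set Φ : ℝ := C * w ^ (j + 1) * (δ n ^ 2 * Real.sqrt n) with hΦ
  have hsn : 0 < Real.sqrt n := Real.sqrt_pos.2 (by exact_mod_cast hn)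
  have hsm : 0 < Real.sqrt (m n) := Real.sqrt_pos.2 (by exact_mod_cast hm)
  have hsn2 : Real.sqrt n ^ 2 = n := Real.sq_sqrt (by positivity)
  have hsm2 : Real.sqrt (m n) ^ 2 = m n := Real.sq_sqrt (by positivity)
  have hΦ0 : 0 < Φ := by positivity
  have hr0 : 0 < r := by positivity
  have hr2 : r ^ 2 = 4 ^ (j + 1) * δ n ^ 2 := by
    rw [hr, mul_pow, ← pow_mul, mul_comm (j + 1) 2, pow_mul]; norm_num
  have hwj : w ^ (j + 1) ≤ 4 ^ (j + 1) := pow_le_pow_left₀ hw0.le hw4.le _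
  have hΦC : Φ ≤ C * (r ^ 2 * Real.sqrt n) := by
    rw [hΦ, hr2]
    calc C * w ^ (j + 1) * (δ n ^ 2 * Real.sqrt n)
        ≤ C * 4 ^ (j + 1) * (δ n ^ 2 * Real.sqrt n) := by gcongr
      _ = _ := by ring
  have hΦn : Φ ≤ A * (r ^ 2 * Real.sqrt n) := hΦC.trans (by
    gcongr; exact le_mul_of_one_le_right hC0.le hκ)
  have hΦm : Φ ≤ A * (r ^ 2 * Real.sqrt (m n)) := by
    refine hΦC.trans ?_
    calc C * (r ^ 2 * Real.sqrt n) ≤ C * (r ^ 2 * (κ * Real.sqrt (m n))) := by gcongr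
      _ = _ := by rw [hA]; ring
  have hF := fun D (hD : D ∈ G.sieveBall θ₀ θ (𝒟 n) r) => h.mem_sieveBall hD
  have b1 := (supMeanLE_midLog hXZ.iid_X hn h.isBracket hF hr0 hΦ0 (hJ (j + 1)) hA1
    hΦn).measure_le (t := n * (4 ^ j * δ n ^ 2 / 64)) (by positivity)
  have b2 := (supMeanLE_midLog_one_sub (hXZ.iid_fake θ) hm h.isBracket hF hr0 hΦ0 (hJ (j + 1)) hA1
    hΦm).measure_le (t := m n * (4 ^ j * δ n ^ 2 / 64)) (by positivity)
  have hn' : (0 : ℝ) < n := by exact_mod_cast hn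
  have hm' : (0 : ℝ) < m n := by exact_mod_cast hm
  -- Markov's inequality divides the entropy growth `w ^ (j + 1)` by the drift `4 ^ j`, leaving a
  -- geometric factor below 1.
  have e1 : 729 * A * (Real.sqrt n * Φ) / (n * (4 ^ j * δ n ^ 2 / 64)) ≤
      729 * A * C * κ * 64 * w * (w / 4) ^ j := by
    have : 729 * A * (Real.sqrt n * Φ) / (n * (4 ^ j * δ n ^ 2 / 64)) =
        729 * A * C * 1 * 64 * w * (w / 4) ^ j := by
      rw [hΦ]
      generalize Real.sqrt (n : ℝ) = y at *
      rw [← hsn2, div_pow]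
      field_simp
      ring
    rw [this]
    gcongr
  have e2 : 729 * A * (Real.sqrt (m n) * Φ) / (m n * (4 ^ j * δ n ^ 2 / 64)) ≤
      729 * A * C * κ * 64 * w * (w / 4) ^ j := by
    have h1 : 729 * A * (Real.sqrt (m n) * Φ) / (m n * (4 ^ j * δ n ^ 2 / 64)) =
        729 * A * C * (Real.sqrt n / Real.sqrt (m n)) * 64 * w * (w / 4) ^ j := by
      rw [hΦ]
      generalize Real.sqrt (m n : ℝ) = y at *
      rw [← hsm2, div_pow]
      field_simp
      ring
    rw [h1]
    gcongr
    rw [div_le_iff₀ hsm]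
    exact hκn
  calc _ ≤ Pr ({ω | ∃ D : G.sieveBall θ₀ θ (𝒟 n) r, n * (4 ^ j * δ n ^ 2 / 64) ≤
          |centeredSum (G.law θ₀) n (fun k => X k ω) fun x => midLog (G.oracle θ₀ θ x) (D.1 x)|} ∪
        {ω | ∃ D : G.sieveBall θ₀ θ (𝒟 n) r, m n * (4 ^ j * δ n ^ 2 / 64) ≤
          |centeredSum (G.law θ) (m n) (fun k => G.T θ (Z k ω))
            fun x => midLog (1 - G.oracle θ₀ θ x) (1 - D.1 x)|}) := by
        refine measure_mono ?_
        rintro ω ⟨D, hD, hd | hd⟩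
        · refine Or.inl ⟨⟨D, hD⟩, ?_⟩
          rw [le_div_iff₀ hn'] at hd
          linarith
        · refine Or.inr ⟨⟨D, hD⟩, ?_⟩
          rw [le_div_iff₀ hm'] at hd
          linarith
    _ ≤ ENNReal.ofReal (729 * A * C * κ * 64 * w * (w / 4) ^ j) +
        ENNReal.ofReal (729 * A * C * κ * 64 * w * (w / 4) ^ j) :=
        (measure_union_le _ _).trans (add_le_add (b1.trans (ENNReal.ofReal_le_ofReal e1))
          (b2.trans (ENNReal.ofReal_le_ofReal e2)))
    _ = _ := by
        rw [← ENNReal.ofReal_add (by positivity) (by positivity)]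
        congr 1
        ring

/-- The classifier converges to the oracle at the rate `δ`. -/
theorem SieveAssumption.dist_Dhat_le [IsProbabilityMeasure Pr] (hXZ : G.IsSampling θ₀ Pr X Z)
    (h : G.SieveAssumption θ₀ θ Pr X Z m 𝒟 Dhat δ 𝓑) {ε : ℝ} (hε : 0 < ε) :
    ∃ J : ℕ, ∀ᶠ n in atTop,
      Pr {ω | 2 ^ J * δ n < G.dist θ₀ θ (Dhat n ω) (G.oracle θ₀ θ)} ≤ ENNReal.ofReal ε := by
  obtain ⟨R, hR, hRmax⟩ := h.approx_max
  obtain ⟨K, hK⟩ := hR (ε / 2) (by positivity)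
  obtain ⟨w, L, hw0, hw4, hL, hshell⟩ := h.shell_bound hXZ
  have hw1 : w / 4 < 1 := by linarith
  have hw1' : 0 < 1 - w / 4 := by linarith
  -- `J₁` makes the geometric tail at most `ε / 2`; `J₂` makes the drift dominate the optimization
  -- error `R`.
  obtain ⟨J₁, hJ₁⟩ := exists_pow_lt_of_lt_one
    (show 0 < ε / 2 * (1 - w / 4) / L by positivity) hw1
  obtain ⟨J₂, hJ₂⟩ := pow_unbounded_of_one_lt (16 * K) (by norm_num : (1 : ℝ) < 4)
  set J := max J₁ J₂ with hJ
  refine ⟨J, ?_⟩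
  filter_upwards [hK, hshell, eventually_gt_atTop 0] with n hKn hsn hn
  have hδ := h.rate_pos n
  set E : ℕ → Set Ω := fun j => {ω | ∃ D ∈ G.sieveBall θ₀ θ (𝒟 n) (2 ^ (j + 1) * δ n),
        4 ^ j * δ n ^ 2 / 64 ≤ |centeredSum (G.law θ₀) n (fun k => X k ω)
          fun x => midLog (G.oracle θ₀ θ x) (D x)| / n ∨
        4 ^ j * δ n ^ 2 / 64 ≤ |centeredSum (G.law θ) (m n) (fun k => G.T θ (Z k ω))
          fun x => midLog (1 - G.oracle θ₀ θ x) (1 - D x)| / m n} with hE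
  have hsub : {ω | 2 ^ J * δ n < G.dist θ₀ θ (Dhat n ω) (G.oracle θ₀ θ)} ⊆
      {ω | K * δ n ^ 2 < |R n ω|} ∪ ⋃ i : ℕ, E (J + i) := by
    intro ω hω
    by_cases hRω : K * δ n ^ 2 < |R n ω|
    · exact Or.inl hRω
    right
    push Not at hRω
    set D := Dhat n ω with hD
    set t := G.dist θ₀ θ D (G.oracle θ₀ θ) with ht
    have hω' : 2 ^ J * δ n < t := hω
    have hex : ∃ i : ℕ, t ≤ 2 ^ (J + i + 1) * δ n := by
      obtain ⟨i, hi⟩ := pow_unbounded_of_one_lt (t / δ n) (by norm_num : (1 : ℝ) < 2)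
      refine ⟨i, ?_⟩
      rw [div_lt_iff₀ hδ] at hi
      refine hi.le.trans ?_
      gcongr
      · norm_num
      · omega
    classical
    -- The least such `i` identifies the shell `2 ^ (J + i) δ < t ≤ 2 ^ (J + i + 1) δ`; for `i = 0`
    -- the lower bound is the assumed one.
    set i := Nat.find hex with hi
    have hi1 : t ≤ 2 ^ (J + i + 1) * δ n := Nat.find_spec hex
    have hi2 : 2 ^ (J + i) * δ n < t := by
      rcases Nat.eq_zero_or_pos i with h0 | h0
      · rw [h0, add_zero]; exact hω'
      · have := Nat.find_min hex (m := i - 1) (by omega)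
        rw [show J + (i - 1) + 1 = J + i by omega] at this
        exact not_le.1 this
    refine mem_iUnion.2 ⟨i, D, ⟨h.Dhat_mem n ω, hi1⟩, ?_⟩
    have hsv := h.sieve n D (h.Dhat_mem n ω)
    have hb := dist_sq_le_of_crossEntropy hn (h.m_pos n) hsv.1 hsv.2 (hRmax n ω)
    -- In units of `4 ^ (J + i) δ²`, two centered sums below `1 / 64` and an error term at most `1 /
    -- 32` total less than `1 / 16`, which the drift exceeds.
    by_contra hcon
    push Not at hcon
    obtain ⟨hc1, hc2⟩ := hcon
    have h4 : (4 : ℝ) ^ (J + i) * δ n ^ 2 < t ^ 2 := by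
      have h5 : ((2 : ℝ) ^ (J + i) * δ n) ^ 2 < t ^ 2 :=
        pow_lt_pow_left₀ hi2 (by positivity) two_ne_zero
      rwa [mul_pow, ← pow_mul, mul_comm (J + i) 2, pow_mul,
        show (2 : ℝ) ^ 2 = 4 by norm_num] at h5
    have h6 : 16 * K * δ n ^ 2 ≤ 4 ^ (J + i) * δ n ^ 2 := by
      gcongr
      refine hJ₂.le.trans ?_
      apply pow_le_pow_right₀ (by norm_num)
      exact (le_max_right J₁ J₂).trans (Nat.le_add_right _ _)
    linarith
  have hgeo : ∑' i : ℕ, ENNReal.ofReal (L * (w / 4) ^ (J + i)) ≤ ENNReal.ofReal (ε / 2) := by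
    have h1 : HasSum (fun i : ℕ => L * (w / 4) ^ (J + i)) (L * (w / 4) ^ J * (1 - w / 4)⁻¹) := by
      have := (hasSum_geometric_of_lt_one (by positivity : 0 ≤ w / 4) hw1).mul_left
        (L * (w / 4) ^ J)
      simpa only [pow_add, mul_assoc] using this
    rw [← ENNReal.ofReal_tsum_of_nonneg (fun i => by positivity) h1.summable, h1.tsum_eq]
    apply ENNReal.ofReal_le_ofReal
    have h2 : (w / 4) ^ J ≤ (w / 4) ^ J₁ :=
      pow_le_pow_of_le_one (by positivity) hw1.le (le_max_left _ _)
    have h3 := h2.trans hJ₁.le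
    rw [le_div_iff₀ hL] at h3
    rw [← div_eq_mul_inv, div_le_iff₀ hw1']
    linarith
  calc _ ≤ Pr {ω | K * δ n ^ 2 < |R n ω|} + Pr (⋃ i : ℕ, E (J + i)) :=
        (measure_mono hsub).trans (measure_union_le _ _)
    _ ≤ ENNReal.ofReal (ε / 2) + ENNReal.ofReal (ε / 2) := by
        refine add_le_add hKn ((measure_iUnion_le _).trans ?_)
        exact (ENNReal.tsum_le_tsum fun i => hsn (J + i)).trans hgeo
    _ = ENNReal.ofReal ε := by
        rw [← ENNReal.ofReal_add (by positivity) (by positivity), add_halves]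

end GenerativeModel

section LogRatio

variable {Ω 𝒳 : Type*} [MeasurableSpace Ω] [MeasurableSpace 𝒳]

/-! ### Moments of log-ratios -/

/-- The moments of `log (a / k)` in terms of those of `√(a / k) - 1` and the tail of `k / a`. -/
lemma log_ratio_pointwise {a k : ℝ} (ha : 0 < a) (hk : 0 < k) :
    Real.log (a / k) ^ 2 * Real.exp (1 / 2 * |Real.log (a / k)|) ≤
        7 * (Real.sqrt (a / k) - 1) ^ 2 + 4 * (if 25 / 16 ≤ k / a then k / a else 0) ∧
      |Real.log (a / k)| ≤
        3 * |Real.sqrt (a / k) - 1| + (if 25 / 16 ≤ k / a then k / a else 0) ∧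
      (if 25 / 16 ≤ k / a then (1 : ℝ) else 0) ≤ 5 * |Real.sqrt (a / k) - 1| := by
  have hy : 0 < Real.sqrt (a / k) := Real.sqrt_pos.2 (by positivity)
  have hy2 : Real.sqrt (a / k) ^ 2 = a / k := Real.sq_sqrt (by positivity)
  have hz : k / a = (Real.sqrt (a / k) ^ 2)⁻¹ := by rw [hy2, inv_div]
  rw [log_eq_two_log_sqrt (by positivity : 0 ≤ a / k), hz]
  clear hz hy2
  generalize Real.sqrt (a / k) = y at *
  have hif0 : 0 ≤ if 25 / 16 ≤ (y ^ 2)⁻¹ then (y ^ 2)⁻¹ else 0 := by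
    split_ifs <;> positivity
  -- Three ranges matter: `y ≥ 1`; `4 / 5 < y ≤ 1`, where `1 / y` is bounded; and `y ≤ 4 / 5`, which
  -- is the tail event `y⁻² ≥ 25 / 16`. There the tail term dominates and `1 - y ≥ 1 / 5`.
  rcases le_total 1 y with h1 | h1
  · have h2 : ¬ (25 / 16 ≤ (y ^ 2)⁻¹) := by
      rw [not_le]
      have : (y ^ 2)⁻¹ ≤ 1 := inv_le_one_of_one_le₀ (by nlinarith)
      linarith
    have h3 := two_log_sq_mul_exp_le h1
    have h4 := Real.log_le_sub_one_of_pos hy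
    have h5 := Real.log_nonneg h1
    rw [if_neg h2, if_neg h2, abs_of_nonneg (by linarith : 0 ≤ y - 1)] at *
    refine ⟨by nlinarith [sq_nonneg (y - 1)], ?_, by linarith⟩
    rw [abs_of_nonneg (by linarith)]
    linarith
  · have h3 := two_log_sq_mul_exp_le_of_le_one hy h1
    have h4 := Real.log_le_sub_one_of_pos (inv_pos.2 hy)
    rw [Real.log_inv] at h4
    have h5 := Real.log_nonpos hy.le h1
    have hinv : 1 ≤ y⁻¹ := (one_le_inv₀ hy).2 h1
    have habs : |2 * Real.log y| ≤ 2 * (y⁻¹ - 1) := by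
      rw [abs_of_nonpos (by linarith)]; linarith
    have hfac : y⁻¹ - 1 = y⁻¹ * (1 - y) := by field_simp
    rw [abs_of_nonpos (by linarith : y - 1 ≤ 0)]
    by_cases h2 : 25 / 16 ≤ (y ^ 2)⁻¹
    · rw [if_pos h2, if_pos h2]
      rw [← inv_pow] at h2 ⊢
      have h6 : 5 / 4 ≤ y⁻¹ := by nlinarith
      have h7 : y ≤ 4 / 5 := by
        have := inv_anti₀ (by norm_num) h6
        rw [inv_inv] at this
        norm_num at this
        linarith
      refine ⟨by nlinarith [sq_nonneg (y - 1)], ?_, by linarith⟩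
      nlinarith [sq_nonneg (y⁻¹ - 1)]
    · rw [if_neg h2, if_neg h2]
      rw [not_le, ← inv_pow] at h2
      have h6 : y⁻¹ ≤ 5 / 4 := by nlinarith
      refine ⟨?_, ?_, by linarith⟩
      · rw [hfac, mul_pow] at h3
        nlinarith [mul_le_mul_of_nonneg_right h2.le (sq_nonneg (1 - y)), sq_nonneg (y - 1)]
      · rw [hfac] at habs
        nlinarith [mul_le_mul_of_nonneg_right h6 (sub_nonneg.2 h1)]

/-- A bound for the conditional mean bounds the integral over the event. -/
lemma setLIntegral_le_of_cond {P : Measure 𝒳} [IsProbabilityMeasure P] {A : Set 𝒳}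
    {g : 𝒳 → ℝ≥0∞} {M : ℝ≥0∞} (h : ∫⁻ x, g x ∂P[|A] ≤ M) :
    ∫⁻ x in A, g x ∂P ≤ M * P A := by
  rcases eq_or_ne (P A) 0 with h0 | h0
  · rw [Measure.restrict_eq_zero.2 h0]; simp
  · rw [ProbabilityTheory.cond, lintegral_smul_measure, smul_eq_mul] at h
    calc ∫⁻ x in A, g x ∂P = P A * ((P A)⁻¹ * ∫⁻ x in A, g x ∂P) := by
          rw [← mul_assoc, ENNReal.mul_inv_cancel h0 (measure_ne_top P A), one_mul]
      _ ≤ P A * M := by gcongr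
      _ = M * P A := mul_comm _ _

lemma log_ratio_moments {P : Measure 𝒳} [IsProbabilityMeasure P] {a k : 𝒳 → ℝ}
    (ham : Measurable a) (hkm : Measurable k) (ha : ∀ x, 0 < a x) (hk : ∀ᵐ x ∂P, 0 < k x)
    {B M : ℝ} (hB : 0 ≤ B) (hM : 0 ≤ M)
    (h1 : ∫⁻ x, ENNReal.ofReal |Real.sqrt (a x / k x) - 1| ∂P ≤ ENNReal.ofReal B)
    (h2 : ∫⁻ x, ENNReal.ofReal ((Real.sqrt (a x / k x) - 1) ^ 2) ∂P ≤ ENNReal.ofReal B)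
    (hc : ∫⁻ x, ENNReal.ofReal (k x / a x) ∂P[|{x | 25 / 16 ≤ k x / a x}] ≤ ENNReal.ofReal M) :
    bernMoment P (fun x => Real.log (a x / k x)) ≤ ENNReal.ofReal ((7 + 20 * M) * B) ∧
      ∫⁻ x, ENNReal.ofReal |Real.log (a x / k x)| ∂P ≤ ENNReal.ofReal ((3 + 5 * M) * B) := by
  set A : Set 𝒳 := {x | 25 / 16 ≤ k x / a x} with hA
  have hAm : MeasurableSet A := measurableSet_le measurable_const (hkm.div ham)
  -- On the tail event `|√(a / k) - 1| ≥ 1 / 5`, so its probability is itself of order `B`.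
  -- Multiplied by the bound on the conditional mean, this keeps the tail integral of order `B`.
  have hPA : P A ≤ ENNReal.ofReal (5 * B) := by
    calc P A = ∫⁻ x, A.indicator 1 x ∂P := (lintegral_indicator_one hAm).symm
      _ ≤ ∫⁻ x, ENNReal.ofReal 5 * ENNReal.ofReal |Real.sqrt (a x / k x) - 1| ∂P := by
          refine lintegral_mono_ae ?_
          filter_upwards [hk] with x hx
          have h3 := (log_ratio_pointwise (ha x) hx).2.2
          rw [← ENNReal.ofReal_mul (by norm_num)]
          by_cases hxA : 25 / 16 ≤ k x / a x
          · rw [if_pos hxA] at h3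
            rw [indicator_of_mem (show x ∈ A from hxA), Pi.one_apply, ← ENNReal.ofReal_one]
            exact ENNReal.ofReal_le_ofReal h3
          · rw [indicator_of_notMem (show x ∉ A from hxA)]
            exact zero_le
      _ ≤ ENNReal.ofReal (5 * B) := by
          rw [lintegral_const_mul' _ _ ENNReal.ofReal_ne_top, ENNReal.ofReal_mul (by norm_num)]
          gcongr
  have htail : ∫⁻ x, ENNReal.ofReal (if 25 / 16 ≤ k x / a x then k x / a x else 0) ∂P ≤
      ENNReal.ofReal (M * (5 * B)) := by
    calc _ = ∫⁻ x in A, ENNReal.ofReal (k x / a x) ∂P := by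
          rw [← lintegral_indicator hAm]
          refine lintegral_congr fun x => ?_
          by_cases hxA : 25 / 16 ≤ k x / a x
          · rw [if_pos hxA, indicator_of_mem (show x ∈ A from hxA)]
          · rw [if_neg hxA, indicator_of_notMem (show x ∉ A from hxA), ENNReal.ofReal_zero]
      _ ≤ ENNReal.ofReal M * P A := setLIntegral_le_of_cond hc
      _ ≤ ENNReal.ofReal M * ENNReal.ofReal (5 * B) := by gcongr
      _ = _ := (ENNReal.ofReal_mul hM).symm
  have hym : Measurable fun x => Real.sqrt (a x / k x) - 1 := by fun_prop
  have hif0 : ∀ x, 0 < k x → 0 ≤ if 25 / 16 ≤ k x / a x then k x / a x else 0 := fun x hx => by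
    have := ha x
    split_ifs <;> positivity
  constructor
  · calc bernMoment P (fun x => Real.log (a x / k x))
        ≤ ∫⁻ x, (ENNReal.ofReal 7 * ENNReal.ofReal ((Real.sqrt (a x / k x) - 1) ^ 2) +
            ENNReal.ofReal 4 * ENNReal.ofReal (if 25 / 16 ≤ k x / a x then k x / a x else 0)) ∂P := by
          refine lintegral_mono_ae ?_
          filter_upwards [hk] with x hx
          have := hif0 x hx
          rw [← ENNReal.ofReal_mul (by norm_num), ← ENNReal.ofReal_mul (by norm_num),
            ← ENNReal.ofReal_add (by positivity) (by positivity)]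
          exact ENNReal.ofReal_le_ofReal (log_ratio_pointwise (ha x) hx).1
      _ ≤ ENNReal.ofReal 7 * ENNReal.ofReal B + ENNReal.ofReal 4 * ENNReal.ofReal (M * (5 * B)) := by
          rw [lintegral_add_left (by fun_prop), lintegral_const_mul' _ _ ENNReal.ofReal_ne_top,
            lintegral_const_mul' _ _ ENNReal.ofReal_ne_top]
          gcongr
      _ = _ := by
          rw [← ENNReal.ofReal_mul (by norm_num), ← ENNReal.ofReal_mul (by norm_num),
            ← ENNReal.ofReal_add (by positivity) (by positivity)]
          congr 1; ring
  · calc ∫⁻ x, ENNReal.ofReal |Real.log (a x / k x)| ∂P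
        ≤ ∫⁻ x, (ENNReal.ofReal 3 * ENNReal.ofReal |Real.sqrt (a x / k x) - 1| +
            ENNReal.ofReal (if 25 / 16 ≤ k x / a x then k x / a x else 0)) ∂P := by
          refine lintegral_mono_ae ?_
          filter_upwards [hk] with x hx
          have := hif0 x hx
          rw [← ENNReal.ofReal_mul (by norm_num),
            ← ENNReal.ofReal_add (by positivity) (by positivity)]
          exact ENNReal.ofReal_le_ofReal (log_ratio_pointwise (ha x) hx).2.1
      _ ≤ ENNReal.ofReal 3 * ENNReal.ofReal B + ENNReal.ofReal (M * (5 * B)) := by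
          rw [lintegral_add_left (by fun_prop), lintegral_const_mul' _ _ ENNReal.ofReal_ne_top]
          gcongr
      _ = _ := by
          rw [← ENNReal.ofReal_mul (by norm_num),
            ← ENNReal.ofReal_add (by positivity) (by positivity)]
          congr 1; ring

/-- The moment of the width of a bracket on the logarithmic scale. -/
lemma bernMoment_log_bracket_le {P : Measure 𝒳} {a₁ a₂ k : 𝒳 → ℝ}
    (h : ∀ᵐ x ∂P, 0 < a₁ x ∧ a₁ x ≤ a₂ x ∧ 0 < k x) :
    bernMoment P (fun x => Real.log (a₂ x / k x) - Real.log (a₁ x / k x)) ≤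
      ENNReal.ofReal 4 * ∫⁻ x, ENNReal.ofReal ((Real.sqrt (a₂ x / a₁ x) - 1) ^ 2) ∂P := by
  rw [← lintegral_const_mul' _ _ ENNReal.ofReal_ne_top]
  refine lintegral_mono_ae ?_
  filter_upwards [h] with x ⟨h1, h2, h3⟩
  rw [← ENNReal.ofReal_mul (by norm_num)]
  apply ENNReal.ofReal_le_ofReal
  have h4 : 0 < a₂ x := h1.trans_le h2
  have h5 : Real.log (a₂ x / k x) - Real.log (a₁ x / k x) = Real.log (a₂ x / a₁ x) := by
    rw [Real.log_div h4.ne' h3.ne', Real.log_div h1.ne' h3.ne', Real.log_div h4.ne' h1.ne']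
    ring
  rw [h5]
  exact log_div_sq_mul_exp_le h1 h2

namespace GenerativeModel

variable {Θ 𝒵 : Type*} [MeasurableSpace 𝒵] {G : GenerativeModel Θ 𝒳 𝒵} {θ₀ θ : Θ}
  {𝒟 : ℕ → Set (𝒳 → ℝ)} {δ : ℕ → ℝ} {𝓑 : Set ((𝒳 → ℝ) × (𝒳 → ℝ))}

/-- `P_{θ₀}` does not charge the zeros of its own density, and finiteness of `P_{θ₀}(p_{θ₀} / p_θ)`
excludes the zeros of `p_θ`. Hence the odds of the oracle are the density ratio. -/
lemma TailAssumption.ae_oracle (h : G.TailAssumption θ₀ θ 𝒟 δ 𝓑) :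
    ∀ᵐ x ∂(G.law θ₀), 0 < G.oracle θ₀ θ x ∧ G.oracle θ₀ θ x < 1 ∧
      ENNReal.ofReal (G.oracle θ₀ θ x / (1 - G.oracle θ₀ θ x)) =
        (G.density θ₀ x : ℝ≥0∞) / (G.density θ x : ℝ≥0∞) := by
  have m0 := G.measurable_density θ₀
  have m1 := G.measurable_density θ
  obtain ⟨M, hM, -⟩ := h.ratio_bound
  have h1 : ∀ᵐ x ∂(G.law θ₀), (G.density θ₀ x : ℝ≥0∞) ≠ 0 := by
    rw [law, ae_withDensity_iff (by fun_prop)]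
    exact Eventually.of_forall fun x hx => hx
  have h2 : ∀ᵐ x ∂(G.law θ₀), (G.density θ₀ x : ℝ≥0∞) / (G.density θ x : ℝ≥0∞) < ⊤ :=
    ae_lt_top (by fun_prop) (hM.trans_lt ENNReal.ofReal_lt_top).ne
  filter_upwards [h1, h2] with x hx1 hx2
  have hp0 : (0 : ℝ) < G.density θ₀ x := by
    have : G.density θ₀ x ≠ 0 := by exact_mod_cast hx1
    exact_mod_cast pos_iff_ne_zero.2 this
  have hpn : G.density θ x ≠ 0 := by
    intro h0
    rw [h0, ENNReal.coe_zero, ENNReal.div_zero hx1] at hx2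
    exact lt_irrefl _ hx2
  have hp1 : (0 : ℝ) < G.density θ x := by exact_mod_cast pos_iff_ne_zero.2 hpn
  refine ⟨by unfold oracle; positivity, ?_, ?_⟩
  · rw [oracle, div_lt_one (by positivity)]; linarith
  · have h3 : G.oracle θ₀ θ x / (1 - G.oracle θ₀ θ x) =
        (G.density θ₀ x : ℝ) / (G.density θ x : ℝ) := by
      rw [oracle, one_sub_div (by positivity), add_sub_cancel_left]
      field_simp
    rw [h3, ENNReal.ofReal_div_of_pos hp1]
    simp

/-- A weighted Hellinger integral under `P_{θ₀}`. -/
lemma lintegral_div_oracle_le {k : 𝒳 → ℝ} (hk : Measurable k) (hk0 : ∀ x, 0 ≤ k x) :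
    ∫⁻ x, ENNReal.ofReal (k x / G.oracle θ₀ θ x) ∂(G.law θ₀) ≤
      ∫⁻ x, ENNReal.ofReal (k x) ∂(G.law θ₀ + G.law θ) := by
  have he := G.measurable_oracle θ₀ θ
  have h := lintegral_withDensity_le he (G.oracle_nonneg θ₀ θ) (G.law_eq_withDensity θ₀ θ)
    (g := fun x => k x / G.oracle θ₀ θ x) (k := k) (hk.div he) zero_le_one fun x => ?_
  · simpa using h
  · rcases (G.oracle_nonneg θ₀ θ x).eq_or_lt with h0 | h0
    · rw [← h0]; simpa using hk0 x
    · rw [mul_div_cancel₀ _ h0.ne', one_mul]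

/-- Dividing by `e` undoes the change of measure, so the second moment is at most `d²`. The first
follows from `|y| ≤ r / 2 + y² / (2r)`. Both are stated with the same linear bound, the form taken
by `log_ratio_moments`. -/
lemma sqrt_ratio_moments (h : G.TailAssumption θ₀ θ 𝒟 δ 𝓑) {D : 𝒳 → ℝ} (hD : Measurable D)
    (hD1 : ∀ x, 0 < D x ∧ D x < 1) {r : ℝ} (hr : 0 < r)
    (hd : G.dist θ₀ θ D (G.oracle θ₀ θ) ≤ r) :
    ∫⁻ x, ENNReal.ofReal |Real.sqrt (D x / G.oracle θ₀ θ x) - 1| ∂(G.law θ₀) ≤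
        ENNReal.ofReal (2 * r) ∧
      ∫⁻ x, ENNReal.ofReal ((Real.sqrt (D x / G.oracle θ₀ θ x) - 1) ^ 2) ∂(G.law θ₀) ≤
        ENNReal.ofReal (2 * r) := by
  set e := G.oracle θ₀ θ with hedef
  have he : Measurable e := G.measurable_oracle θ₀ θ
  have hd0 := dist_nonneg (G := G) (θ₀ := θ₀) (θ := θ) D e
  have hd2 := dist_le_two (G := G) (θ₀ := θ₀) (θ := θ) hD he
    (fun x => ⟨(hD1 x).1.le, (hD1 x).2.le⟩)
    fun x => ⟨G.oracle_nonneg θ₀ θ x, G.oracle_le_one θ₀ θ x⟩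
  have hsq : ∫⁻ x, ENNReal.ofReal ((Real.sqrt (D x / e x) - 1) ^ 2) ∂(G.law θ₀) ≤
      ENNReal.ofReal (G.dist θ₀ θ D e ^ 2) := by
    refine le_trans (le_of_eq (lintegral_congr_ae ?_)) ((lintegral_div_oracle_le (θ := θ)
      (k := fun x => (Real.sqrt (D x) - Real.sqrt (e x)) ^ 2) (by fun_prop)
      fun x => sq_nonneg _).trans (lintegral_le_dist_sq hD he (fun x => (hD1 x).2.le)
        (G.oracle_le_one θ₀ θ)))
    filter_upwards [h.ae_oracle] with x hx
    have hx0 : 0 < e x := hx.1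
    have hs := Real.sqrt_pos.2 hx0
    congr 1
    rw [Real.sqrt_div (hD1 x).1.le, ← hedef]
    have h2 := Real.sq_sqrt hx0.le
    generalize Real.sqrt (e x) = s at *
    rw [← h2]
    field_simp
  refine ⟨?_, hsq.trans (ENNReal.ofReal_le_ofReal (by nlinarith))⟩
  calc _ ≤ ∫⁻ x, (ENNReal.ofReal (r / 2) + ENNReal.ofReal (2 * r)⁻¹ *
          ENNReal.ofReal ((Real.sqrt (D x / e x) - 1) ^ 2)) ∂(G.law θ₀) := by
        refine lintegral_mono fun x => ?_
        rw [← ENNReal.ofReal_mul (by positivity), ← ENNReal.ofReal_add (by positivity)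
          (by positivity)]
        apply ENNReal.ofReal_le_ofReal
        set y := Real.sqrt (D x / e x) - 1
        have : 0 ≤ (2 * r)⁻¹ * (|y| - r) ^ 2 := by positivity
        have h3 : (2 * r)⁻¹ * (|y| - r) ^ 2 = r / 2 + (2 * r)⁻¹ * |y| ^ 2 - |y| := by
          field_simp; ring
        rw [sq_abs] at h3
        linarith
    _ ≤ ENNReal.ofReal (r / 2) + ENNReal.ofReal (2 * r)⁻¹ * ENNReal.ofReal (r ^ 2) := by
        rw [lintegral_add_left measurable_const, lintegral_const_mul' _ _ ENNReal.ofReal_ne_top]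
        have : G.dist θ₀ θ D e ^ 2 ≤ r ^ 2 := pow_le_pow_left₀ hd0 hd 2
        gcongr
        · simp
        · exact hsq.trans (ENNReal.ofReal_le_ofReal this)
    _ ≤ _ := by
        rw [← ENNReal.ofReal_mul (by positivity), ← ENNReal.ofReal_add (by positivity)
          (by positivity)]
        apply ENNReal.ofReal_le_ofReal
        have : (2 * r)⁻¹ * r ^ 2 = r / 2 := by field_simp
        linarith

/-- Here the denominator is `1 - e` while the law has density `e`. With `z` the absolute difference
of the roots of `1 - D` and `1 - e`, the inequality `2ab ≤ a² + b²` separates `z² / e`, which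
integrates to at most `d²`, from powers of the odds `W = p_{θ₀} / p_θ`. This mismatch reduces the
second moment to linear order in `r`. -/
lemma sqrt_ratio_moments_one_sub (h : G.TailAssumption θ₀ θ 𝒟 δ 𝓑) : ∃ M : ℝ, 0 < M ∧
    ∀ D : 𝒳 → ℝ, Measurable D → (∀ x, 0 < D x ∧ D x < 1) → ∀ r : ℝ, 0 < r →
    G.dist θ₀ θ D (G.oracle θ₀ θ) ≤ r →
    ∫⁻ x, ENNReal.ofReal |Real.sqrt ((1 - D x) / (1 - G.oracle θ₀ θ x)) - 1| ∂(G.law θ₀) ≤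
        ENNReal.ofReal (M * r) ∧
      ∫⁻ x, ENNReal.ofReal ((Real.sqrt ((1 - D x) / (1 - G.oracle θ₀ θ x)) - 1) ^ 2)
        ∂(G.law θ₀) ≤ ENNReal.ofReal (M * r) := by
  obtain ⟨M₀, hM1, hM2⟩ := h.ratio_bound
  set M := max M₀ 0 with hM
  have hM0 : 0 ≤ M := le_max_right _ _
  refine ⟨M + 1, by positivity, fun D hD hD1 r hr hd => ?_⟩
  set e := G.oracle θ₀ θ with hedef
  have he : Measurable e := G.measurable_oracle θ₀ θ
  have hd0 := dist_nonneg (G := G) (θ₀ := θ₀) (θ := θ) D e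
  set W : 𝒳 → ℝ := fun x => e x / (1 - e x) with hW
  have hWm : Measurable W := he.div (he.const_sub 1)
  have hW1 : ∫⁻ x, ENNReal.ofReal (W x) ∂(G.law θ₀) ≤ ENNReal.ofReal M := by
    refine le_trans (le_of_eq (lintegral_congr_ae ?_))
      (hM1.trans (ENNReal.ofReal_le_ofReal (le_max_left _ _)))
    filter_upwards [h.ae_oracle] with x hx
    exact hx.2.2
  have hW2 : ∫⁻ x, ENNReal.ofReal (W x) ^ 2 ∂(G.law θ₀) ≤ ENNReal.ofReal M := by
    refine le_trans (le_of_eq (lintegral_congr_ae ?_))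
      (hM2.trans (ENNReal.ofReal_le_ofReal (le_max_left _ _)))
    filter_upwards [h.ae_oracle] with x hx
    rw [← hx.2.2]
  set k : 𝒳 → ℝ := fun x => (Real.sqrt (1 - D x) - Real.sqrt (1 - e x)) ^ 2 with hk
  have hkm : Measurable k := by fun_prop
  have hkd : ∫⁻ x, ENNReal.ofReal (k x / e x) ∂(G.law θ₀) ≤ ENNReal.ofReal (r ^ 2) :=
    (lintegral_div_oracle_le hkm fun x => sq_nonneg _).trans
      ((lintegral_one_sub_le_dist_sq hD he (fun x => (hD1 x).1.le) (G.oracle_nonneg θ₀ θ)).trans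
        (ENNReal.ofReal_le_ofReal (pow_le_pow_left₀ hd0 hd 2)))
  have hpt : ∀ᵐ x ∂(G.law θ₀),
      |Real.sqrt ((1 - D x) / (1 - e x)) - 1| ≤ r / 2 * W x + (2 * r)⁻¹ * (k x / e x) ∧
      (Real.sqrt ((1 - D x) / (1 - e x)) - 1) ^ 2 ≤
        r / 2 * (W x ^ 2 + W x) + (2 * r)⁻¹ * (k x / e x) ∧ 0 ≤ W x ∧ 0 < e x := by
    filter_upwards [h.ae_oracle] with x ⟨hx1, hx2, _⟩
    have hx1 : 0 < e x := hx1
    have hx2 : 0 < 1 - e x := sub_pos.2 hx2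
    have hs0 : 0 < Real.sqrt (1 - e x) := Real.sqrt_pos.2 hx2
    have ht0 : 0 < Real.sqrt (e x) := Real.sqrt_pos.2 hx1
    have hs2 := Real.sq_sqrt hx2.le
    have ht2 := Real.sq_sqrt hx1.le
    have hq0 := Real.sqrt_nonneg (1 - D x)
    have hq1 : Real.sqrt (1 - D x) ≤ 1 := Real.sqrt_le_one.2 (by linarith [(hD1 x).1])
    have hs1 : Real.sqrt (1 - e x) ≤ 1 := Real.sqrt_le_one.2 (by linarith)
    have hW0 : 0 ≤ W x := by simp only [hW]; positivity
    refine ⟨?_, ?_, hW0, hx1⟩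
    all_goals
      simp only [hW, hk]
      rw [Real.sqrt_div (by linarith [(hD1 x).2])]
      set z := |Real.sqrt (1 - D x) - Real.sqrt (1 - e x)| with hz
      have hz2 : (Real.sqrt (1 - D x) - Real.sqrt (1 - e x)) ^ 2 = z ^ 2 := (sq_abs _).symm
      have hz1 : z ≤ 1 := abs_le.2 ⟨by linarith, by linarith⟩
      have hz0 : 0 ≤ z := abs_nonneg _
      have hy : |Real.sqrt (1 - D x) / Real.sqrt (1 - e x) - 1| = z / Real.sqrt (1 - e x) := by
        rw [hz, ← abs_of_pos hs0, ← abs_div, abs_of_pos hs0, sub_div, div_self hs0.ne']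
      rw [hz2]
    · rw [hy]
      generalize Real.sqrt (1 - e x) = s at *
      generalize Real.sqrt (e x) = t at *
      rw [← hs2, ← ht2]
      have h0 : 0 ≤ (2 * r)⁻¹ * (r * (t / s) - z / t) ^ 2 := by positivity
      have h1 : (2 * r)⁻¹ * (r * (t / s) - z / t) ^ 2 =
          r / 2 * (t ^ 2 / s ^ 2) + (2 * r)⁻¹ * (z ^ 2 / t ^ 2) - z / s := by
        field_simp; ring
      linarith
    · rw [← sq_abs, hy]
      have hsum : Real.sqrt (1 - e x) ^ 2 = 1 - Real.sqrt (e x) ^ 2 := by rw [hs2, ht2]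
      generalize Real.sqrt (1 - e x) = s at *
      generalize Real.sqrt (e x) = t at *
      rw [← ht2, ← hsum]
      have h0 : 0 ≤ (2 * r)⁻¹ * (r * (t / s ^ 2) - z / t) ^ 2 := by positivity
      have h1 : (2 * r)⁻¹ * (r * (t / s ^ 2) - z / t) ^ 2 =
          r / 2 * (t ^ 2 / (s ^ 2) ^ 2) + (2 * r)⁻¹ * (z ^ 2 / t ^ 2) - z / s ^ 2 := by
        field_simp; ring
      have h2 : (t ^ 2 / s ^ 2) ^ 2 + t ^ 2 / s ^ 2 = t ^ 2 / (s ^ 2) ^ 2 := by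
        have : t ^ 2 + s ^ 2 = 1 := by linarith
        calc (t ^ 2 / s ^ 2) ^ 2 + t ^ 2 / s ^ 2 = t ^ 2 * (t ^ 2 + s ^ 2) / (s ^ 2) ^ 2 := by
              field_simp
          _ = _ := by rw [this, mul_one]
      -- The bound `z ≤ 1` gives up one power of `z`; the remaining weight `t² / s⁴` equals `W² + W`
      -- because `t² + s² = 1`, hence the need for two moments of the ratio.
      have h3 : (z / s) ^ 2 ≤ z / s ^ 2 := by
        rw [div_pow]
        gcongr
        nlinarith
      rw [h2]
      linarith
  have hrr : (2 * r)⁻¹ * r ^ 2 = r / 2 := by field_simp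
  constructor
  · calc _ ≤ ∫⁻ x, (ENNReal.ofReal (r / 2) * ENNReal.ofReal (W x) +
          ENNReal.ofReal (2 * r)⁻¹ * ENNReal.ofReal (k x / e x)) ∂(G.law θ₀) := by
          refine lintegral_mono_ae ?_
          filter_upwards [hpt] with x ⟨h1, _, h3, h4⟩
          have : 0 ≤ k x / e x := div_nonneg (sq_nonneg _) h4.le
          rw [← ENNReal.ofReal_mul (by positivity), ← ENNReal.ofReal_mul (by positivity),
            ← ENNReal.ofReal_add (by positivity) (by positivity)]
          exact ENNReal.ofReal_le_ofReal h1
      _ ≤ ENNReal.ofReal (r / 2) * ENNReal.ofReal M +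
          ENNReal.ofReal (2 * r)⁻¹ * ENNReal.ofReal (r ^ 2) := by
          rw [lintegral_add_left (by fun_prop), lintegral_const_mul' _ _ ENNReal.ofReal_ne_top,
            lintegral_const_mul' _ _ ENNReal.ofReal_ne_top]
          gcongr
      _ ≤ _ := by
          rw [← ENNReal.ofReal_mul (by positivity), ← ENNReal.ofReal_mul (by positivity),
            ← ENNReal.ofReal_add (by positivity) (by positivity), hrr]
          apply ENNReal.ofReal_le_ofReal
          nlinarith
  · calc _ ≤ ∫⁻ x, (ENNReal.ofReal (r / 2) * (ENNReal.ofReal (W x) ^ 2 + ENNReal.ofReal (W x)) +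
          ENNReal.ofReal (2 * r)⁻¹ * ENNReal.ofReal (k x / e x)) ∂(G.law θ₀) := by
          refine lintegral_mono_ae ?_
          filter_upwards [hpt] with x ⟨_, h1, h3, h4⟩
          have : 0 ≤ k x / e x := div_nonneg (sq_nonneg _) h4.le
          rw [← ENNReal.ofReal_pow h3, ← ENNReal.ofReal_add (by positivity) h3,
            ← ENNReal.ofReal_mul (by positivity), ← ENNReal.ofReal_mul (by positivity),
            ← ENNReal.ofReal_add (by positivity) (by positivity)]
          exact ENNReal.ofReal_le_ofReal h1
      _ ≤ ENNReal.ofReal (r / 2) * (ENNReal.ofReal M + ENNReal.ofReal M) +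
          ENNReal.ofReal (2 * r)⁻¹ * ENNReal.ofReal (r ^ 2) := by
          rw [lintegral_add_left (by fun_prop), lintegral_const_mul' _ _ ENNReal.ofReal_ne_top,
            lintegral_const_mul' _ _ ENNReal.ofReal_ne_top, lintegral_add_left (by fun_prop)]
          gcongr
      _ ≤ _ := by
          rw [← ENNReal.ofReal_add hM0 hM0, ← ENNReal.ofReal_mul (by positivity),
            ← ENNReal.ofReal_mul (by positivity),
            ← ENNReal.ofReal_add (by positivity) (by positivity), hrr]
          apply ENNReal.ofReal_le_ofReal
          nlinarith

end GenerativeModel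

end LogRatio

section Sqrt

variable {Ω 𝒳 : Type*} [MeasurableSpace Ω] [MeasurableSpace 𝒳]

/-! ### The rate of convergence of the residual -/

/-- The maximal inequality for brackets whose squared size is proportional to the distance. The
chain stops at brackets of distance of order `t`. -/
theorem IsIIDSample.supMeanLE_bracketing_sqrt {Pr : Measure Ω}
    [IsProbabilityMeasure Pr] {P : Measure 𝒳} [IsProbabilityMeasure P] {X : ℕ → Ω → 𝒳}
    (hX : IsIIDSample Pr P X) {n : ℕ} (hn : 0 < n) {𝓑 : Set ((𝒳 → ℝ) × (𝒳 → ℝ))}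
    {F : Set (𝒳 → ℝ)} {d : (𝒳 → ℝ) → (𝒳 → ℝ) → ℝ} {r Φ t : ℝ} (hr : 0 < r) (hΦ : 0 ≤ Φ)
    (ht : 0 < t) (htr : t ≤ r)
    (hJ : bracketingIntegral 𝓑 r F d ≤ ENNReal.ofReal Φ)
    {τ : (𝒳 → ℝ) × (𝒳 → ℝ) → (𝒳 → ℝ) × (𝒳 → ℝ)} {f : (𝒳 → ℝ) → 𝒳 → ℝ}
    (hτm : ∀ b ∈ 𝓑, Measurable (τ b).1 ∧ Measurable (τ b).2)
    (hfm : ∀ D ∈ F, Measurable (f D))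
    (hf : ∀ b ∈ 𝓑, ∀ᵐ x ∂P, ∀ D ∈ F, b.1 x ≤ D x → D x ≤ b.2 x →
      (τ b).1 x ≤ f D x ∧ f D x ≤ (τ b).2 x)
    {C : ℝ} (hC : 0 < C)
    (hbr : ∀ b ∈ 𝓑, d b.1 b.2 ≤ r →
      bernMoment P (fun x => (τ b).2 x - (τ b).1 x) ≤ ENNReal.ofReal (C * d b.1 b.2))
    {s : ℝ} (hs0 : 0 ≤ s) (hs : ∀ D ∈ F, bernMoment P (f D) ≤ ENNReal.ofReal s) :
    SupMeanLE Pr (fun (D : F) ω => centeredSum P n (fun k => X k ω) (f D))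
      (64 * (Φ / r) ^ 2 + 2 * n * (s + C * r) +
        320 * (Real.sqrt n * Real.sqrt (2 * C / t) * Φ) + 2 * n * Real.sqrt (C * t)) := by
  have hex : ∃ q : ℕ, (1 / 2 : ℝ) ^ q * r ≤ t := by
    obtain ⟨q, hq⟩ := exists_pow_lt_of_lt_one (div_pos ht hr) (by norm_num : (1 / 2 : ℝ) < 1)
    exact ⟨q, ((lt_div_iff₀ hr).1 hq).le⟩
  classical
  -- The chain stops at the first dyadic radius below `t`, which is then at least `t / 2`; if `Q =
  -- 0` this uses `t ≤ r`.
  set Q := Nat.find hex with hQ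
  have hQ1 : (1 / 2 : ℝ) ^ Q * r ≤ t := Nat.find_spec hex
  have hQ2 : t / 2 ≤ (1 / 2 : ℝ) ^ Q * r := by
    rcases Nat.eq_zero_or_pos Q with h0 | h0
    · rw [h0, pow_zero, one_mul]; linarith
    · have h1 := not_le.1 (Nat.find_min hex (m := Q - 1) (by omega))
      have h2 : (1 / 2 : ℝ) ^ Q = (1 / 2) ^ (Q - 1) * (1 / 2) := by
        rw [← pow_succ]; congr 1; omega
      rw [h2]; linarith
  have hρ2 : Real.sqrt (1 / 2) ^ 2 = 1 / 2 := Real.sq_sqrt (by norm_num)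
  have hρ0 := Real.sqrt_nonneg (1 / 2)
  have hpow : ∀ q : ℕ, Real.sqrt (1 / 2) ^ q = Real.sqrt ((1 / 2) ^ q) := fun q => by
    rw [Real.sqrt_eq_rpow, Real.sqrt_eq_rpow, ← Real.rpow_natCast, ← Real.rpow_natCast,
      ← Real.rpow_mul (by norm_num), ← Real.rpow_mul (by norm_num), mul_comm]
  have hσq : ∀ q : ℕ, (Real.sqrt (C * r) * Real.sqrt (1 / 2) ^ q) ^ 2 = C * ((1 / 2) ^ q * r) := by
    intro q
    rw [mul_pow, Real.sq_sqrt (by positivity), hpow, Real.sq_sqrt (by positivity)]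
    ring
  have hs2 : Real.sqrt s ^ 2 = s := Real.sq_sqrt hs0
  refine (hX.supMeanLE_bracketing hn hr hΦ hJ hτm hfm hf (σ := Real.sqrt (C * r))
    (ρ := Real.sqrt (1 / 2)) (Real.sqrt_pos.2 (by positivity))
    (Real.le_sqrt_of_sq_le (by norm_num)) (Real.sqrt_le_iff.2 (by norm_num))
    (fun q b hb hq => (hbr b hb ?_).trans (ENNReal.ofReal_le_ofReal ?_))
    (s := Real.sqrt s) (fun D hD => by rw [hs2]; exact hs D hD) (c := 1 / 4) (by norm_num)
    le_rfl Q).mono ?_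
  · exact hq.le.trans (mul_le_of_le_one_left hr.le (pow_le_one₀ (by norm_num) (by norm_num)))
  · rw [hσq]
    gcongr
  · have h1 : 2 * (1 / 4 : ℝ)⁻¹ * (2 * (2 * Φ / r) ^ 2 + n * ((1 / 4) ^ 2 *
        (4 * (Real.sqrt s ^ 2 + Real.sqrt (C * r) ^ 2)))) =
        64 * (Φ / r) ^ 2 + 2 * n * (s + C * r) := by
      rw [hs2, Real.sq_sqrt (by positivity)]
      ring
    have h2 : Real.sqrt (C * r) * Real.sqrt (1 / 2) ^ Q ≤ Real.sqrt (C * t) := by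
      apply Real.le_sqrt_of_sq_le
      rw [hσq]
      gcongr
    have h3 : Real.sqrt (C * r) * ((2 * Real.sqrt (1 / 2)) ^ Q * (2 * Φ / r)) ≤
        2 * (Real.sqrt (2 * C / t) * Φ) := by
      -- The square of the left side is `C` divided by the final radius `(1 / 2) ^ Q * r ≥ t / 2`:
      -- the cost of stopping early enough.
      have h4 : Real.sqrt (C * r) * (2 * Real.sqrt (1 / 2)) ^ Q / r ≤ Real.sqrt (2 * C / t) := by
        apply Real.le_sqrt_of_sq_le
        have h5 : (Real.sqrt (C * r) * (2 * Real.sqrt (1 / 2)) ^ Q / r) ^ 2 =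
            C / ((1 / 2) ^ Q * r) := by
          rw [div_pow, mul_pow, Real.sq_sqrt (by positivity), ← pow_mul, mul_comm Q 2, pow_mul,
            mul_pow, hρ2]
          rw [one_div, inv_pow]
          norm_num
          field_simp
        rw [h5, div_le_div_iff₀ (by positivity) ht]
        nlinarith
      calc _ = 2 * (Real.sqrt (C * r) * (2 * Real.sqrt (1 / 2)) ^ Q / r * Φ) := by ring
        _ ≤ _ := by gcongr
    have h6 : Real.sqrt n * Real.sqrt (C * r) * ((2 * Real.sqrt (1 / 2)) ^ Q * (2 * Φ / r)) ≤
        Real.sqrt n * (2 * (Real.sqrt (2 * C / t) * Φ)) := by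
      rw [mul_assoc]
      gcongr
    have h7 : 2 * (n : ℝ) * (Real.sqrt (C * r) * Real.sqrt (1 / 2) ^ Q) ≤
        2 * n * Real.sqrt (C * t) := by gcongr
    rw [h1]
    linarith

/-- The constant in the maximal inequality at the scale of the rate. -/
def rateConst (A B C c s : ℝ) : ℝ :=
  64 * (A / c) ^ 2 * B + 2 * (s + C * c) + 320 * (Real.sqrt (2 * C * B / c) * A) +
    2 * Real.sqrt (C * c / B)

/-- At the scale of the rate, the chain that stops at squared radius yields the rate itself. -/
theorem IsIIDSample.supMeanLE_bracketing_rate {Pr : Measure Ω}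
    [IsProbabilityMeasure Pr] {P : Measure 𝒳} [IsProbabilityMeasure P] {X : ℕ → Ω → 𝒳}
    (hX : IsIIDSample Pr P X) {n : ℕ} (hn : 0 < n) {𝓑 : Set ((𝒳 → ℝ) × (𝒳 → ℝ))}
    {F : Set (𝒳 → ℝ)} {d : (𝒳 → ℝ) → (𝒳 → ℝ) → ℝ} {A B c δ : ℝ} (hδ : 0 < δ) (hδB : δ ≤ B)
    (hc : 0 < c) (hA : 0 ≤ A)
    (hJ : bracketingIntegral 𝓑 (c * δ) F d ≤ ENNReal.ofReal (A * (δ ^ 2 * Real.sqrt n)))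
    {τ : (𝒳 → ℝ) × (𝒳 → ℝ) → (𝒳 → ℝ) × (𝒳 → ℝ)} {f : (𝒳 → ℝ) → 𝒳 → ℝ}
    (hτm : ∀ b ∈ 𝓑, Measurable (τ b).1 ∧ Measurable (τ b).2)
    (hfm : ∀ D ∈ F, Measurable (f D))
    (hf : ∀ b ∈ 𝓑, ∀ᵐ x ∂P, ∀ D ∈ F, b.1 x ≤ D x → D x ≤ b.2 x →
      (τ b).1 x ≤ f D x ∧ f D x ≤ (τ b).2 x)
    {C : ℝ} (hC : 0 < C)
    (hbr : ∀ b ∈ 𝓑, d b.1 b.2 ≤ c * δ →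
      bernMoment P (fun x => (τ b).2 x - (τ b).1 x) ≤ ENNReal.ofReal (C * d b.1 b.2))
    {s : ℝ} (hs0 : 0 ≤ s) (hs : ∀ D ∈ F, bernMoment P (f D) ≤ ENNReal.ofReal (s * δ)) :
    SupMeanLE Pr (fun (D : F) ω => centeredSum P n (fun k => X k ω) (f D))
      (rateConst A B C c s * (n * δ)) := by
  have hB : 0 < B := hδ.trans_le hδB
  have hsn : 0 < Real.sqrt n := Real.sqrt_pos.2 (by exact_mod_cast hn)
  have hsn2 : Real.sqrt n ^ 2 = n := Real.sq_sqrt (by positivity)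
  have htr : c / B * δ ^ 2 ≤ c * δ := by
    rw [div_mul_eq_mul_div, div_le_iff₀ hB]
    calc c * δ ^ 2 = c * δ * δ := by ring
      _ ≤ c * δ * B := by gcongr
  -- The stopping radius is of order `δ²`, so that the remainder `n √t` and the chaining cost `√n Φ
  -- / √t` are both of order `n δ`. The factor `c / B` guarantees that it does not exceed the
  -- initial radius `c δ`.
  refine (hX.supMeanLE_bracketing_sqrt hn (by positivity) (by positivity)
    (t := c / B * δ ^ 2) (by positivity) htr hJ hτm hfm hf hC hbr (by positivity) hs).mono ?_
  have h1 : 64 * (A * (δ ^ 2 * Real.sqrt n) / (c * δ)) ^ 2 ≤ 64 * (A / c) ^ 2 * B * (n * δ) := by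
    have : 64 * (A * (δ ^ 2 * Real.sqrt n) / (c * δ)) ^ 2 = 64 * (A / c) ^ 2 * δ * (n * δ) := by
      generalize Real.sqrt (n : ℝ) = y at *
      rw [← hsn2]
      field_simp
    rw [this]
    gcongr
  have h2 : Real.sqrt (2 * C / (c / B * δ ^ 2)) = Real.sqrt (2 * C * B / c) / δ := by
    rw [show 2 * C / (c / B * δ ^ 2) = 2 * C * B / c / δ ^ 2 by field_simp,
      Real.sqrt_div (by positivity), Real.sqrt_sq hδ.le]
  have h3 : Real.sqrt (C * (c / B * δ ^ 2)) = Real.sqrt (C * c / B) * δ := by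
    rw [show C * (c / B * δ ^ 2) = C * c / B * δ ^ 2 by ring, Real.sqrt_mul (by positivity),
      Real.sqrt_sq hδ.le]
  have h4 : Real.sqrt n * (Real.sqrt (2 * C * B / c) / δ) * (A * (δ ^ 2 * Real.sqrt n)) =
      Real.sqrt (2 * C * B / c) * A * (n * δ) := by
    generalize Real.sqrt (n : ℝ) = y at *
    rw [← hsn2]
    field_simp
  rw [h2, h3, h4, rateConst]
  linarith

lemma abs_empMean_le {n : ℕ} (hn : 0 < n) {P : Measure 𝒳} (Y : ℕ → 𝒳) {g : 𝒳 → ℝ}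
    {B t : ℝ} (hB : 0 ≤ B) (hg : ∫⁻ x, ENNReal.ofReal |g x| ∂P ≤ ENNReal.ofReal B)
    (ht : |centeredSum P n Y g| ≤ n * t) : |empMean n Y g| ≤ t + B := by
  have hn' : (0 : ℝ) < n := by exact_mod_cast hn
  rw [GenerativeModel.empMean_eq_centeredSum hn P]
  refine (abs_add_le _ _).trans (add_le_add ?_ ?_)
  · rw [abs_div, abs_of_pos hn', div_le_iff₀ hn']
    linarith
  · have h1 := norm_integral_le_lintegral_norm (μ := P) g
    simp only [Real.norm_eq_abs] at h1
    exact h1.trans (ENNReal.toReal_le_of_le_ofReal hB hg)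

end Sqrt

/-! ### Log-ratios over sieve balls and the residual. -/

namespace GenerativeModel

variable {Ω 𝒳 𝒵 Θ : Type*} [MeasurableSpace Ω] [MeasurableSpace 𝒳] [MeasurableSpace 𝒵]
  {G : GenerativeModel Θ 𝒳 𝒵} {θ₀ θ : Θ}
  {Pr : Measure Ω} {X : ℕ → Ω → 𝒳} {Z : ℕ → Ω → 𝒵} {m : ℕ → ℕ} {𝒟 : ℕ → Set (𝒳 → ℝ)}
  {Dhat : ℕ → Ω → 𝒳 → ℝ} {δ : ℕ → ℝ} {𝓑 : Set ((𝒳 → ℝ) × (𝒳 → ℝ))}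

/-- The moments of the log-ratios over a ball of the sieve. -/
lemma logRatio_moments (h₁ : G.SieveAssumption θ₀ θ Pr X Z m 𝒟 Dhat δ 𝓑)
    (h₂ : G.TailAssumption θ₀ θ 𝒟 δ 𝓑) {K : ℝ} (hK : 0 < K) :
    ∃ s : ℝ, 0 < s ∧ ∀ᶠ n in atTop, ∀ D ∈ G.sieveBall θ₀ θ (𝒟 n) (K * δ n),
      (bernMoment (G.law θ₀) (fun x => Real.log (D x / G.oracle θ₀ θ x)) ≤
        ENNReal.ofReal (s * δ n) ∧
      ∫⁻ x, ENNReal.ofReal |Real.log (D x / G.oracle θ₀ θ x)| ∂(G.law θ₀) ≤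
        ENNReal.ofReal (s * δ n)) ∧
      (bernMoment (G.law θ₀) (fun x => Real.log ((1 - D x) / (1 - G.oracle θ₀ θ x))) ≤
        ENNReal.ofReal (s * δ n) ∧
      ∫⁻ x, ENNReal.ofReal |Real.log ((1 - D x) / (1 - G.oracle θ₀ θ x))| ∂(G.law θ₀) ≤
        ENNReal.ofReal (s * δ n)) := by
  obtain ⟨M₀, hM₀⟩ := h₂.tail_bound K hK
  obtain ⟨L, hL, hLr⟩ := sqrt_ratio_moments_one_sub h₂
  set M := max M₀ 0 with hM
  have hM0 : 0 ≤ M := le_max_right _ _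
  set N := max L 2 with hN
  have hN0 : 0 < N := hL.trans_le (le_max_left _ _)
  refine ⟨(7 + 20 * M) * (N * K), by positivity, ?_⟩
  filter_upwards [hM₀] with n hn D hD
  have hδ := h₁.rate_pos n
  obtain ⟨hDm, hD1, hDd⟩ := h₁.mem_sieveBall hD
  have hMM := ENNReal.ofReal_le_ofReal (le_max_left M₀ 0)
  have hae := h₂.ae_oracle
  have hN2 : ENNReal.ofReal (2 * (K * δ n)) ≤ ENNReal.ofReal (N * (K * δ n)) :=
    ENNReal.ofReal_le_ofReal (by gcongr; exact le_max_right _ _)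
  have hNL : ENNReal.ofReal (L * (K * δ n)) ≤ ENNReal.ofReal (N * (K * δ n)) :=
    ENNReal.ofReal_le_ofReal (by gcongr; exact le_max_left _ _)
  have a1 := sqrt_ratio_moments h₂ hDm hD1 (by positivity) hDd
  have a2 := hLr D hDm hD1 _ (by positivity) hDd
  have r1 := log_ratio_moments hDm (G.measurable_oracle θ₀ θ) (fun x => (hD1 x).1)
    (hae.mono fun x hx => hx.1) (by positivity) hM0 (a1.1.trans hN2) (a1.2.trans hN2)
    ((hn D hD).1.trans hMM)
  have r2 := log_ratio_moments (hDm.const_sub 1) ((G.measurable_oracle θ₀ θ).const_sub 1)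
    (fun x => sub_pos.2 (hD1 x).2) (hae.mono fun x hx => sub_pos.2 hx.2.1) (by positivity) hM0
    (a2.1.trans hNL) (a2.2.trans hNL) ((hn D hD).2.trans hMM)
  have c1 : (7 + 20 * M) * (N * (K * δ n)) = (7 + 20 * M) * (N * K) * δ n := by ring
  have c2 : ENNReal.ofReal ((3 + 5 * M) * (N * (K * δ n))) ≤
      ENNReal.ofReal ((7 + 20 * M) * (N * (K * δ n))) := by
    apply ENNReal.ofReal_le_ofReal
    apply mul_le_mul_of_nonneg_right _ (by positivity)
    linarith
  rw [← c1]
  exact ⟨⟨r1.1, r1.2.trans c2⟩, r2.1, r2.2.trans c2⟩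

/-- The centered sums of the log-ratios over a ball of the sieve. -/
lemma supMeanLE_logRatio [IsProbabilityMeasure Pr] (hXZ : G.IsSampling θ₀ Pr X Z)
    (h₁ : G.SieveAssumption θ₀ θ Pr X Z m 𝒟 Dhat δ 𝓑) (h₂ : G.TailAssumption θ₀ θ 𝒟 δ 𝓑)
    (J : ℕ) :
    ∃ L : ℝ, ∀ᶠ n in atTop,
      SupMeanLE Pr (fun (D : G.sieveBall θ₀ θ (𝒟 n) (2 ^ J * δ n)) ω =>
        centeredSum (G.law θ₀) n (fun k => X k ω)
          fun x => Real.log (D.1 x / G.oracle θ₀ θ x)) (L * (n * δ n)) ∧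
      SupMeanLE Pr (fun (D : G.sieveBall θ₀ θ (𝒟 n) (2 ^ J * δ n)) ω =>
        centeredSum (G.law θ₀) n (fun k => X k ω)
          fun x => Real.log ((1 - D.1 x) / (1 - G.oracle θ₀ θ x))) (L * (n * δ n)) := by
  obtain ⟨w, C, hw0, -, hC, hent⟩ := h₁.entropy_dyadic
  obtain ⟨s, hs, hmom⟩ := logRatio_moments h₁ h₂ (K := 2 ^ J) (by positivity)
  obtain ⟨B, hB⟩ := h₁.rate_bdd
  obtain ⟨C₁, hC₁⟩ := h₂.bracket_bigO
  obtain ⟨r₀, hr₀, hlit⟩ := h₂.bracket_littleO 1 one_pos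
  have hB0 : 0 < B := (h₁.rate_pos 0).trans_le (hB 0)
  -- The chain starts at radius `c δ ≤ r₀`, where the little-o condition applies, although the class
  -- is the whole ball of radius `2 ^ J δ`.
  set c := min 1 (r₀ / B) with hc
  have hc0 : 0 < c := lt_min one_pos (by positivity)
  -- The lower-upper quotient contributes `4 C₁ d² ≤ 8 C₁ d` when `C₁ ≥ 0`, by `d ≤ 2`; the
  -- complementary one contributes `4 d`, from the choice `η = 1`.
  set C' := max (8 * C₁) 4 with hC'
  have hC'0 : 0 < C' := by have := le_max_right (8 * C₁) 4; linarith
  set A := C * w ^ J with hA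
  have hA0 : 0 ≤ A := by positivity
  refine ⟨rateConst A B C' c s, ?_⟩
  filter_upwards [hent, hmom, eventually_gt_atTop 0] with n hJ hmn hn
  have hδ := h₁.rate_pos n
  have hae := h₂.ae_oracle
  have hem := G.measurable_oracle θ₀ θ
  have hcr : c * δ n ≤ r₀ := by
    calc c * δ n ≤ r₀ / B * B := by
          gcongr
          · exact min_le_right _ _
          · exact hB n
      _ = r₀ := by field_simp
  have hJ' := (bracketingIntegral_mono (𝓑 := 𝓑)
    (F := G.sieveBall θ₀ θ (𝒟 n) (2 ^ J * δ n)) (d := G.dist θ₀ θ)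
    (show c * δ n ≤ 2 ^ J * δ n by
      gcongr
      exact (min_le_left _ _).trans (one_le_pow₀ (by norm_num)))).trans (hJ J)
  have hbd : ∀ b ∈ 𝓑, 0 ≤ G.dist θ₀ θ b.1 b.2 ∧ G.dist θ₀ θ b.1 b.2 ≤ 2 := fun b hb =>
    ⟨dist_nonneg _ _, dist_le_two (h₁.isBracket b hb).1 (h₁.isBracket b hb).2.1
      (fun x => ⟨((h₁.isBracket b hb).2.2 x).1, ((h₁.isBracket b hb).2.2 x).2.1.trans
        ((h₁.isBracket b hb).2.2 x).2.2⟩)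
      (fun x => ⟨((h₁.isBracket b hb).2.2 x).1.trans ((h₁.isBracket b hb).2.2 x).2.1,
        ((h₁.isBracket b hb).2.2 x).2.2⟩)⟩
  constructor
  · refine hXZ.iid_X.supMeanLE_bracketing_rate (f := fun D x => Real.log (D x / G.oracle θ₀ θ x))
      (τ := fun b => (fun x => Real.log (b.1 x / G.oracle θ₀ θ x),
        fun x => Real.log (b.2 x / G.oracle θ₀ θ x))) hn hδ (hB n) hc0 hA0 hJ'
      (fun b hb => ⟨((h₁.isBracket b hb).1.div hem).log, ((h₁.isBracket b hb).2.1.div hem).log⟩)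
      (fun D hD => ((h₁.mem_sieveBall hD).1.div hem).log) (fun b hb => ?_) hC'0
      (fun b hb _ => ?_) hs.le fun D hD => (hmn D hD).1.1
    -- Monotonicity of the logarithm needs a positive lower bracket and oracle, which hold only
    -- almost surely.
    · filter_upwards [hae, h₂.bracket_pos b hb] with x hx hxb D hD h3 h4
      have := hx.1
      exact ⟨Real.log_le_log (div_pos hxb.1 hx.1) (by gcongr),
        Real.log_le_log (div_pos (hxb.1.trans_le h3) hx.1) (by gcongr)⟩
    · refine (bernMoment_log_bracket_le ?_).trans
        ((mul_le_mul_right (hC₁ b hb) (ENNReal.ofReal 4)).trans ?_)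
      · filter_upwards [hae, h₂.bracket_pos b hb] with x hx hxb
        exact ⟨hxb.1, ((h₁.isBracket b hb).2.2 x).2.1, hx.1⟩
      · rw [← ENNReal.ofReal_mul (by norm_num)]
        apply ENNReal.ofReal_le_ofReal
        rw [dist_comm]
        obtain ⟨d0, d2⟩ := hbd b hb
        have h5 : 8 * C₁ ≤ C' := le_max_left _ _
        rcases le_total 0 C₁ with h6 | h6
        · nlinarith [mul_nonneg h6 (mul_nonneg d0 (sub_nonneg.2 d2)),
            mul_le_mul_of_nonneg_right h5 d0]
        · nlinarith [mul_nonneg (neg_nonneg.2 h6) (sq_nonneg (G.dist θ₀ θ b.1 b.2)),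
            mul_nonneg hC'0.le d0]
  · refine hXZ.iid_X.supMeanLE_bracketing_rate
      (f := fun D x => Real.log ((1 - D x) / (1 - G.oracle θ₀ θ x)))
      (τ := fun b => (fun x => Real.log ((1 - b.2 x) / (1 - G.oracle θ₀ θ x)),
        fun x => Real.log ((1 - b.1 x) / (1 - G.oracle θ₀ θ x)))) hn hδ (hB n) hc0 hA0 hJ'
      (fun b hb => ⟨(((h₁.isBracket b hb).2.1.const_sub 1).div (hem.const_sub 1)).log,
        (((h₁.isBracket b hb).1.const_sub 1).div (hem.const_sub 1)).log⟩)
      (fun D hD => (((h₁.mem_sieveBall hD).1.const_sub 1).div (hem.const_sub 1)).log)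
      (fun b hb => ?_) hC'0 (fun b hb hbc => ?_) hs.le fun D hD => (hmn D hD).2.1
    · filter_upwards [hae, h₂.bracket_pos b hb] with x hx hxb D hD h3 h4
      have h5 : 0 < 1 - G.oracle θ₀ θ x := sub_pos.2 hx.2.1
      have h6 : 0 < 1 - b.2 x := sub_pos.2 hxb.2
      exact ⟨Real.log_le_log (div_pos h6 h5) (by gcongr),
        Real.log_le_log (div_pos (by linarith) h5) (by gcongr)⟩
    · rw [dist_comm] at hbc ⊢
      refine (bernMoment_log_bracket_le ?_).trans
        ((mul_le_mul_right (hlit b hb (hbc.trans hcr)) (ENNReal.ofReal 4)).trans ?_)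
      · filter_upwards [hae, h₂.bracket_pos b hb] with x hx hxb
        exact ⟨sub_pos.2 hxb.2, by linarith [((h₁.isBracket b hb).2.2 x).2.1], sub_pos.2 hx.2.1⟩
      · rw [← ENNReal.ofReal_mul (by norm_num), one_mul]
        apply ENNReal.ofReal_le_ofReal
        exact mul_le_mul_of_nonneg_right (le_max_right _ _) (dist_nonneg _ _)

/-- The mean residual is of the order of the rate. -/
theorem isBigOP_residual [IsProbabilityMeasure Pr] (hXZ : G.IsSampling θ₀ Pr X Z)
    (h₁ : G.SieveAssumption θ₀ θ Pr X Z m 𝒟 Dhat δ 𝓑) (h₂ : G.TailAssumption θ₀ θ 𝒟 δ 𝓑) :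
    IsBigOP Pr (fun n ω => G.residual θ₀ θ n (fun i => X i ω) (Dhat n ω) / (n : ℝ)) δ := by
  intro ε hε
  obtain ⟨J, hJ⟩ := h₁.dist_Dhat_le hXZ (ε := ε / 2) (by positivity)
  obtain ⟨L, hL⟩ := supMeanLE_logRatio hXZ h₁ h₂ J
  obtain ⟨s, hs, hmom⟩ := logRatio_moments h₁ h₂ (K := 2 ^ J) (by positivity)
  -- With this level Markov's inequality gives `ε / 4` for each of the two centered sums; leaving
  -- the ball accounts for the other `ε / 2`.
  set t : ℝ := 4 * (|L| + 1) / ε with ht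
  have ht0 : 0 < t := by positivity
  refine ⟨2 * (t + s), ?_⟩
  filter_upwards [hJ, hL, hmom, eventually_gt_atTop 0] with n hJn hLn hmn hn
  have hδ := h₁.rate_pos n
  have hn' : (0 : ℝ) < n := by exact_mod_cast hn
  have hbound : L * (n * δ n) / (n * (t * δ n)) ≤ ε / 4 := by
    have h1 : L * (n * δ n) / (n * (t * δ n)) = L / t := by field_simp
    rw [h1, div_le_iff₀ ht0, ht]
    have : ε / 4 * (4 * (|L| + 1) / ε) = |L| + 1 := by field_simp
    rw [this]
    linarith [le_abs_self L]
  have b1 := (hLn.1.measure_le (t := n * (t * δ n)) (by positivity)).trans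
    (ENNReal.ofReal_le_ofReal hbound)
  have b2 := (hLn.2.measure_le (t := n * (t * δ n)) (by positivity)).trans
    (ENNReal.ofReal_le_ofReal hbound)
  refine (measure_mono ?_).trans ((measure_union_le _ _).trans
    ((add_le_add hJn ((measure_union_le _ _).trans (add_le_add b1 b2))).trans (le_of_eq ?_)))
  · intro ω hω
    by_contra hcon
    simp only [mem_union, mem_ofPred_eq, not_or, not_exists, not_le, not_lt] at hcon
    obtain ⟨hd, hc1, hc2⟩ := hcon
    have hmem : Dhat n ω ∈ G.sieveBall θ₀ θ (𝒟 n) (2 ^ J * δ n) := ⟨h₁.Dhat_mem n ω, hd⟩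
    have e1 := abs_empMean_le hn (fun i => X i ω) (by positivity) (hmn _ hmem).1.2
      (hc1 ⟨_, hmem⟩).le
    have e2 := abs_empMean_le hn (fun i => X i ω) (by positivity) (hmn _ hmem).2.2
      (hc2 ⟨_, hmem⟩).le
    have e3 : G.residual θ₀ θ n (fun i => X i ω) (Dhat n ω) / (n : ℝ) =
        empMean n (fun i => X i ω)
          (fun x => Real.log ((1 - Dhat n ω x) / (1 - G.oracle θ₀ θ x))) -
        empMean n (fun i => X i ω) (fun x => Real.log (Dhat n ω x / G.oracle θ₀ θ x)) := by
      simp only [residual, residualTerm, empMean, Finset.sum_sub_distrib, sub_div]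
    have e4 : 2 * (t + s) * δ n < |G.residual θ₀ θ n (fun i => X i ω) (Dhat n ω) / (n : ℝ)| := hω
    rw [e3] at e4
    have e5 := abs_sub (empMean n (fun i => X i ω)
      (fun x => Real.log ((1 - Dhat n ω x) / (1 - G.oracle θ₀ θ x))))
      (empMean n (fun i => X i ω) (fun x => Real.log (Dhat n ω x / G.oracle θ₀ θ x)))
    linarith
  · rw [← ENNReal.ofReal_add (by positivity) (by positivity),
      ← ENNReal.ofReal_add (by positivity) (by positivity)]
    congr 1
    ring

end GenerativeModel

end MHC

end

theorem theorem1 {Θ 𝒳 𝒵 Ω : Type*} [MeasurableSpace 𝒳] [MeasurableSpace 𝒵] [MeasurableSpace Ω]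
    (G : MHC.GenerativeModel Θ 𝒳 𝒵) (θ₀ θ : Θ)
    (Pr : Measure Ω) [IsProbabilityMeasure Pr] (X : ℕ → Ω → 𝒳) (Z : ℕ → Ω → 𝒵)
    (hXZ : G.IsSampling θ₀ Pr X Z)
    (m : ℕ → ℕ) (𝒟 : ℕ → Set (𝒳 → ℝ)) (Dhat : ℕ → Ω → 𝒳 → ℝ) (δ : ℕ → ℝ)
    (𝓑 : Set ((𝒳 → ℝ) × (𝒳 → ℝ)))
    (h₁ : G.SieveAssumption θ₀ θ Pr X Z m 𝒟 Dhat δ 𝓑)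
    (h₂ : G.TailAssumption θ₀ θ 𝒟 δ 𝓑) :
    (∀ n ω, G.residual θ₀ θ n (fun i => X i ω) (Dhat n ω) / (n : ℝ) =
      MHC.empMean n (fun i => X i ω) (fun x =>
        Real.log ((1 - Dhat n ω x) / (1 - G.oracle θ₀ θ x)) -
          Real.log (Dhat n ω x / G.oracle θ₀ θ x))) ∧
    MHC.IsBigOP Pr
      (fun n ω => G.residual θ₀ θ n (fun i => X i ω) (Dhat n ω) / (n : ℝ)) δ := by
  exact ⟨fun _ _ => rfl, MHC.GenerativeModel.isBigOP_residual hXZ h₁ h₂⟩
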